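/- Let $\mathbb F$ be $\mathbb R$ or $\mathbb C$, $c\in\{1,2\}$, $N\ge 1$, let $\alpha_1>\dots>\alpha_N\ge 1$ and $m_1,\dots,m_N\ge 1$ be integers, and $\varepsilon\in\{1,-1\}$. Put $\mu_r=m_r$ if $c+\alpha_r$ is even, $\mu_r=2m_r$ if $c+\alpha_r$ is odd, and $n=\sum_{r=1}^N\alpha_r\mu_r$. Let $J_a(0)$ be the $a\times a$ nilpotent upper Jordan block and $\Gamma_a$ the $a\times a$ matrix with entries $(-1)^{i-1}$ at the positions $(i,a+1-i)$ and $0$ elsewhere. Set $$\mathcal A=\bigoplus_{r=1}^N\bigoplus_{j=1}^{m_r}A_r,\qquad H=\bigoplus_{r=1}^N\bigoplus_{j=1}^{m_r}H_r,\qquad \mathcal R=\varepsilon e^{\mathcal A},$$ where $A_r=J_{\alpha_r}(0)$, $H_r=\Gamma_{\alpha_r}$ if $c+\alpha_r$ is even, and $A_r=J_{\alpha_r}(0)\oplus -J_{\alpha_r}(0)^T$, $H_r=\begin{bmatrix}0&I\\(-1)^{c+1}I&0\end{bmatrix}$ if $c+\alpha_r$ is odd. Let $G=\{Q\in GL_n(\mathbb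 F): Q^THQ=H\}$, i.e. $G=O_n(\mathbb F,H)$ ($H$ nonsingular symmetric) for $c=1$ and $G=Sp_n(\mathbb F,H)$ ($H$ nonsingular skew-symmetric) for $c=2$. Then $\mathcal A^TH=-H\mathcal A$ and $\mathcal R\in G$. Let $\Sigma_G(\mathcal A)=\{Q\in G:Q^{-1}\mathcal AQ=\mathcal A\}$ and $C_G(\mathcal R)=\{Q\in G:Q^{-1}\mathcal RQ=\mathcal R\}$. **Notation.** $\mathbb T^{\alpha,\mu}$ is the set of nonsingular block matrices $\mathcal X=[\mathcal X_{rs}]_{r,s=1}^N$, where $\mathcal X_{rs}$ is an $\alpha_r\times\alpha_s$ block matrix with blocks of size $\mu_r\times\mu_s$, equal to $[0\ \ \mathcal T_{rs}]$, $\begin{bmatrix}\mathcal T_{rs}\\0\end{bmatrix}$, $\mathcal T_{rs}$ for $\alpha_r<\alpha_s$, $\alpha_r>\alpha_s$, $\alpha_r=\alpha_s$, respectively, with $\mathcal T_{rs}=T(A_0^{rs},\dots,A_{b_{rs}-1}^{rs})$ the block upper triangular Toeplitz matrix whose first block row is $(A_0^{rs},\dots,A_{b_{rs}-1}^{rs})$,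 $b_{rs}=\min\{\alpha_r,\alpha_s\}$, and all $A_0^{rr}$ nonsingular. Put $B_r=(-1)^cI_{m_r}$ if $c+\alpha_r$ is even and $B_r=\begin{bmatrix}0&I_{m_r}\\-I_{m_r}&0\end{bmatrix}$ if $c+\alpha_r$ is odd. Let $G_r=O_{m_r}(\mathbb F)$ if $c+\alpha_r$ is even, $G_r=Sp_{2m_r}(\mathbb F)$ if $c+\alpha_r$ is odd. Let $\mathbb O$ be the group of all $\bigoplus_{r=1}^N\bigoplus_{j=1}^{\alpha_r}Q_r$ with $Q_r\in G_r$ (the same $Q_r$ for every $j$). Let $\mathbb U$ be the group generated by the following matrices (a) and (b) in $\mathbb T^{\alpha,\mu}$. (a) $\bigoplus_{r=1}^NT(I,W_1^r,\dots,W_{\alpha_r-1}^r)$, $\ W_j^r=B_r^{-1}\big(Z_j^r-\tfrac12\sum_{k=1}^{j-1}(-1)^k(W_k^r)^TB_rW_{j-k}^r\big)$, for arbitrary $Z_j^r\in\mathbb F^{\mu_r\times\mu_r}$ with $(Z_j^r)^T=(-1)^{\alpha_r-j+c+1}Z_j^r$. (b) For $1\le p<t\le N$, $0\le k\le\alpha_t-1$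 and arbitrary $F\in\mathbb F^{\mu_t\times\mu_p}$: the matrix that agrees with the identity outside the blocks $(p,p),(p,t),(t,p),(t,t)$, where $$\mathcal T_{tp}=N^k_{\alpha_t}(F),\qquad \mathcal T_{pt}=N^k_{\alpha_t}\big((-1)^{k+1}B_p^{-1}F^TB_t\big),\qquad \mathcal T_{rr}=T(I,V_1^r,\dots,V_{\alpha_r-1}^r)\quad(r\in\{p,t\});$$ here $N^k_a(X)$ is the $a\times a$ block matrix with $X$ on the $k$-th block superdiagonal and $0$ elsewhere, $V_j^p=(-1)^{kl}a_{l-1}B_p^{-1}(F^TB_tFB_p^{-1})^lB_p$ and $V_j^t=(-1)^{kl}a_{l-1}B_t^{-1}(B_tFB_p^{-1}F^T)^lB_t$ if $j=l(2k+\alpha_p-\alpha_t)$ for an integer $l\ge1$, $V_j^p=V_j^t=0$ for all other $j\geq 1$, and $a_l=-\frac{1}{2^{2l+1}}\frac1{l+1}\binom{2l}{l}$. Let $\Psi=\Pi U$, where $U=\bigoplus_r\bigoplus_{j=1}^{m_r}U_r$ with $U_r=I_{\alpha_r}$ if $c+\alpha_r$ is even and $U_r=I_{\alpha_r}\oplus(-\Gamma_{\alpha_r})$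 if $c+\alpha_r$ is odd, and $\Pi=\bigoplus_r\Pi_r$ is the permutation matrix for which $\Pi_r$ sends the coordinate $i$ of the $b$-th Jordan chain of the $j$-th copy ($1\le j\le m_r$, $1\le i\le\alpha_r$, $b=1$ or $b\in\{1,2\}$) to position $(b-1)m_r+j$ inside the $i$-th group of $\mu_r$ coordinates. A unipotent group is one consisting of matrices $g$ with $g-I$ nilpotent; the unipotent radical $R_u(C)$ of a matrix group $C$ is its largest normal unipotent subgroup, and $C$ is reductive if $R_u(C)$ is trivial. **Theorem.** The isotropy group and the centralizer coincide, and there is a reductive subgroup $L$ with $$\Sigma_G(\mathcal A)=C_G(\mathcal R)=L\ltimes R_u(C_G(\mathcal R)).$$ 1. $\Psi L\Psi^{-1}=\mathbb O\subset\mathbb T^{\alpha,\mu}$. 2. $\Psi R_u(C_G(\mathcal R))\Psi^{-1}=\mathbb U\subset\mathbb T^{\alpha,\mu}$; matrices (a) and (b) exist in $\mathbb{U}$ for all values of their parameters. 3. $\Psi C_G(\mathcal R)\Psi^{-1}=\mathbb X$, where $\mathbb X=\mathbb O\ltimes\mathbb U\subset\mathbb T^{\alpha,\mu}$ (with $\mathbb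 U$ normal in $\mathbb X$). Every $\mathcal X\in\mathbb X$ satisfies: (I) $(A_0^{rr})^TB_rA_0^{rr}=B_r$, and the $A_j^{rs}$ with $r>s$ are free; (II) for $1\le j\le\alpha_r-1$, $A_j^{rr}=A_0^{rr}B_r^{-1}Z_j^r+D_j^r$, where $Z_j^r$ with $(Z_j^r)^T=(-1)^{\alpha_r-j+c+1}Z_j^r$ is arbitrary and $D_j^r$ is a polynomial in the entries of the $A_{j'}^{r'r'}$ with $j'<j$, $r'\le r$, and of the $\mathcal X_{r's'}$ with $r'>s'$; (III) the entries of $\mathcal X_{rs}$ with $r<s$ are polynomials in the entries of the $\mathcal X_{r's'}$ with $r'\ge s'$. For all choices of $A_0^{rr}$ with $(A_0^{rr})^TB_rA_0^{rr}=B_r$, of $A_j^{rs}$ ($r>s$) and of $Z_j^r$ as in (II), there is exactly one $\mathcal X\in\mathbb X$ with these data. 4. (Algorithm.) Write $\Psi_l^{krs}=\sum_{i=0}^l(-1)^i(A_i^{kr})^TB_kA_{l-i}^{ks}$ for $l\ge0$, $\Psi_l^{krs}=0$ for $l<0$, and for $r\le s$ $$D_j^{rs}=\sum_{l=1}^{j-1}(-1)^l(A_l^{rr})^TB_rA_{j-l}^{rs}+\eta_j^{rs}+\sum_{k<r}(-1)^{\alpha_k-\alpha_r}\Psi^{krs}_{j-\alpha_k+\alpha_r}+\sum_{r<k\le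 s}\Psi_j^{krs}+\sum_{k>s}\Psi^{krs}_{j-\alpha_s+\alpha_k},$$ with $\eta_j^{rs}=(-1)^j(A_j^{rr})^TB_rA_0^{rs}$ if $r<s$ and $j\ge1$, and $\eta_j^{rs}=0$ otherwise. Then $D_j^{rs}$ depends only on the $A_{j'}^{r's'}$ with $r'>s'$ and on those with $r'\le s'$ for which $(j',s'-r')$ is lexicographically smaller than $(j,s-r)$. A matrix $\mathcal X\in\mathbb T^{\alpha,\mu}$ belongs to $\mathbb X$ if and only if $(A_0^{rr})^TB_rA_0^{rr}=B_r$ for all $r$ and, for some $Z_j^r$ with $(Z_j^r)^T=(-1)^{\alpha_r-j+c+1}Z_j^r$, $A_j^{rr}=A_0^{rr}B_r^{-1}(Z_j^r-\frac12D_j^{rr})$ for $1\le j<\alpha_r$ and $A_j^{rs}=-A_0^{rr}B_r^{-1}D_j^{rs}$ for $r<s$, $0\le j<\alpha_s$; so $\mathbb X$ is computed recursively. 5. $\mathbb X$ is a closed subgroup, a Lie group over $\mathbb F$ of dimension $$\dim_{\mathbb F}\mathbb X=\sum_{r=1}^N\Big(\tfrac12\alpha_r\mu_r^2+\sum_{s=1}^{r-1}\alpha_r\mu_r\mu_s\Big)+(-1)^c\sum_{\alpha_r\text{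 odd}}\tfrac12\mu_r.$$ 6. For $\mathbb F=\mathbb R$, $H$ is real congruent to $I_n$ or $-I_n$ if and only if $c=1$, $N=1$, $\alpha_1=1$. Further, $\mathcal A=0$ if and only if $N=1$, $\alpha_1=1$. If $c=1$, $N=1$, $\alpha_1=1$, then $G=O_n(\mathbb R)$, $\mathcal R=\varepsilon I_n$ and $C_G(\pm I_n)=\Sigma_G(0)=O_n(\mathbb R)$. -/

import Mathlib

open Matrix
open scoped Kronecker

/-! ### Matrix groups given by a bilinear form, stabilizers, unipotent radicals -/

namespace BlockToeplitz

/-- The group `{Q ∈ GL | Qᵀ H Q = H}`: the `H`-orthogonal group if `H` is nonsingular symmetric,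
the `H`-symplectic group if `H` is nonsingular skew-symmetric. -/
def formGroup {ι 𝕜 : Type*} [Fintype ι] [DecidableEq ι] [Field 𝕜] (H : Matrix ι ι 𝕜) :
    Subgroup (GeneralLinearGroup ι 𝕜) where
  carrier := {Q | (Q : Matrix ι ι 𝕜)ᵀ * H * (Q : Matrix ι ι 𝕜) = H}
  one_mem' := by simp
  mul_mem' := by
    intro P Q hP hQ
    simp only [Set.mem_ofPred_eq] at hP hQ ⊢
    calc ((P * Q : GeneralLinearGroup ι 𝕜) : Matrix ι ι 𝕜)ᵀ * H * (P * Q : GeneralLinearGroup ι 𝕜)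
        = (Q : Matrix ι ι 𝕜)ᵀ * ((P : Matrix ι ι 𝕜)ᵀ * H * (P : Matrix ι ι 𝕜))
            * (Q : Matrix ι ι 𝕜) := by
          simp [Matrix.transpose_mul, Matrix.mul_assoc]
      _ = H := by rw [hP, hQ]
  inv_mem' := by
    intro Q hQ
    simp only [Set.mem_ofPred_eq] at hQ ⊢
    have h1 : (Q : Matrix ι ι 𝕜) * ((Q⁻¹ : GeneralLinearGroup ι 𝕜) : Matrix ι ι 𝕜) = 1 :=
      Q.mul_inv
    have h2 : ((Q⁻¹ : GeneralLinearGroup ι 𝕜) : Matrix ι ι 𝕜)ᵀ * (Q : Matrix ι ι 𝕜)ᵀ = 1 := by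
      rw [← Matrix.transpose_mul, h1, Matrix.transpose_one]
    calc ((Q⁻¹ : GeneralLinearGroup ι 𝕜) : Matrix ι ι 𝕜)ᵀ * H
            * ((Q⁻¹ : GeneralLinearGroup ι 𝕜) : Matrix ι ι 𝕜)
        = ((Q⁻¹ : GeneralLinearGroup ι 𝕜) : Matrix ι ι 𝕜)ᵀ
            * ((Q : Matrix ι ι 𝕜)ᵀ * H * (Q : Matrix ι ι 𝕜))
            * ((Q⁻¹ : GeneralLinearGroup ι 𝕜) : Matrix ι ι 𝕜) := by rw [hQ]
      _ = (((Q⁻¹ : GeneralLinearGroup ι 𝕜) : Matrix ι ι 𝕜)ᵀ * (Q : Matrix ι ι 𝕜)ᵀ) * H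
            * ((Q : Matrix ι ι 𝕜) * ((Q⁻¹ : GeneralLinearGroup ι 𝕜) : Matrix ι ι 𝕜)) := by
          simp only [Matrix.mul_assoc]
      _ = H := by rw [h1, h2, Matrix.one_mul, Matrix.mul_one]

/-- `{Q ∈ G | Q⁻¹ M Q = M}`. This is the isotropy group `Σ_G(M)` for the similarity action of `G`
on matrices; if `M ∈ G`, it is the centralizer `C_G(M)`. -/
def stab {ι 𝕜 : Type*} [Fintype ι] [DecidableEq ι] [Field 𝕜]
    (G : Subgroup (GeneralLinearGroup ι 𝕜)) (M : Matrix ι ι 𝕜) :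
    Subgroup (GeneralLinearGroup ι 𝕜) where
  carrier := {Q | Q ∈ G ∧
    ((Q⁻¹ : GeneralLinearGroup ι 𝕜) : Matrix ι ι 𝕜) * M * (Q : Matrix ι ι 𝕜) = M}
  one_mem' := ⟨G.one_mem, by simp⟩
  mul_mem' := by
    rintro P Q ⟨hP, hP'⟩ ⟨hQ, hQ'⟩
    refine ⟨G.mul_mem hP hQ, ?_⟩
    calc (((P * Q)⁻¹ : GeneralLinearGroup ι 𝕜) : Matrix ι ι 𝕜) * M
            * ((P * Q : GeneralLinearGroup ι 𝕜) : Matrix ι ι 𝕜)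
        = ((Q⁻¹ : GeneralLinearGroup ι 𝕜) : Matrix ι ι 𝕜)
            * (((P⁻¹ : GeneralLinearGroup ι 𝕜) : Matrix ι ι 𝕜) * M * (P : Matrix ι ι 𝕜))
            * (Q : Matrix ι ι 𝕜) := by
          rw [_root_.mul_inv_rev, Units.val_mul, Units.val_mul]
          simp only [Matrix.mul_assoc]
      _ = M := by rw [hP', hQ']
  inv_mem' := by
    rintro Q ⟨hQ, hQ'⟩
    refine ⟨G.inv_mem hQ, ?_⟩
    have h1 : (Q : Matrix ι ι 𝕜) * ((Q⁻¹ : GeneralLinearGroup ι 𝕜) : Matrix ι ι 𝕜) = 1 :=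
      Q.mul_inv
    rw [inv_inv]
    calc (Q : Matrix ι ι 𝕜) * M * ((Q⁻¹ : GeneralLinearGroup ι 𝕜) : Matrix ι ι 𝕜)
        = (Q : Matrix ι ι 𝕜) * (((Q⁻¹ : GeneralLinearGroup ι 𝕜) : Matrix ι ι 𝕜) * M
            * (Q : Matrix ι ι 𝕜)) * ((Q⁻¹ : GeneralLinearGroup ι 𝕜) : Matrix ι ι 𝕜) := by
          rw [hQ']
      _ = ((Q : Matrix ι ι 𝕜) * ((Q⁻¹ : GeneralLinearGroup ι 𝕜) : Matrix ι ι 𝕜)) * M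
            * ((Q : Matrix ι ι 𝕜) * ((Q⁻¹ : GeneralLinearGroup ι 𝕜) : Matrix ι ι 𝕜)) := by
          simp only [Matrix.mul_assoc]
      _ = M := by rw [h1, Matrix.one_mul, Matrix.mul_one]

/-- `C = L ⋉ U` (internal semidirect product of subgroups of `C`, with `U` normal in `C`). -/
def IsSemidirect {Γ : Type*} [Group Γ] (C L U : Subgroup Γ) : Prop :=
  L ≤ C ∧ U ≤ C ∧ (U.subgroupOf C).Normal ∧ (L.subgroupOf C).IsComplement' (U.subgroupOf C)

/-- `U` is a normal subgroup of `C` that consists of unipotent matrices. -/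
def IsNormalUnipotent {ι 𝕜 : Type*} [Fintype ι] [DecidableEq ι] [Field 𝕜]
    (C U : Subgroup (GeneralLinearGroup ι 𝕜)) : Prop :=
  U ≤ C ∧ (U.subgroupOf C).Normal ∧ ∀ g ∈ U, IsNilpotent ((g : Matrix ι ι 𝕜) - 1)

/-- `U` is the unipotent radical of `C`: the largest normal unipotent subgroup. -/
def IsUnipotentRadical {ι 𝕜 : Type*} [Fintype ι] [DecidableEq ι] [Field 𝕜]
    (C U : Subgroup (GeneralLinearGroup ι 𝕜)) : Prop :=
  IsNormalUnipotent C U ∧ ∀ V, IsNormalUnipotent C V → V ≤ U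

/-- A matrix group is reductive if its unipotent radical is trivial. -/
def IsReductive {ι 𝕜 : Type*} [Fintype ι] [DecidableEq ι] [Field 𝕜]
    (L : Subgroup (GeneralLinearGroup ι 𝕜)) : Prop :=
  IsUnipotentRadical L ⊥

/-- `X` is a closed subgroup of `GL`, its Lie algebra `{M | exp (t M) ∈ X for all real t}` is a
`𝕜`-subspace, and the `𝕜`-dimension of this Lie algebra is `d`; that is, `X` is a Lie group over
`𝕜` of dimension `d`. -/
def HasDimension {ι 𝕜 : Type*} [Fintype ι] [DecidableEq ι] [RCLike 𝕜]
    (X : Subgroup (GeneralLinearGroup ι 𝕜)) (d : ℕ) : Prop :=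
  IsClosed (X : Set (GeneralLinearGroup ι 𝕜)) ∧
  ∃ 𝔛 : Submodule 𝕜 (Matrix ι ι 𝕜),
    (∀ M, M ∈ 𝔛 ↔ ∀ t : ℝ, ∃ g ∈ X, (g : Matrix ι ι 𝕜) = NormedSpace.exp ((t : 𝕜) • M)) ∧
    Module.finrank 𝕜 𝔛 = d

/-! ### The normal forms -/

/-- The nilpotent Jordan block `J_a(0)`. -/
def jordanZero (𝕜 : Type*) [Field 𝕜] (a : ℕ) : Matrix (Fin a) (Fin a) 𝕜 :=
  Matrix.of fun i j => if (i : ℕ) + 1 = j then 1 else 0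

/-- The exchange matrix `Γ_a` with alternating signs; its upper right entry is `1`. -/
def gammaMat (𝕜 : Type*) [Field 𝕜] (a : ℕ) : Matrix (Fin a) (Fin a) 𝕜 :=
  Matrix.of fun i j => if (i : ℕ) + j + 1 = a then (-1) ^ (i : ℕ) else 0

/-- `1` if `c + a` is even and `2` if `c + a` is odd. -/
def mult (c a : ℕ) : ℕ := if Even (c + a) then 1 else 2

/-- `μ_r = m_r` if `c + α_r` is even and `μ_r = 2 m_r` if `c + α_r` is odd. -/
abbrev mu {N : ℕ} (c : ℕ) (α m : Fin N → ℕ) : Fin N → ℕ := fun r => mult c (α r) * m r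

/-- `J_a(0)` if `c + a` is even, `J_a(0) ⊕ -J_a(0)ᵀ` if `c + a` is odd. A row index `(b, i)` is the
`i`-th row of the `b`-th of the one or two diagonal blocks. -/
def blockA (𝕜 : Type*) [Field 𝕜] (c a : ℕ) :
    Matrix (Fin (mult c a) × Fin a) (Fin (mult c a) × Fin a) 𝕜 :=
  Matrix.of fun x y =>
    if x.1 = y.1 then
      if (x.1 : ℕ) = 0 then jordanZero 𝕜 a x.2 y.2 else -(jordanZero 𝕜 a)ᵀ x.2 y.2
    else 0

/-- `Γ_a` if `c + a` is even, `[[0, I], [(-1)^(c+1) I, 0]]` if `c + a` is odd. -/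
def blockH (𝕜 : Type*) [Field 𝕜] (c a : ℕ) :
    Matrix (Fin (mult c a) × Fin a) (Fin (mult c a) × Fin a) 𝕜 :=
  Matrix.of fun x y =>
    if Even (c + a) then gammaMat 𝕜 a x.2 y.2
    else if x.1 = y.1 then 0
    else if (x.1 : ℕ) = 0 then (1 : Matrix (Fin a) (Fin a) 𝕜) x.2 y.2
    else (-1) ^ (c + 1) * (1 : Matrix (Fin a) (Fin a) 𝕜) x.2 y.2

/-- The row indices of the `n × n` matrices `𝒜` and `H`: block `r`, position in the normal form
block, number of the copy. There are `n = ∑ α_r μ_r` of them. -/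
abbrev NIdx {N : ℕ} (c : ℕ) (α m : Fin N → ℕ) : Type :=
  Σ r : Fin N, (Fin (mult c (α r)) × Fin (α r)) × Fin (m r)

/-- `𝒜 = ⨁_r ⨁_{j=1}^{m_r} A_r`. -/
def matA (𝕜 : Type*) [Field 𝕜] {N : ℕ} (c : ℕ) (α m : Fin N → ℕ) :
    Matrix (NIdx c α m) (NIdx c α m) 𝕜 :=
  Matrix.blockDiagonal' fun r => Matrix.blockDiagonal fun _ : Fin (m r) => blockA 𝕜 c (α r)

/-- `H = ⨁_r ⨁_{j=1}^{m_r} H_r`. -/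
def matH (𝕜 : Type*) [Field 𝕜] {N : ℕ} (c : ℕ) (α m : Fin N → ℕ) :
    Matrix (NIdx c α m) (NIdx c α m) 𝕜 :=
  Matrix.blockDiagonal' fun r => Matrix.blockDiagonal fun _ : Fin (m r) => blockH 𝕜 c (α r)

/-! ### Block matrices with rectangular upper triangular Toeplitz blocks -/

/-- The row indices of a matrix in `𝕋^{α,μ}`: block row `r` is an `α_r`-tuple of block rows of
height `μ_r`. -/
abbrev TIdx {N : ℕ} (α μ : Fin N → ℕ) : Type := Σ r : Fin N, Fin (α r) × Fin (μ r)

/-- A family of matrices `A_j^{rs}` of size `μ_r × μ_s`, `j = 0, 1, 2, …`. -/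
abbrev Coeffs (𝕜 : Type*) {N : ℕ} (μ : Fin N → ℕ) : Type _ :=
  ∀ r s : Fin N, ℕ → Matrix (Fin (μ r)) (Fin (μ s)) 𝕜

/-- The block matrix `[X_rs]` with `X_rs = [0 T]`, `[T; 0]`, `T` for `α_r < α_s`, `α_r > α_s`,
`α_r = α_s`, respectively, where `T` is the square block upper triangular Toeplitz matrix
`T(A_0^{rs}, …, A_{b-1}^{rs})`, `b = min (α_r, α_s)`. The truncated difference `α_s - α_r` is the
number of zero block columns in front of `T`. -/
def toeplitz {𝕜 : Type*} [Field 𝕜] {N : ℕ} (α : Fin N → ℕ) {μ : Fin N → ℕ} (A : Coeffs 𝕜 μ) :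
    Matrix (TIdx α μ) (TIdx α μ) 𝕜 :=
  Matrix.of fun x y =>
    if (α y.1 - α x.1) + (x.2.1 : ℕ) ≤ y.2.1 then
      A x.1 y.1 ((y.2.1 : ℕ) - ((α y.1 - α x.1) + (x.2.1 : ℕ))) x.2.2 y.2.2
    else 0

/-- `𝕋^{α,μ}`. -/
def toeplitzSet (𝕜 : Type*) [Field 𝕜] {N : ℕ} (α μ : Fin N → ℕ) :
    Set (GeneralLinearGroup (TIdx α μ) 𝕜) :=
  {X | ∃ A : Coeffs 𝕜 μ, (X : Matrix (TIdx α μ) (TIdx α μ) 𝕜) = toeplitz α A ∧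
    ∀ r, IsUnit (A r r 0)}

/-- The coefficients `A_j^{rs}` of a matrix in `𝕋^{α,μ}`, read off the first block row of `X_rs`;
they are `0` for `j ≥ min (α_r, α_s)`. -/
def coeff {𝕜 : Type*} [Field 𝕜] {N : ℕ} {α μ : Fin N → ℕ}
    (X : GeneralLinearGroup (TIdx α μ) 𝕜) : Coeffs 𝕜 μ := fun r s j =>
  Matrix.of fun p q =>
    if h : 0 < α r ∧ (α s - α r) + j < α s then
      (X : Matrix (TIdx α μ) (TIdx α μ) 𝕜) ⟨r, ⟨0, h.1⟩, p⟩ ⟨s, ⟨(α s - α r) + j, h.2⟩, q⟩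
    else 0

/-! ### The groups `𝕆`, `𝕌`, `𝕏` -/

/-- For `k = 2 m` this is the standard skew-symmetric matrix `[[0, I_m], [-I_m, 0]]`. -/
def stdSkew (𝕜 : Type*) [Field 𝕜] (k m : ℕ) : Matrix (Fin k) (Fin k) 𝕜 :=
  Matrix.of fun i j => if (j : ℕ) = i + m then 1 else if (i : ℕ) = j + m then -1 else 0

/-- `B_r = (-1)^c I_{m_r}` if `c + α_r` is even, `B_r = [[0, I], [-I, 0]]` if `c + α_r` is odd. -/
def matB (𝕜 : Type*) [Field 𝕜] {N : ℕ} (c : ℕ) (α m : Fin N → ℕ) (r : Fin N) :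
    Matrix (Fin (mu c α m r)) (Fin (mu c α m r)) 𝕜 :=
  if Even (c + α r) then (-1 : 𝕜) ^ c • 1 else stdSkew 𝕜 (mu c α m r) (m r)

/-- `G_r = O_{m_r}` if `c + α_r` is even, `G_r = Sp_{2 m_r}` if `c + α_r` is odd. -/
def groupG (𝕜 : Type*) [Field 𝕜] {N : ℕ} (c : ℕ) (α m : Fin N → ℕ) (r : Fin N) :
    Subgroup (GeneralLinearGroup (Fin (mu c α m r)) 𝕜) :=
  if Even (c + α r) then formGroup 1 else formGroup (stdSkew 𝕜 (mu c α m r) (m r))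

/-- `(Q_r)_r ↦ ⨁_r ⨁_{j=1}^{α_r} Q_r`. -/
def diagHom (𝕜 : Type*) [Field 𝕜] {N : ℕ} (α μ : Fin N → ℕ) :
    (∀ r, Matrix (Fin (μ r)) (Fin (μ r)) 𝕜) →* Matrix (TIdx α μ) (TIdx α μ) 𝕜 where
  toFun Q := Matrix.blockDiagonal' fun r => (1 : Matrix (Fin (α r)) (Fin (α r)) 𝕜) ⊗ₖ Q r
  map_one' := by simp [Matrix.blockDiagonal'_one, ← Pi.one_def]
  map_mul' P Q := by
    rw [← Matrix.blockDiagonal'_mul]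
    congr 1
    funext r
    rw [← Matrix.mul_kronecker_mul, Matrix.one_mul, Pi.mul_apply]

/-- `𝕆 = ⨁_r (⨁_{j=1}^{α_r} G_r)`: the matrices `⨁_r (Q_r ⊕ … ⊕ Q_r)` with `Q_r ∈ G_r`. -/
def groupO (𝕜 : Type*) [Field 𝕜] {N : ℕ} (c : ℕ) (α m : Fin N → ℕ) :
    Subgroup (GeneralLinearGroup (TIdx α (mu c α m)) 𝕜) :=
  (Subgroup.pi Set.univ fun r => groupG 𝕜 c α m r).map
    ((Units.map (diagHom 𝕜 α (mu c α m))).comp MulEquiv.piUnits.symm.toMonoidHom)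

/-- The symmetry condition `(Z_j^r)ᵀ = (-1)^(α_r - j + c + 1) Z_j^r`. -/
def HasSign {𝕜 : Type*} [Field 𝕜] {N : ℕ} (c : ℕ) (α : Fin N → ℕ) {μ : Fin N → ℕ}
    (Z : ∀ r : Fin N, ℕ → Matrix (Fin (μ r)) (Fin (μ r)) 𝕜) : Prop :=
  ∀ r j, 1 ≤ j → j < α r → (Z r j)ᵀ = (-1 : 𝕜) ^ (α r - j + c + 1) • Z r j

/-- `X = ⨁_r T(I, W_1^r, …, W_{α_r-1}^r)` with
`W_j^r = B_r⁻¹ (Z_j^r - ½ ∑_{k=1}^{j-1} (-1)^k (W_k^r)ᵀ B_r W_{j-k}^r)`. -/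
def IsDiagGen {𝕜 : Type*} [Field 𝕜] {N : ℕ} {α μ : Fin N → ℕ}
    (B : ∀ r : Fin N, Matrix (Fin (μ r)) (Fin (μ r)) 𝕜)
    (Z : ∀ r : Fin N, ℕ → Matrix (Fin (μ r)) (Fin (μ r)) 𝕜)
    (X : GeneralLinearGroup (TIdx α μ) 𝕜) : Prop :=
  X ∈ toeplitzSet 𝕜 α μ ∧
  (∀ r s, r ≠ s → ∀ j, coeff X r s j = 0) ∧
  (∀ r, coeff X r r 0 = 1) ∧
  ∀ r j, 1 ≤ j → j < α r →
    coeff X r r j = (B r)⁻¹ * (Z r j - (1 / 2 : 𝕜) • ∑ k ∈ Finset.Ico 1 j,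
      (-1 : 𝕜) ^ k • ((coeff X r r k)ᵀ * B r * coeff X r r (j - k)))

/-- `a_n = -C(n) / 2^(2n+1)`, where `C(n)` is the Catalan number. -/
def catalanCoeff (𝕜 : Type*) [Field 𝕜] (n : ℕ) : 𝕜 := -(catalan n : 𝕜) / 2 ^ (2 * n + 1)

/-- For `p < t` (so that `α_t < α_p`), `0 ≤ k < α_t` and `F` of size `μ_t × μ_p`: the matrix in
`𝕋^{α,μ}` that differs from the identity only in the block rows and columns `p`, `t`, with
`T_tp = N^k(F)`, `T_pt = N^k((-1)^(k+1) B_p⁻¹ Fᵀ B_t)` and unitriangular Toeplitz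
`T_pp`, `T_tt`, whose `j`-th coefficient for `j = n (2k + α_p - α_t)`, `n ≥ 1`, is
`(-1)^(kn) a_{n-1} B_p⁻¹ (Fᵀ B_t F B_p⁻¹)^n B_p`, respectively
`(-1)^(kn) a_{n-1} B_t⁻¹ (B_t F B_p⁻¹ Fᵀ)^n B_t`, and zero for all other `j ≥ 1`. -/
def IsOffDiagGen {𝕜 : Type*} [Field 𝕜] {N : ℕ} {α μ : Fin N → ℕ}
    (B : ∀ r : Fin N, Matrix (Fin (μ r)) (Fin (μ r)) 𝕜)
    (p t : Fin N) (k : ℕ) (F : Matrix (Fin (μ t)) (Fin (μ p)) 𝕜)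
    (X : GeneralLinearGroup (TIdx α μ) 𝕜) : Prop :=
  X ∈ toeplitzSet 𝕜 α μ ∧
  (∀ r, coeff X r r 0 = 1) ∧
  (∀ r, r ≠ p → r ≠ t → ∀ j, 1 ≤ j → coeff X r r j = 0) ∧
  (∀ r s, r ≠ s → ¬ (r = p ∧ s = t) → ¬ (r = t ∧ s = p) → ∀ j, coeff X r s j = 0) ∧
  (∀ j, coeff X t p j = if j = k then F else 0) ∧
  (∀ j, coeff X p t j = if j = k then (-1 : 𝕜) ^ (k + 1) • ((B p)⁻¹ * Fᵀ * B t) else 0) ∧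
  (∀ j, 1 ≤ j → j < α p → coeff X p p j =
    if 2 * k + (α p - α t) ∣ j then
      let n := j / (2 * k + (α p - α t))
      ((-1 : 𝕜) ^ (k * n) * catalanCoeff 𝕜 (n - 1)) •
        ((B p)⁻¹ * (Fᵀ * B t * F * (B p)⁻¹) ^ n * B p)
    else 0) ∧
  (∀ j, 1 ≤ j → j < α t → coeff X t t j =
    if 2 * k + (α p - α t) ∣ j then
      let n := j / (2 * k + (α p - α t))
      ((-1 : 𝕜) ^ (k * n) * catalanCoeff 𝕜 (n - 1)) •
        ((B t)⁻¹ * (B t * F * (B p)⁻¹ * Fᵀ) ^ n * B t)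
    else 0)

/-- `𝕌` is generated by the matrices of the two kinds above. -/
def groupU (𝕜 : Type*) [Field 𝕜] {N : ℕ} (c : ℕ) (α m : Fin N → ℕ) :
    Subgroup (GeneralLinearGroup (TIdx α (mu c α m)) 𝕜) :=
  Subgroup.closure
    ({X | ∃ Z, HasSign c α Z ∧ IsDiagGen (matB 𝕜 c α m) Z X} ∪
     {X | ∃ p t k F, p < t ∧ k < α t ∧ IsOffDiagGen (matB 𝕜 c α m) p t k F X})

/-- `𝕏`, the subgroup generated by `𝕆` and `𝕌`. -/
def groupX (𝕜 : Type*) [Field 𝕜] {N : ℕ} (c : ℕ) (α m : Fin N → ℕ) :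
    Subgroup (GeneralLinearGroup (TIdx α (mu c α m)) 𝕜) :=
  groupO 𝕜 c α m ⊔ groupU 𝕜 c α m

/-! ### The conditions on the blocks of a matrix in `𝕏` -/

/-- The scalar entries of the coefficients `A_j^{rs}`, as polynomial variables:
`⟨(r, s), j, p, q⟩` stands for the entry `(p, q)` of `A_j^{rs}`. -/
abbrev Coord {N : ℕ} (μ : Fin N → ℕ) : Type :=
  Σ rs : Fin N × Fin N, ℕ × Fin (μ rs.1) × Fin (μ rs.2)

/-- Evaluation of a matrix of polynomials at the entries of the coefficients `A_j^{rs}`. -/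
noncomputable def polyEval {𝕜 : Type*} [Field 𝕜] {N : ℕ} {μ : Fin N → ℕ} {k l : Type*}
    (P : Matrix k l (MvPolynomial (Coord μ) 𝕜)) (A : Coeffs 𝕜 μ) : Matrix k l 𝕜 :=
  P.map (MvPolynomial.eval fun x => A x.1.1 x.1.2 x.2.1 x.2.2.1 x.2.2.2)

/-- The matrices in `S` satisfy, for every `r`, `s`:
(I) `(A_0^{rr})ᵀ B_r A_0^{rr} = B_r`, and the `A_j^{rs}` with `r > s` are free;
(II) `A_j^{rr} = A_0^{rr} B_r⁻¹ Z_j^r + D_j^r` for `j ≥ 1`, where `(Z_j^r)ᵀ = ± Z_j^r` is arbitrary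
and `D_j^r` is a polynomial in the `A_{j'}^{r'r'}`, `j' < j`, `r' ≤ r`, and the `A_{j'}^{r's'}`,
`r' > s'`;
(III) the `A_j^{rs}` with `r < s` are polynomials in the `A_{j'}^{r's'}` with `r' ≥ s'`.
The last clause expresses that everything described as free or arbitrary is so simultaneously, and
that it determines the matrix uniquely. -/
def SatisfiesConditions {𝕜 : Type*} [Field 𝕜] {N : ℕ} (c : ℕ) {α μ : Fin N → ℕ}
    (B : ∀ r : Fin N, Matrix (Fin (μ r)) (Fin (μ r)) 𝕜)
    (S : Set (GeneralLinearGroup (TIdx α μ) 𝕜)) : Prop :=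
  ∃ (D : ∀ r : Fin N, ℕ → Matrix (Fin (μ r)) (Fin (μ r)) (MvPolynomial (Coord μ) 𝕜))
    (E : ∀ r s : Fin N, ℕ → Matrix (Fin (μ r)) (Fin (μ s)) (MvPolynomial (Coord μ) 𝕜)),
    (∀ r j p q, ∀ x ∈ (D r j p q).vars,
      x.1.2 < x.1.1 ∨ (x.1.1 = x.1.2 ∧ x.1.1 ≤ r ∧ x.2.1 < j)) ∧
    (∀ r s j p q, ∀ x ∈ (E r s j p q).vars, x.1.2 ≤ x.1.1) ∧
    (∀ X ∈ S, ∀ r, (coeff X r r 0)ᵀ * B r * coeff X r r 0 = B r) ∧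
    (∀ X ∈ S, ∃ Z, HasSign c α Z ∧ ∀ r j, 1 ≤ j → j < α r →
      coeff X r r j = coeff X r r 0 * (B r)⁻¹ * Z r j + polyEval (D r j) (coeff X)) ∧
    (∀ X ∈ S, ∀ r s, r < s → ∀ j < α s, coeff X r s j = polyEval (E r s j) (coeff X)) ∧
    ∀ (A₀ : ∀ r : Fin N, Matrix (Fin (μ r)) (Fin (μ r)) 𝕜) (L : Coeffs 𝕜 μ)
      (Z : ∀ r : Fin N, ℕ → Matrix (Fin (μ r)) (Fin (μ r)) 𝕜),
      (∀ r, (A₀ r)ᵀ * B r * A₀ r = B r) → HasSign c α Z →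
      ∃! X, X ∈ S ∧ (∀ r, coeff X r r 0 = A₀ r) ∧
        (∀ r s, s < r → ∀ j < α r, coeff X r s j = L r s j) ∧
        ∀ r j, 1 ≤ j → j < α r →
          coeff X r r j = A₀ r * (B r)⁻¹ * Z r j + polyEval (D r j) (coeff X)

/-! ### The recursive algorithm -/

/-- `∑_{l=0}^{n} (-1)^l (A_l^{kr})ᵀ B_k A_{n-l}^{ks}`. -/
def pairing {𝕜 : Type*} [Field 𝕜] {N : ℕ} {μ : Fin N → ℕ}
    (B : ∀ r : Fin N, Matrix (Fin (μ r)) (Fin (μ r)) 𝕜) (A : Coeffs 𝕜 μ)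
    (k r s : Fin N) (n : ℕ) : Matrix (Fin (μ r)) (Fin (μ s)) 𝕜 :=
  ∑ l ∈ Finset.range (n + 1), (-1 : 𝕜) ^ l • ((A k r l)ᵀ * B k * A k s (n - l))

/-- The part of the equation for `A_j^{rs}`, `r ≤ s`, that is known when `A_j^{rs}` is computed. -/
def remainder {𝕜 : Type*} [Field 𝕜] {N : ℕ} (α : Fin N → ℕ) {μ : Fin N → ℕ}
    (B : ∀ r : Fin N, Matrix (Fin (μ r)) (Fin (μ r)) 𝕜) (A : Coeffs 𝕜 μ)
    (r s : Fin N) (j : ℕ) : Matrix (Fin (μ r)) (Fin (μ s)) 𝕜 :=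
  (∑ l ∈ Finset.Ico 1 j, (-1 : 𝕜) ^ l • ((A r r l)ᵀ * B r * A r s (j - l))) +
  (if r < s ∧ 0 < j then (-1 : 𝕜) ^ j • ((A r r j)ᵀ * B r * A r s 0) else 0) +
  (∑ k ∈ Finset.univ.filter (fun k => k < r),
    if α k ≤ j + α r then (-1 : 𝕜) ^ (α k - α r) • pairing B A k r s (j + α r - α k) else 0) +
  (∑ k ∈ Finset.univ.filter (fun k => r < k ∧ k ≤ s), pairing B A k r s j) +
  (∑ k ∈ Finset.univ.filter (fun k => s < k),
    if α s ≤ j + α k then pairing B A k r s (j + α k - α s) else 0)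

/-- The order of the computation: the blocks below the diagonal come first; the other coefficients
`A_j^{rs}`, `r ≤ s`, are computed in the lexicographic order of `(j, s - r)`. -/
def Precedes {N : ℕ} (r' s' : Fin N) (j' : ℕ) (r s : Fin N) (j : ℕ) : Prop :=
  s' < r' ∨ (r' ≤ s' ∧ (j' < j ∨ (j' = j ∧ (s' : ℕ) - r' < (s : ℕ) - r)))

/-- The output of the algorithm for the input `Z`, `A_0^{rr}` and `A_j^{rs}` with `r > s`. -/
def IsComputed {𝕜 : Type*} [Field 𝕜] {N : ℕ} (α : Fin N → ℕ) {μ : Fin N → ℕ}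
    (B : ∀ r : Fin N, Matrix (Fin (μ r)) (Fin (μ r)) 𝕜)
    (Z : ∀ r : Fin N, ℕ → Matrix (Fin (μ r)) (Fin (μ r)) 𝕜) (A : Coeffs 𝕜 μ) : Prop :=
  (∀ r j, 1 ≤ j → j < α r →
    A r r j = A r r 0 * (B r)⁻¹ * (Z r j - (1 / 2 : 𝕜) • remainder α B A r r j)) ∧
  ∀ r s, r < s → ∀ j < α s, A r s j = -(A r r 0 * (B r)⁻¹ * remainder α B A r s j)

/-! ### The conjugating matrix -/

/-- The block `r` of the matrix `Ψ`. Its columns are indexed as the `r`-th part of `𝒜` and its rows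
as the `r`-th block row of a matrix in `𝕋^{α,μ}`; it is the matrix `I` or `I ⊕ -Γ` (once for every
copy of the normal form block), followed by the permutation that puts first together the `i`-th rows
of all the blocks, for every `i`, and orders them with the first halves of the copies in front. -/
def psiBlock (𝕜 : Type*) [Field 𝕜] (c a m : ℕ) :
    Matrix (Fin a × Fin (mult c a * m)) ((Fin (mult c a) × Fin a) × Fin m) 𝕜 :=
  Matrix.of fun x y =>
    if x.2 = finProdFinEquiv (y.1.1, y.2) then
      if (y.1.1 : ℕ) = 0 then (1 : Matrix (Fin a) (Fin a) 𝕜) x.1 y.1.2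
      else -gammaMat 𝕜 a x.1 y.1.2
    else 0

/-- The matrix `Ψ`. -/
def psi (𝕜 : Type*) [Field 𝕜] {N : ℕ} (c : ℕ) (α m : Fin N → ℕ) :
    Matrix (TIdx α (mu c α m)) (NIdx c α m) 𝕜 :=
  Matrix.blockDiagonal' fun r => psiBlock 𝕜 c (α r) (m r)

theorem gammaMat_mul_transpose (𝕜 : Type*) [Field 𝕜] (a : ℕ) :
    gammaMat 𝕜 a * (gammaMat 𝕜 a)ᵀ = 1 := by
  have hG : ∀ i j : Fin a, gammaMat 𝕜 a i j = if j = i.rev then (-1) ^ (i : ℕ) else 0 := by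
    intro i j
    have : ((i : ℕ) + j + 1 = a) ↔ j = i.rev := by
      rw [Fin.ext_iff, Fin.val_rev]
      omega
    simp only [gammaMat, Matrix.of_apply, this]
  ext i i'
  rw [Matrix.mul_apply]
  simp only [Matrix.transpose_apply, hG]
  simp only [ite_mul, zero_mul, Finset.sum_ite_eq', Finset.mem_univ, if_true]
  by_cases h : i = i'
  · subst h
    simp [← pow_add, ← two_mul]
  · have h' : i.rev ≠ i'.rev := fun e => h (Fin.rev_injective e)
    simp [h, h']

theorem psiBlock_mul_transpose (𝕜 : Type*) [Field 𝕜] (c a m : ℕ) :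
    psiBlock 𝕜 c a m * (psiBlock 𝕜 c a m)ᵀ = 1 := by
  ext ⟨i, q⟩ ⟨i', q'⟩
  obtain ⟨⟨b, j⟩, rfl⟩ := finProdFinEquiv.surjective q
  obtain ⟨⟨b', j'⟩, rfl⟩ := finProdFinEquiv.surjective q'
  rw [Matrix.mul_apply]
  simp only [Matrix.transpose_apply, psiBlock, Matrix.of_apply, EmbeddingLike.apply_eq_iff_eq,
    Prod.mk.injEq, Fintype.sum_prod_type]
  by_cases hb : b = b' ∧ j = j'
  · obtain ⟨rfl, rfl⟩ := hb
    rw [Finset.sum_eq_single b, Finset.sum_comm, Finset.sum_eq_single j]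
    · have h1 := congrFun (congrFun (gammaMat_mul_transpose 𝕜 a) i) i'
      rw [Matrix.mul_apply] at h1
      by_cases h0 : (b : ℕ) = 0
      · simp [h0, Matrix.one_apply]
      · simp only [Matrix.transpose_apply] at h1
        simp [h0, Matrix.one_apply, h1]
    · intro j' _ hj
      simp [Ne.symm hj]
    · simp
    · intro b' _ hb
      simp [Ne.symm hb]
    · simp
  · rw [Matrix.one_apply_ne]
    · refine Finset.sum_eq_zero fun b'' _ => Finset.sum_eq_zero fun k _ =>
        Finset.sum_eq_zero fun j'' _ => ?_
      split_ifs with h1 h2 <;> simp_all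
    · intro h
      apply hb
      simpa using (Prod.ext_iff.1 h).2

theorem psi_mul_transpose (𝕜 : Type*) [Field 𝕜] {N : ℕ} (c : ℕ) (α m : Fin N → ℕ) :
    psi 𝕜 c α m * (psi 𝕜 c α m)ᵀ = 1 := by
  rw [psi, Matrix.blockDiagonal'_transpose, ← Matrix.blockDiagonal'_mul]
  simp only [psiBlock_mul_transpose]
  exact Matrix.blockDiagonal'_one

/-- Both index sets have `n = ∑ α_r μ_r` elements. -/
theorem card_NIdx {N : ℕ} (c : ℕ) (α m : Fin N → ℕ) :
    Fintype.card (NIdx c α m) = ∑ r, α r * mu c α m r := by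
  simp only [NIdx, mu, Fintype.card_sigma, Fintype.card_prod, Fintype.card_fin]
  exact Finset.sum_congr rfl fun r _ => by ring

theorem card_TIdx {N : ℕ} (α μ : Fin N → ℕ) :
    Fintype.card (TIdx α μ) = ∑ r, α r * μ r := by
  simp [TIdx]

theorem transpose_mul_psi (𝕜 : Type*) [Field 𝕜] {N : ℕ} (c : ℕ) (α m : Fin N → ℕ) :
    (psi 𝕜 c α m)ᵀ * psi 𝕜 c α m = 1 :=
  (Matrix.mul_eq_one_comm_of_card_eq _ _ _ ((card_TIdx α _).trans (card_NIdx c α m).symm)).1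
    (psi_mul_transpose 𝕜 c α m)

/-- Conjugation `Q ↦ Ψ Q Ψ⁻¹`; here `Ψ⁻¹ = Ψᵀ`. -/
def conjPsi (𝕜 : Type*) [Field 𝕜] {N : ℕ} (c : ℕ) (α m : Fin N → ℕ) :
    GeneralLinearGroup (NIdx c α m) 𝕜 ≃* GeneralLinearGroup (TIdx α (mu c α m)) 𝕜 :=
  Units.mapEquiv
    { toFun := fun Q => psi 𝕜 c α m * Q * (psi 𝕜 c α m)ᵀ
      invFun := fun Y => (psi 𝕜 c α m)ᵀ * Y * psi 𝕜 c α m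
      left_inv := fun Q => by
        calc _ = ((psi 𝕜 c α m)ᵀ * psi 𝕜 c α m) * Q * ((psi 𝕜 c α m)ᵀ * psi 𝕜 c α m) := by
              simp only [Matrix.mul_assoc]
          _ = Q := by rw [transpose_mul_psi, Matrix.one_mul, Matrix.mul_one]
      right_inv := fun Y => by
        calc _ = (psi 𝕜 c α m * (psi 𝕜 c α m)ᵀ) * Y * (psi 𝕜 c α m * (psi 𝕜 c α m)ᵀ) := by
              simp only [Matrix.mul_assoc]
          _ = Y := by rw [psi_mul_transpose, Matrix.one_mul, Matrix.mul_one]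
      map_mul' := fun P Q => by
        calc psi 𝕜 c α m * (P * Q) * (psi 𝕜 c α m)ᵀ
            = psi 𝕜 c α m * P * ((psi 𝕜 c α m)ᵀ * psi 𝕜 c α m) * Q * (psi 𝕜 c α m)ᵀ := by
              rw [transpose_mul_psi, Matrix.mul_one, Matrix.mul_assoc (psi 𝕜 c α m) P Q]
          _ = _ := by simp only [Matrix.mul_assoc] }

end BlockToeplitz

/-!
The matrix `Ψ` carries `𝒜` to `shiftT = ⨁_r J_{α_r}(0) ⊗ I` and `H` to `formT = ⨁_r (-1)^{α_r}
Γ_{α_r} ⊗ B_r` (`psi_mul_matA`, `psi_mul_matH`). A matrix commutes with `ε e^𝒜` if and only if it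
commutes with the nilpotent matrix `𝒜` (`commute_exp_iff_of_isNilpotent`). So the centralizer is
conjugate to the group `isoT` of the isometries of `formT` that commute with `shiftT`, and the
centralizer of `shiftT` consists of Toeplitz block matrices (`toeplitz_matCoeff_of_commute`).

For a Toeplitz block matrix `X` the product `Xᵀ H X` is `H` times the Toeplitz block matrix of the
Gram coefficients of `X`. By the symmetry of the form only the Gram coefficients on and above the
diagonal matter. The one of index `(r, s, j)` is `(A_0^{rr})ᵀ B_r A_j^{rs}`, plus its transpose up
to the sign if `r = s`, plus a remainder in coefficients that precede `A_j^{rs}`. As `(A_0^{rr})ᵀ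
B_r` is invertible, the equation `Xᵀ H X = H` is a recursion for the coefficients on and above the
diagonal (`preserves_iff_isComputed`), with a matrix of prescribed symmetry left free on the
diagonal. This yields the algorithm, the existence and uniqueness of the element with given free
parameters (`exists_isComputed`, `IsComputed.unique`) and the polynomial dependence
(`satisfiesConditions`).

Since the sizes `α_r` are distinct, `X ↦ (A_0^{rr})_r` is multiplicative (`matCoeff_mul_zero`). On
`isoT` it is a homomorphism onto the product of the isometry groups of the `B_r`, with the block
diagonal matrices as a section. The elements of the kernel raise a height function on the basis
after subtraction of the identity, hence are unipotent. The kernel is generated by the matrices of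
the two kinds (`genU_eq_unipT`): the matrix of the second kind is `Φ - Φ* + √(1 - Φ*Φ - ΦΦ*)`,
where `Φ` has the single coefficient `F` and the square root is the binomial series with Catalan
numbers as coefficients (`isometry_of_sqrt`, `exists_isOffDiagGen`). Multiplication by such
matrices removes the coefficients below the diagonal in the order of their weights
(`exists_kill_coeff`); what remains is then block diagonal by the recursion, and of the first
kind.

The kernel is the unipotent radical, because orthogonal and symplectic groups have no nontrivial
normal unipotent subgroups. Indeed, if `g` lies in such a subgroup, then so do its commutators
with reflections or transvections along a vector `v`; that their trace is `n` gives an equation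
for the value of the form at `(v, g v)`, which forces `g = 1` (`hasNoNormalUnipotent_one`,
`hasNoNormalUnipotent_of_skew`).

The Lie algebra consists of the skew-adjoint Toeplitz block matrices. Its coordinates are the
coefficients below the diagonal and the matrices `B_r A_j^{rr}`, which are symmetric or
skew-symmetric according to the parity of `α_r + c + j` (`lieCoord_bijective`); this gives the
dimension.
-/


set_option linter.unusedSectionVars false

namespace BlockToeplitz

/-! ### The algebra of block Toeplitz matrices -/

section Toeplitz

variable {𝕜 : Type*} [Field 𝕜] {N : ℕ} {α μ : Fin N → ℕ}

/-- The `μ_r × μ_s` block of `M` in the `i`-th row of block row `r` and the `i'`-th column of block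
column `s`. -/
def blk (M : Matrix (TIdx α μ) (TIdx α μ) 𝕜) (r : Fin N) (i : Fin (α r)) (s : Fin N)
    (i' : Fin (α s)) : Matrix (Fin (μ r)) (Fin (μ s)) 𝕜 :=
  Matrix.of fun p q => M ⟨r, i, p⟩ ⟨s, i', q⟩

theorem ext_blk {M M' : Matrix (TIdx α μ) (TIdx α μ) 𝕜}
    (h : ∀ r i s i', blk M r i s i' = blk M' r i s i') : M = M' := by
  ext ⟨r, i, p⟩ ⟨s, i', q⟩
  exact congrFun (congrFun (h r i s i') p) q

theorem blk_mul (M M' : Matrix (TIdx α μ) (TIdx α μ) 𝕜) (r i s i') :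
    blk (M * M') r i s i' = ∑ k, ∑ l, blk M r i k l * blk M' k l s i' := by
  ext p q
  simp only [blk, Matrix.of_apply, Matrix.mul_apply, Matrix.sum_apply, Fintype.sum_sigma,
    Fintype.sum_prod_type]

theorem blk_transpose (M : Matrix (TIdx α μ) (TIdx α μ) 𝕜) (r i s i') :
    blk Mᵀ r i s i' = (blk M s i' r i)ᵀ := rfl

theorem blk_one_ne {r s : Fin N} (h : r ≠ s) (i i') :
    blk (1 : Matrix (TIdx α μ) (TIdx α μ) 𝕜) r i s i' = 0 := by
  ext p q
  simp [blk, h]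

theorem blk_one_same (r : Fin N) (i i') :
    blk (1 : Matrix (TIdx α μ) (TIdx α μ) 𝕜) r i r i' = if i = i' then 1 else 0 := by
  ext p q
  by_cases h : i = i' <;> simp [blk, Matrix.one_apply, h]

theorem blk_toeplitz (A : Coeffs 𝕜 μ) (r i s i') :
    blk (toeplitz α A) r i s i' =
      if (α s - α r) + (i : ℕ) ≤ i' then A r s ((i' : ℕ) - ((α s - α r) + (i : ℕ))) else 0 := by
  ext p q
  simp only [blk, toeplitz, Matrix.of_apply]
  split_ifs <;> rfl

/-- The coefficients `A_j^{rs}` of an arbitrary matrix, read off the first block rows. -/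
def matCoeff (M : Matrix (TIdx α μ) (TIdx α μ) 𝕜) : Coeffs 𝕜 μ := fun r s j =>
  if h : 0 < α r ∧ (α s - α r) + j < α s then blk M r ⟨0, h.1⟩ s ⟨(α s - α r) + j, h.2⟩ else 0

theorem coeff_eq_matCoeff (X : GeneralLinearGroup (TIdx α μ) 𝕜) :
    coeff X = matCoeff (X : Matrix (TIdx α μ) (TIdx α μ) 𝕜) := by
  funext r s j
  ext p q
  simp only [coeff, matCoeff, Matrix.of_apply]
  split_ifs <;> rfl

/-- Outside the range `j < min α_r α_s`, where the first block row has no block, the coefficients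
are zero by convention. -/
theorem matCoeff_of_le (M : Matrix (TIdx α μ) (TIdx α μ) 𝕜) {r s : Fin N} {j : ℕ}
    (h : min (α r) (α s) ≤ j) : matCoeff M r s j = 0 := by
  rw [matCoeff, dif_neg]
  omega

theorem matCoeff_add (M M' : Matrix (TIdx α μ) (TIdx α μ) 𝕜) :
    matCoeff (M + M') = matCoeff M + matCoeff M' := by
  funext r s j
  simp only [matCoeff, Pi.add_apply]
  split_ifs
  · rfl
  · simp

theorem matCoeff_smul (a : 𝕜) (M : Matrix (TIdx α μ) (TIdx α μ) 𝕜) :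
    matCoeff (a • M) = a • matCoeff M := by
  funext r s j
  simp only [matCoeff, Pi.smul_apply]
  split_ifs
  · rfl
  · simp

theorem matCoeff_neg (M : Matrix (TIdx α μ) (TIdx α μ) 𝕜) :
    matCoeff (-M) = -matCoeff M := by
  rw [← neg_one_smul 𝕜 M, matCoeff_smul, neg_one_smul]

theorem matCoeff_sub (M M' : Matrix (TIdx α μ) (TIdx α μ) 𝕜) :
    matCoeff (M - M') = matCoeff M - matCoeff M' := by
  rw [sub_eq_add_neg, matCoeff_add, matCoeff_neg, sub_eq_add_neg]

theorem matCoeff_zero : matCoeff (0 : Matrix (TIdx α μ) (TIdx α μ) 𝕜) = 0 := by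
  rw [← sub_self 0, matCoeff_sub, sub_self]

theorem matCoeff_sum {ι : Type*} (S : Finset ι) (f : ι → Matrix (TIdx α μ) (TIdx α μ) 𝕜) :
    matCoeff (∑ x ∈ S, f x) = ∑ x ∈ S, matCoeff (f x) := by
  classical
  induction S using Finset.induction_on with
  | empty => simp [matCoeff_zero]
  | insert a S ha ih => rw [Finset.sum_insert ha, Finset.sum_insert ha, matCoeff_add, ih]

theorem matCoeff_toeplitz (A : Coeffs 𝕜 μ) (r s : Fin N) (j : ℕ) :
    matCoeff (toeplitz α A) r s j = if j < min (α r) (α s) then A r s j else 0 := by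
  rw [matCoeff]
  by_cases h : j < min (α r) (α s)
  · have h' : 0 < α r ∧ (α s - α r) + j < α s := by omega
    rw [dif_pos h', if_pos h, blk_toeplitz, if_pos (by simp)]
    simp
  · rw [if_neg h, dif_neg (by omega)]

theorem toeplitz_congr {A A' : Coeffs 𝕜 μ}
    (h : ∀ r s j, j < min (α r) (α s) → A r s j = A' r s j) : toeplitz α A = toeplitz α A' := by
  refine ext_blk fun r i s i' => ?_
  rw [blk_toeplitz, blk_toeplitz]
  split_ifs with h1
  · have := i'.2
    exact h _ _ _ (by omega)
  · rfl

theorem toeplitz_matCoeff_toeplitz (A : Coeffs 𝕜 μ) :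
    toeplitz α (matCoeff (toeplitz α A)) = toeplitz α A :=
  toeplitz_congr fun r s j h => by rw [matCoeff_toeplitz, if_pos h]

/-- The excess of `(α_s - α_r)⁺ + (α_u - α_s)⁺` over `(α_u - α_r)⁺`: the shift that occurs when a
block `(r, s)` is multiplied by a block `(s, u)`. -/
def gap (α : Fin N → ℕ) (r s u : Fin N) : ℕ := (α s - α r) + (α u - α s) - (α u - α r)

/-- The coefficients of the product of two Toeplitz block matrices. -/
def conv (α : Fin N → ℕ) (A A' : Coeffs 𝕜 μ) : Coeffs 𝕜 μ := fun r u j =>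
  ∑ s, if gap α r s u ≤ j then
    ∑ l ∈ Finset.range (j - gap α r s u + 1), A r s l * A' s u (j - gap α r s u - l) else 0

theorem toeplitz_mul (A A' : Coeffs 𝕜 μ) :
    toeplitz α A * toeplitz α A' = toeplitz α (conv α A A') := by
  refine ext_blk fun r i u i' => ?_
  rw [blk_mul, blk_toeplitz]
  simp only [blk_toeplitz]
  have hi := i.2
  have hi' := i'.2
  by_cases h : (α u - α r) + (i : ℕ) ≤ i'
  · rw [if_pos h, conv]
    refine Finset.sum_congr rfl fun s _ => ?_
    rw [Fin.sum_univ_eq_sum_range (fun l : ℕ =>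
      (if (α s - α r) + (i : ℕ) ≤ l then A r s (l - ((α s - α r) + (i : ℕ))) else 0) *
      (if (α u - α s) + l ≤ i' then A' s u ((i' : ℕ) - ((α u - α s) + l)) else 0)) (α s)]
    have hg : gap α r s u + (α u - α r) = (α s - α r) + (α u - α s) := by unfold gap; omega
    split_ifs with h1
    · symm
      -- The nonzero terms of the sum over the `α_s` block columns are those of the convolution,
      -- shifted by `(α_s - α_r)⁺ + i`.
      refine Finset.sum_of_injOn (fun l => l + ((α s - α r) + (i : ℕ))) ?_ ?_ ?_ ?_
      · intro a _ b _ hab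
        simpa using hab
      · intro l hl
        simp only [Finset.coe_range, Set.mem_Iio] at hl ⊢
        omega
      · intro l hl hl'
        simp only [Finset.coe_range, Set.mem_image, Set.mem_Iio, Finset.mem_range, not_exists,
          not_and] at hl hl'
        by_cases h2 : (α s - α r) + (i : ℕ) ≤ l
        · by_cases h3 : (α u - α s) + l ≤ i'
          · exact absurd (by omega) (hl' (l - ((α s - α r) + (i : ℕ))) (by omega))
          · rw [if_neg h3, Matrix.mul_zero]
        · rw [if_neg h2, Matrix.zero_mul]
      · intro l hl
        simp only [Finset.mem_range] at hl
        rw [if_pos (by omega), if_pos (by omega)]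
        congr 2 <;> omega
    · refine Finset.sum_eq_zero fun l _ => ?_
      by_cases h2 : (α s - α r) + (i : ℕ) ≤ l
      · rw [if_neg (c := (α u - α s) + l ≤ i') (by omega), Matrix.mul_zero]
      · rw [if_neg h2, Matrix.zero_mul]
  · rw [if_neg h]
    refine Finset.sum_eq_zero fun s _ => Finset.sum_eq_zero fun l _ => ?_
    by_cases h2 : (α s - α r) + (i : ℕ) ≤ l
    · rw [if_neg (c := (α u - α s) + (l : ℕ) ≤ i') (by omega), Matrix.mul_zero]
    · rw [if_neg h2, Matrix.zero_mul]

/-- The nilpotent matrix `⨁_r J_{α_r}(0) ⊗ I`, to which `Ψ` conjugates `𝒜`. -/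
def shiftT (𝕜 : Type*) [Field 𝕜] {N : ℕ} (α μ : Fin N → ℕ) :
    Matrix (TIdx α μ) (TIdx α μ) 𝕜 :=
  Matrix.blockDiagonal' fun r => jordanZero 𝕜 (α r) ⊗ₖ (1 : Matrix (Fin (μ r)) (Fin (μ r)) 𝕜)

theorem blk_shiftT_same (r : Fin N) (i i') :
    blk (shiftT 𝕜 α μ) r i r i' = if (i : ℕ) + 1 = i' then 1 else 0 := by
  ext p q
  simp only [blk, shiftT, Matrix.of_apply, Matrix.blockDiagonal'_apply_eq, kroneckerMap_apply,
    jordanZero]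
  split_ifs <;> simp

theorem blk_shiftT_ne {r s : Fin N} (h : r ≠ s) (i i') :
    blk (shiftT 𝕜 α μ) r i s i' = 0 := by
  ext p q
  simp only [blk, shiftT, Matrix.of_apply, Matrix.zero_apply]
  rw [Matrix.blockDiagonal'_apply_ne _ _ _ h]

theorem blk_mul_shiftT (M : Matrix (TIdx α μ) (TIdx α μ) 𝕜) (r i s) (i' : Fin (α s)) :
    blk (M * shiftT 𝕜 α μ) r i s i' =
      if (i' : ℕ) = 0 then 0 else blk M r i s ⟨i' - 1, (Nat.sub_le _ _).trans_lt i'.2⟩ := by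
  rw [blk_mul, Finset.sum_eq_single s]
  · split_ifs with h
    · refine Finset.sum_eq_zero fun l _ => ?_
      rw [blk_shiftT_same, if_neg (by omega), Matrix.mul_zero]
    · rw [Finset.sum_eq_single ⟨i' - 1, (Nat.sub_le _ _).trans_lt i'.2⟩]
      · rw [blk_shiftT_same, if_pos (by simp; omega), Matrix.mul_one]
      · intro l _ hl
        rw [blk_shiftT_same, if_neg, Matrix.mul_zero]
        intro h'
        exact hl (Fin.ext (by simp; omega))
      · simp
  · intro k _ hk
    refine Finset.sum_eq_zero fun l _ => ?_
    rw [blk_shiftT_ne hk, Matrix.mul_zero]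
  · simp

theorem blk_shiftT_mul (M : Matrix (TIdx α μ) (TIdx α μ) 𝕜) (r s) (i : Fin (α r))
    (i' : Fin (α s)) :
    blk (shiftT 𝕜 α μ * M) r i s i' =
      if h : (i : ℕ) + 1 < α r then blk M r ⟨i + 1, h⟩ s i' else 0 := by
  rw [blk_mul, Finset.sum_eq_single r]
  · split_ifs with h
    · rw [Finset.sum_eq_single ⟨i + 1, h⟩]
      · rw [blk_shiftT_same, if_pos (by simp), Matrix.one_mul]
      · intro l _ hl
        rw [blk_shiftT_same, if_neg, Matrix.zero_mul]
        intro h'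
        exact hl (Fin.ext (by simp; omega))
      · simp
    · refine Finset.sum_eq_zero fun l _ => ?_
      rw [blk_shiftT_same, if_neg (by omega), Matrix.zero_mul]
  · intro k _ hk
    refine Finset.sum_eq_zero fun l _ => ?_
    rw [blk_shiftT_ne hk.symm, Matrix.zero_mul]
  · simp

theorem toeplitz_commute_shiftT (A : Coeffs 𝕜 μ) : Commute (toeplitz α A) (shiftT 𝕜 α μ) := by
  refine ext_blk fun r i s i' => ?_
  have hi := i.2
  have hi' := i'.2
  rw [blk_mul_shiftT, blk_shiftT_mul]
  simp only [blk_toeplitz]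
  by_cases h0 : (i' : ℕ) = 0
  · rw [if_pos h0]
    split_ifs <;> first | rfl | omega
  · rw [if_neg h0]
    by_cases h1 : (i : ℕ) + 1 < α r
    · rw [dif_pos h1]
      by_cases h2 : (α s - α r) + ((i : ℕ) + 1) ≤ i'
      · rw [if_pos h2, if_pos (by omega)]
        congr 1
        omega
      · rw [if_neg h2, if_neg (by omega)]
    · rw [dif_neg h1, if_neg (by omega)]

/-- The centralizer of the nilpotent matrix `⨁_r J_{α_r}(0) ⊗ I` consists of Toeplitz block
matrices. -/
theorem toeplitz_matCoeff_of_commute {M : Matrix (TIdx α μ) (TIdx α μ) 𝕜}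
    (h : Commute M (shiftT 𝕜 α μ)) : toeplitz α (matCoeff M) = M := by
  have key : ∀ r i s i', blk (M * shiftT 𝕜 α μ) r i s i' = blk (shiftT 𝕜 α μ * M) r i s i' :=
    fun r i s i' => by rw [h.eq]
  simp only [blk_mul_shiftT, blk_shiftT_mul] at key
  -- The blocks are constant along the diagonals of each block `(r, s)`.
  have step : ∀ (r s : Fin N) (k i i' : ℕ) (h1 : i + k < α r) (h2 : i' + k < α s),
      blk M r ⟨i + k, h1⟩ s ⟨i' + k, h2⟩ = blk M r ⟨i, by omega⟩ s ⟨i', by omega⟩ := by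
    intro r s k
    induction k with
    | zero => intros; rfl
    | succ k ih =>
      intro i i' h1 h2
      have := key r ⟨i + k, by omega⟩ s ⟨i' + (k + 1), h2⟩
      rw [if_neg (by simp), dif_pos (show i + k + 1 < α r by omega)] at this
      rw [← ih i i' (by omega) (by omega)]
      exact this.symm
  refine ext_blk fun r i s i' => ?_
  have hi := i.2
  have hi' := i'.2
  rw [blk_toeplitz]
  by_cases h1 : (α s - α r) + (i : ℕ) ≤ i'
  · rw [if_pos h1, matCoeff, dif_pos (by omega)]
    rw [← step r s i 0 _ (by omega) (by omega)]
    congr 1 <;> ext <;> simp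
    omega
  · rw [if_neg h1]
    by_cases h2 : (i : ℕ) ≤ i'
    · have h3 := step r s (α r - 1 - i) i i' (by omega) (by omega)
      -- Along the diagonal one reaches the last block row, where the entry of `M * shiftT` is a
      -- block of `M` and that of `shiftT * M` is zero.
      have h4 := key r ⟨i + (α r - 1 - i), by omega⟩ s ⟨i' + (α r - 1 - i) + 1, by omega⟩
      rw [if_neg (by simp), dif_neg (by simp; omega)] at h4
      exact (h3.symm.trans h4).symm
    · have h3 := step r s i' (i - i') 0 (by omega) (by omega)
      -- Below the main diagonal one reaches the first block column, where the entry of `M * shiftT`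
      -- is zero.
      have h4 := key r ⟨i - i' - 1, by omega⟩ s ⟨0, by omega⟩
      rw [if_pos rfl, dif_pos (by simp; omega)] at h4
      have h5 : blk M r ⟨i - i', by omega⟩ s ⟨0, by omega⟩ = 0 := by
        rw [h4]
        congr 1
        ext
        simp
        omega
      rw [h5] at h3
      rw [← h3]
      congr 1 <;> ext <;> simp
      omega

theorem matCoeff_mul {M M' : Matrix (TIdx α μ) (TIdx α μ) 𝕜} (h : Commute M (shiftT 𝕜 α μ))
    (h' : Commute M' (shiftT 𝕜 α μ)) {r u : Fin N} {j : ℕ} (hj : j < min (α r) (α u)) :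
    matCoeff (M * M') r u j = conv α (matCoeff M) (matCoeff M') r u j := by
  conv_lhs => rw [← toeplitz_matCoeff_of_commute h, ← toeplitz_matCoeff_of_commute h', toeplitz_mul,
    matCoeff_toeplitz, if_pos hj]

theorem matCoeff_one_ne {r s : Fin N} (h : r ≠ s) (j : ℕ) :
    matCoeff (1 : Matrix (TIdx α μ) (TIdx α μ) 𝕜) r s j = 0 := by
  rw [matCoeff]
  split_ifs
  · exact blk_one_ne h _ _
  · rfl

theorem matCoeff_one_same (r : Fin N) {j : ℕ} (hj : 0 < j) :
    matCoeff (1 : Matrix (TIdx α μ) (TIdx α μ) 𝕜) r r j = 0 := by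
  rw [matCoeff]
  split_ifs
  · rw [blk_one_same, if_neg]
    intro h
    have := congrArg Fin.val h
    simp at this
    omega
  · rfl

theorem matCoeff_one_zero (r : Fin N) (hr : 0 < α r) :
    matCoeff (1 : Matrix (TIdx α μ) (TIdx α μ) 𝕜) r r 0 = 1 := by
  rw [matCoeff, dif_pos (by omega), blk_one_same, if_pos]
  ext
  simp

/-- The map that sends a Toeplitz block matrix to its leading diagonal coefficients `A_0^{rr}` is
multiplicative: a product of two off-diagonal blocks contributes only to higher coefficients. -/
theorem matCoeff_mul_zero (hα : Function.Injective α) (hα₀ : ∀ r, 0 < α r)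
    {M M' : Matrix (TIdx α μ) (TIdx α μ) 𝕜} (h : Commute M (shiftT 𝕜 α μ))
    (h' : Commute M' (shiftT 𝕜 α μ)) (r : Fin N) :
    matCoeff (M * M') r r 0 = matCoeff M r r 0 * matCoeff M' r r 0 := by
  rw [matCoeff_mul h h' (by simpa using hα₀ r), _root_.BlockToeplitz.conv, Finset.sum_eq_single r]
  · simp [gap]
  · intro s _ hs
    have : α s ≠ α r := fun e => hs (hα e)
    rw [if_neg]
    unfold gap
    omega
  · simp

/-! ### The height filtration -/

/-- The height of a basis vector. A coefficient `A_j^{rs}` raises it by `2 j + |α_r - α_s|`. -/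
def ht (a : TIdx α μ) : ℤ := (α a.1 : ℤ) - 2 * ((a.2.1 : ℕ) : ℤ)

/-- The matrix `M` raises the height by at least `w`. -/
def Raises (w : ℤ) (M : Matrix (TIdx α μ) (TIdx α μ) 𝕜) : Prop :=
  ∀ a b, M a b ≠ 0 → ht b + w ≤ ht a

/-- By how much a coefficient `A_j^{rs}` raises the height. -/
def wt (α : Fin N → ℕ) (r s : Fin N) (j : ℕ) : ℕ := 2 * j + ((α r - α s) + (α s - α r))

theorem Raises.mul {v w : ℤ} {M M' : Matrix (TIdx α μ) (TIdx α μ) 𝕜} (h : Raises v M)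
    (h' : Raises w M') : Raises (v + w) (M * M') := by
  intro a b hab
  rw [Matrix.mul_apply] at hab
  obtain ⟨x, -, hx⟩ := Finset.exists_ne_zero_of_sum_ne_zero hab
  have h1 := h a x (left_ne_zero_of_mul hx)
  have h2 := h' x b (right_ne_zero_of_mul hx)
  omega

theorem raises_one : Raises 0 (1 : Matrix (TIdx α μ) (TIdx α μ) 𝕜) := by
  intro a b hab
  by_cases h : a = b
  · simp [h]
  · exact absurd (Matrix.one_apply_ne h) hab

theorem Raises.pow {w : ℤ} {M : Matrix (TIdx α μ) (TIdx α μ) 𝕜} (h : Raises w M) (n : ℕ) :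
    Raises (n * w) (M ^ n) := by
  induction n with
  | zero => simpa using raises_one
  | succ n ih =>
    rw [pow_succ]
    convert ih.mul h using 1
    push_cast
    ring

/-- The heights lie in `(-max α_r, max α_r]`, so they cannot be raised more than `2 ∑ α_r` times.
-/
theorem Raises.isNilpotent {M : Matrix (TIdx α μ) (TIdx α μ) 𝕜} (h : Raises 1 M) :
    IsNilpotent M := by
  have hS : ∀ r, α r ≤ ∑ r, α r := fun r =>
    Finset.single_le_sum (f := α) (fun _ _ => Nat.zero_le _) (by simp)
  generalize ∑ r, α r = S at hS
  refine ⟨2 * S + 1, ?_⟩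
  ext a b
  by_contra hab
  have h1 := h.pow _ a b hab
  have h2 := hS a.1
  have h3 := hS b.1
  have h4 := b.2.1.2
  unfold ht at h1
  push_cast at h1
  omega

/-- A block Toeplitz matrix raises the height by at least the least weight of its nonzero
coefficients. -/
theorem raises_toeplitz {w : ℕ} {A : Coeffs 𝕜 μ}
    (h : ∀ r s j, j < min (α r) (α s) → wt α r s j < w → A r s j = 0) :
    Raises w (toeplitz α A) := by
  rintro ⟨r, i, p⟩ ⟨s, i', q⟩ hab
  have hi' := i'.2
  have hi := i.2
  simp only [toeplitz, Matrix.of_apply] at hab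
  split_ifs at hab with h1
  · by_contra h2
    simp only [ht] at h2
    exact hab (by rw [h r s _ (by omega) (by unfold wt; omega)]; rfl)
  · exact absurd rfl hab

theorem Raises.matCoeff_eq_zero {w : ℕ} {M : Matrix (TIdx α μ) (TIdx α μ) 𝕜} (h : Raises w M)
    {r s : Fin N} {j : ℕ} (hj : wt α r s j < w) : matCoeff M r s j = 0 := by
  rw [matCoeff]
  split_ifs with h1
  · ext p q
    by_contra hab
    have := h _ _ hab
    unfold ht wt at *
    simp at this
    omega
  · rfl

end Toeplitz

/-! ### The bilinear form on Toeplitz block matrices -/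

section Form

variable {𝕜 : Type*} [Field 𝕜] {N : ℕ} {α μ : Fin N → ℕ}

/-- The bilinear form `⨁_r (-1)^{α_r} Γ_{α_r} ⊗ B_r`, to which `Ψ` carries `H`. -/
def formT (α : Fin N → ℕ) (B : ∀ r : Fin N, Matrix (Fin (μ r)) (Fin (μ r)) 𝕜) :
    Matrix (TIdx α μ) (TIdx α μ) 𝕜 :=
  Matrix.blockDiagonal' fun r => (-1 : 𝕜) ^ α r • (gammaMat 𝕜 (α r) ⊗ₖ B r)

variable (B : ∀ r : Fin N, Matrix (Fin (μ r)) (Fin (μ r)) 𝕜)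

theorem blk_formT_same (r : Fin N) (i i') :
    blk (formT α B) r i r i' = if i' = i.rev then (-1 : 𝕜) ^ (α r + (i : ℕ)) • B r else 0 := by
  have hi := i.2
  have hi' := i'.2
  have : i' = i.rev ↔ (i : ℕ) + i' + 1 = α r := by
    rw [Fin.ext_iff, Fin.val_rev]
    omega
  ext p q
  simp only [blk, formT, Matrix.of_apply, Matrix.blockDiagonal'_apply_eq, Matrix.smul_apply,
    kroneckerMap_apply, gammaMat, this]
  split_ifs
  · simp [pow_add, mul_assoc]
  · simp

theorem blk_formT_ne {r s : Fin N} (h : r ≠ s) (i i') : blk (formT α B) r i s i' = 0 := by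
  ext p q
  simp only [blk, formT, Matrix.of_apply, Matrix.zero_apply]
  rw [Matrix.blockDiagonal'_apply_ne _ _ _ h]

theorem blk_formT_mul (M : Matrix (TIdx α μ) (TIdx α μ) 𝕜) (r i s i') :
    blk (formT α B * M) r i s i' =
      (-1 : 𝕜) ^ (α r + (i : ℕ)) • (B r * blk M r i.rev s i') := by
  rw [blk_mul, Finset.sum_eq_single r]
  · rw [Finset.sum_eq_single i.rev]
    · rw [blk_formT_same, if_pos rfl, Matrix.smul_mul]
    · intro l _ hl
      rw [blk_formT_same, if_neg hl, Matrix.zero_mul]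
    · simp
  · intro k _ hk
    refine Finset.sum_eq_zero fun l _ => ?_
    rw [blk_formT_ne B hk.symm, Matrix.zero_mul]
  · simp

theorem blk_mul_formT (M : Matrix (TIdx α μ) (TIdx α μ) 𝕜) (r i s) (i' : Fin (α s)) :
    blk (M * formT α B) r i s i' =
      (-1 : 𝕜) ^ ((i' : ℕ) + 1) • (blk M r i s i'.rev * B s) := by
  have hi' := i'.2
  rw [blk_mul, Finset.sum_eq_single s]
  · rw [Finset.sum_eq_single i'.rev]
    · rw [blk_formT_same, if_pos (Fin.rev_rev _).symm, Matrix.mul_smul]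
      congr 1
      rw [Fin.val_rev]
      rw [show α s + (α s - ((i' : ℕ) + 1)) = (i' + 1) + 2 * (α s - (i' + 1)) by omega, pow_add]
      simp
    · intro l _ hl
      rw [blk_formT_same, if_neg, Matrix.mul_zero]
      intro h
      exact hl (by rw [h, Fin.rev_rev])
    · simp
  · intro k _ hk
    refine Finset.sum_eq_zero fun l _ => ?_
    rw [blk_formT_ne B hk, Matrix.mul_zero]
  · simp

theorem formT_transpose {c : ℕ} (hB : ∀ r, (B r)ᵀ = (-1 : 𝕜) ^ (α r + c) • B r) :
    (formT α B)ᵀ = (-1 : 𝕜) ^ (c + 1) • formT α B := by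
  refine ext_blk fun r i s i' => ?_
  have hsm : blk ((-1 : 𝕜) ^ (c + 1) • formT α B) r i s i' =
    (-1 : 𝕜) ^ (c + 1) • blk (formT α B) r i s i' := rfl
  rw [hsm, blk_transpose]
  by_cases h : r = s
  · subst h
    rw [blk_formT_same, blk_formT_same]
    by_cases h1 : i' = i.rev
    · subst h1
      have hi := i.2
      rw [if_pos (Fin.rev_rev i).symm, if_pos rfl, Matrix.transpose_smul, hB, smul_smul, smul_smul]
      congr 1
      rw [← pow_add, ← pow_add, Fin.val_rev]
      exact neg_one_pow_congr (by rw [Nat.even_iff, Nat.even_iff]; omega)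
    · rw [if_neg h1, if_neg, Matrix.transpose_zero, smul_zero]
      intro h2
      exact h1 (by rw [h2, Fin.rev_rev])
  · rw [blk_formT_ne B h, blk_formT_ne B (Ne.symm h), Matrix.transpose_zero, smul_zero]

theorem isUnit_det_formT (hB : ∀ r, IsUnit (B r).det) : IsUnit (formT α B).det := by
  refine (Matrix.isUnit_iff_isUnit_det _).1 (IsUnit.of_mul_eq_one
    (Matrix.blockDiagonal' fun r => (-1 : 𝕜) ^ α r • ((gammaMat 𝕜 (α r))ᵀ ⊗ₖ (B r)⁻¹)) ?_)
  rw [formT, ← Matrix.blockDiagonal'_mul, ← Matrix.blockDiagonal'_one]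
  congr 1
  funext r
  rw [Matrix.smul_mul, Matrix.mul_smul, ← Matrix.mul_kronecker_mul, gammaMat_mul_transpose,
    Matrix.mul_nonsing_inv _ (hB r), smul_smul, ← pow_add, ← two_mul]
  simp

/-- The coefficients of the adjoint of a Toeplitz block matrix with respect to the form. -/
noncomputable def adjC (α : Fin N → ℕ) (A : Coeffs 𝕜 μ) : Coeffs 𝕜 μ := fun r s l =>
  (-1 : 𝕜) ^ (l + (α s - α r)) • ((B r)⁻¹ * (A s r l)ᵀ * B s)

theorem transpose_toeplitz_mul_formT (hB : ∀ r, IsUnit (B r).det) (A : Coeffs 𝕜 μ) :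
    (toeplitz α A)ᵀ * formT α B = formT α B * toeplitz α (adjC B α A) := by
  refine ext_blk fun r i s i' => ?_
  have hi := i.2
  have hi' := i'.2
  rw [blk_mul_formT, blk_formT_mul, blk_transpose, blk_toeplitz, blk_toeplitz]
  simp only [Fin.val_rev]
  by_cases h : (α r - α s) + (α s - (i' + 1)) ≤ (i : ℕ)
  · rw [if_pos h, if_pos (by omega), adjC, Matrix.mul_smul, smul_smul, ← Matrix.mul_assoc,
      ← Matrix.mul_assoc, Matrix.mul_nonsing_inv _ (hB r), Matrix.one_mul, ← pow_add]
    have h1 : (i' : ℕ) - ((α s - α r) + (α r - ((i : ℕ) + 1))) =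
      (i : ℕ) - ((α r - α s) + (α s - (i' + 1))) := by omega
    rw [h1]
    congr 1
    exact neg_one_pow_congr (by rw [Nat.even_iff, Nat.even_iff]; omega)
  · rw [if_neg h, if_neg (by omega)]
    simp

/-- The part of the coefficient `j` of the block `(r, s)` of `Xᵀ H X`, without the invertible
factors. -/
def gramC (α : Fin N → ℕ) (A : Coeffs 𝕜 μ) (r s : Fin N) (j : ℕ) :
    Matrix (Fin (μ r)) (Fin (μ s)) 𝕜 :=
  ∑ k, if gap α r k s ≤ j then (-1 : 𝕜) ^ (α k - α r) • pairing B A k r s (j - gap α r k s) else 0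

theorem conv_adjC (A : Coeffs 𝕜 μ) (r s : Fin N) (j : ℕ) :
    conv α (adjC B α A) A r s j = (B r)⁻¹ * gramC B α A r s j := by
  rw [conv, gramC, Matrix.mul_sum]
  refine Finset.sum_congr rfl fun k _ => ?_
  split_ifs
  · rw [pairing, Matrix.mul_smul, Matrix.mul_sum, Finset.smul_sum]
    refine Finset.sum_congr rfl fun l _ => ?_
    rw [adjC, Matrix.smul_mul, Matrix.mul_smul, smul_smul, ← pow_add, add_comm l]
    simp only [Matrix.mul_assoc]
  · simp

/-- The product `Xᵀ H X` is `H` times a Toeplitz block matrix whose coefficients are the Gram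
coefficients of `X`, up to the factors `B_r⁻¹`. -/
theorem transpose_toeplitz_mul_formT_mul (hB : ∀ r, IsUnit (B r).det) (A : Coeffs 𝕜 μ) :
    (toeplitz α A)ᵀ * formT α B * toeplitz α A =
      formT α B * toeplitz α (fun r s j => (B r)⁻¹ * gramC B α A r s j) := by
  rw [transpose_toeplitz_mul_formT B hB, Matrix.mul_assoc, toeplitz_mul]
  congr 2
  funext r s j
  exact conv_adjC B A r s j

/-- Since the form is symmetric or skew-symmetric, only the blocks on and above the diagonal of the
equation `Xᵀ H X = H` matter. -/
theorem preserves_iff_gramC (hα₀ : ∀ r, 0 < α r) (hα : StrictAnti α)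
    (hBu : ∀ r, IsUnit (B r).det) {c : ℕ}
    (hBt : ∀ r, (B r)ᵀ = (-1 : 𝕜) ^ (α r + c) • B r) (A : Coeffs 𝕜 μ) :
    (toeplitz α A)ᵀ * formT α B * toeplitz α A = formT α B ↔
      (∀ r, gramC B α A r r 0 = B r) ∧ (∀ r j, 1 ≤ j → j < α r → gramC B α A r r j = 0) ∧
      ∀ r s, r < s → ∀ j < α s, gramC B α A r s j = 0 := by
  have hle : ∀ {r s : Fin N}, r ≤ s → α s ≤ α r := fun h => hα.antitone h
  have hcancel : ∀ (r s : Fin N) (M : Matrix (Fin (μ r)) (Fin (μ s)) 𝕜),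
      B r * ((B r)⁻¹ * M) = M := fun r s M => by
    rw [← Matrix.mul_assoc, Matrix.mul_nonsing_inv _ (hBu r), Matrix.one_mul]
  constructor
  · intro h
    rw [transpose_toeplitz_mul_formT_mul B hBu] at h
    have h1 : toeplitz α (fun r s j => (B r)⁻¹ * gramC B α A r s j) = 1 := by
      have := congrArg (fun M => (formT α B)⁻¹ * M) h
      simpa [← Matrix.mul_assoc, Matrix.nonsing_inv_mul _ (isUnit_det_formT B hBu)] using this
    have h2 : ∀ r s j, j < min (α r) (α s) → (B r)⁻¹ * gramC B α A r s j =
        matCoeff (1 : Matrix (TIdx α μ) (TIdx α μ) 𝕜) r s j := fun r s j hj => by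
      rw [← h1, matCoeff_toeplitz, if_pos hj]
    refine ⟨fun r => ?_, fun r j hj hj' => ?_, fun r s hrs j hj => ?_⟩
    · have := h2 r r 0 (by simpa using hα₀ r)
      rw [matCoeff_one_zero r (hα₀ r)] at this
      rw [← hcancel r r (gramC B α A r r 0), this, Matrix.mul_one]
    · have := h2 r r j (by simpa using hj')
      rw [matCoeff_one_same r hj] at this
      rw [← hcancel r r (gramC B α A r r j), this, Matrix.mul_zero]
    · have := h2 r s j (by have := hle hrs.le; omega)
      rw [matCoeff_one_ne hrs.ne] at this
      rw [← hcancel r s (gramC B α A r s j), this, Matrix.mul_zero]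
  · rintro ⟨h1, h2, h3⟩
    -- The difference of the two sides has the symmetry of the form, so it vanishes as soon as its
    -- blocks on and above the diagonal do.
    set M := (toeplitz α A)ᵀ * formT α B * toeplitz α A - formT α B with hM
    have hMt : Mᵀ = (-1 : 𝕜) ^ (c + 1) • M := by
      rw [hM, Matrix.transpose_sub, Matrix.transpose_mul, Matrix.transpose_mul,
        Matrix.transpose_transpose, formT_transpose B hBt, smul_sub, Matrix.smul_mul,
        Matrix.mul_smul, Matrix.mul_assoc]
    have hupper : ∀ r i s i', r ≤ s → blk M r i s i' = 0 := by
      intro r i s i' hrs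
      have hi := i.2
      have hi' := i'.2
      rw [hM, transpose_toeplitz_mul_formT_mul B hBu]
      have hs : formT α B * toeplitz α (fun r s j => (B r)⁻¹ * gramC B α A r s j) - formT α B =
          formT α B * (toeplitz α (fun r s j => (B r)⁻¹ * gramC B α A r s j) - 1) := by
        rw [Matrix.mul_sub, Matrix.mul_one]
      have hb : ∀ P Q : Matrix (TIdx α μ) (TIdx α μ) 𝕜, ∀ i, blk (P - Q) r i s i' =
        blk P r i s i' - blk Q r i s i' := fun _ _ _ => rfl
      rw [hs, blk_formT_mul, hb, blk_toeplitz]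
      have := hle hrs
      rcases hrs.eq_or_lt with rfl | hrs
      · rw [blk_one_same]
        by_cases h4 : i.rev = i'
        · subst h4
          rw [if_pos (by omega), if_pos rfl]
          rw [show (i.rev : ℕ) - (α r - α r + (i.rev : ℕ)) = 0 by omega, h1,
            Matrix.nonsing_inv_mul _ (hBu r)]
          simp
        · rw [if_neg h4]
          have h5 : (i.rev : ℕ) ≠ i' := fun h => h4 (Fin.ext h)
          split_ifs with h6
          · rw [h2 _ _ (by omega) (by omega)]
            simp
          · simp
      · rw [blk_one_ne hrs.ne]
        split_ifs with h6
        · rw [h3 _ _ hrs _ (by omega)]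
          simp
        · simp
    have hM0 : M = 0 := by
      refine ext_blk fun r i s i' => ?_
      rcases le_total r s with hrs | hrs
      · exact hupper r i s i' hrs
      · have h4 := blk_transpose M s i' r i
        rw [hMt] at h4
        have h5 : blk ((-1 : 𝕜) ^ (c + 1) • M) s i' r i =
          (-1 : 𝕜) ^ (c + 1) • blk M s i' r i := rfl
        rw [h5, hupper s i' r i hrs, smul_zero] at h4
        rw [← Matrix.transpose_transpose (blk M r i s i'), ← h4, Matrix.transpose_zero]
        rfl
    exact sub_eq_zero.1 hM0

/-- The Gram coefficients split into the terms of the recursive algorithm. -/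
theorem gramC_eq (hα : StrictAnti α) (A : Coeffs 𝕜 μ) {r s : Fin N} (hrs : r ≤ s) (j : ℕ) :
    gramC B α A r s j = pairing B A r r s j +
      (∑ k ∈ Finset.univ.filter (fun k => k < r),
        if α k ≤ j + α r then (-1 : 𝕜) ^ (α k - α r) • pairing B A k r s (j + α r - α k) else 0) +
      (∑ k ∈ Finset.univ.filter (fun k => r < k ∧ k ≤ s), pairing B A k r s j) +
      (∑ k ∈ Finset.univ.filter (fun k => s < k),
        if α s ≤ j + α k then pairing B A k r s (j + α k - α s) else 0) := by
  have hle : ∀ {r s : Fin N}, r ≤ s → α s ≤ α r := fun h => hα.antitone h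
  have hs := hle hrs
  -- Since `α` decreases, the gap of `(r, k, s)` is `α_k - α_r` for `k < r`, zero for `r ≤ k ≤ s`,
  -- and `α_s - α_k` for `s < k`.
  set f : Fin N → Matrix (Fin (μ r)) (Fin (μ s)) 𝕜 := fun k =>
    if gap α r k s ≤ j then (-1 : 𝕜) ^ (α k - α r) • pairing B A k r s (j - gap α r k s) else 0
    with hf
  have h1 : ∑ k ∈ Finset.univ.filter (fun k => k < r), f k =
      ∑ k ∈ Finset.univ.filter (fun k => k < r),
        if α k ≤ j + α r then (-1 : 𝕜) ^ (α k - α r) • pairing B A k r s (j + α r - α k)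
        else 0 := by
    refine Finset.sum_congr rfl fun k hk => ?_
    simp only [Finset.mem_filter, Finset.mem_univ, true_and] at hk
    have h2 := hle hk.le
    have h3 : gap α r k s = α k - α r := by unfold gap; omega
    simp only [hf, h3]
    by_cases h4 : α k ≤ j + α r
    · rw [if_pos h4, if_pos (by omega)]
      congr 2
      omega
    · rw [if_neg h4, if_neg (by omega)]
  have h2 : ∑ k ∈ Finset.univ.filter (fun k => r < k ∧ k ≤ s), f k =
      ∑ k ∈ Finset.univ.filter (fun k => r < k ∧ k ≤ s), pairing B A k r s j := by
    refine Finset.sum_congr rfl fun k hk => ?_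
    simp only [Finset.mem_filter, Finset.mem_univ, true_and] at hk
    have h2 := hle hk.1.le
    have h2' := hle hk.2
    have h3 : gap α r k s = 0 := by unfold gap; omega
    simp only [hf, h3]
    simp [Nat.sub_eq_zero_of_le h2]
  have h3 : ∑ k ∈ Finset.univ.filter (fun k => s < k), f k =
      ∑ k ∈ Finset.univ.filter (fun k => s < k),
        if α s ≤ j + α k then pairing B A k r s (j + α k - α s) else 0 := by
    refine Finset.sum_congr rfl fun k hk => ?_
    simp only [Finset.mem_filter, Finset.mem_univ, true_and] at hk
    have h2 := hle hk.le
    have h3 : gap α r k s = α s - α k := by unfold gap; omega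
    simp only [hf, h3]
    rw [Nat.sub_eq_zero_of_le (h2.trans hs), pow_zero, one_smul]
    by_cases h4 : α s ≤ j + α k
    · rw [if_pos h4, if_pos (by omega)]
      congr 1
      omega
    · rw [if_neg h4, if_neg (by omega)]
  have h4 : f r = pairing B A r r s j := by
    have h3 : gap α r r s = 0 := by unfold gap; omega
    simp [hf, h3]
  rw [← h1, ← h2, ← h3, ← h4, gramC]
  change ∑ k, f k = _
  simp only [Finset.sum_filter]
  have h5 : f r = ∑ k, if k = r then f k else 0 := by simp
  rw [h5]
  simp only [← Finset.sum_add_distrib]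
  refine Finset.sum_congr rfl fun k _ => ?_
  rcases lt_trichotomy k r with h | h | h
  · rw [if_neg h.ne, if_pos h, if_neg (by intro h'; exact absurd h'.1 h.not_gt),
      if_neg (by intro h'; exact absurd (h.trans_le hrs) h'.not_gt)]
    simp
  · subst h
    simp [hrs]
  · rw [if_neg h.ne', if_neg h.not_gt]
    rcases le_or_gt k s with h' | h'
    · rw [if_pos ⟨h, h'⟩, if_neg h'.not_gt]
      simp
    · rw [if_neg (by intro h''; exact absurd h''.2 h'.not_ge), if_pos h']
      simp

theorem pairing_eq (A : Coeffs 𝕜 μ) (k r s : Fin N) {j : ℕ} (hj : 1 ≤ j) :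
    pairing B A k r s j = (A k r 0)ᵀ * B k * A k s j +
      ∑ l ∈ Finset.Ico 1 j, (-1 : 𝕜) ^ l • ((A k r l)ᵀ * B k * A k s (j - l)) +
      (-1 : 𝕜) ^ j • ((A k r j)ᵀ * B k * A k s 0) := by
  rw [pairing, Finset.sum_range_succ, Finset.range_eq_Ico,
    Finset.sum_eq_sum_Ico_succ_bot (by omega)]
  simp

theorem pairing_zero (A : Coeffs 𝕜 μ) (k r s : Fin N) :
    pairing B A k r s 0 = (A k r 0)ᵀ * B k * A k s 0 := by
  simp [pairing]

theorem gramC_of_lt (hα : StrictAnti α) (A : Coeffs 𝕜 μ) {r s : Fin N} (hrs : r < s) (j : ℕ) :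
    gramC B α A r s j = (A r r 0)ᵀ * B r * A r s j + remainder α B A r s j := by
  rw [gramC_eq B hα A hrs.le, remainder]
  rcases Nat.eq_zero_or_pos j with rfl | hj
  · rw [pairing_zero, if_neg (by simp)]
    simp [add_assoc]
  · rw [pairing_eq B A r r s hj, if_pos ⟨hrs, hj⟩]
    simp only [add_assoc]

theorem gramC_diag (hα : StrictAnti α) (A : Coeffs 𝕜 μ) (r : Fin N) {j : ℕ} (hj : 1 ≤ j) :
    gramC B α A r r j = (A r r 0)ᵀ * B r * A r r j +
      (-1 : 𝕜) ^ j • ((A r r j)ᵀ * B r * A r r 0) + remainder α B A r r j := by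
  rw [gramC_eq B hα A le_rfl, remainder, pairing_eq B A r r r hj, if_neg (by simp)]
  abel

theorem gramC_diag_zero (hα : StrictAnti α) (A : Coeffs 𝕜 μ) (r : Fin N) :
    gramC B α A r r 0 = (A r r 0)ᵀ * B r * A r r 0 := by
  rw [gramC_eq B hα A le_rfl, pairing_zero, Finset.sum_eq_zero, Finset.sum_eq_zero,
    Finset.sum_eq_zero]
  · simp
  · intro k hk
    simp only [Finset.mem_filter, Finset.mem_univ, true_and] at hk
    have := hα hk
    rw [if_neg (by omega)]
  · intro k hk
    simp only [Finset.mem_filter, Finset.mem_univ, true_and] at hk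
    exact absurd hk.1 hk.2.not_gt
  · intro k hk
    simp only [Finset.mem_filter, Finset.mem_univ, true_and] at hk
    have := hα hk
    rw [if_neg (by omega)]

theorem pairing_transpose {c : ℕ} (hBt : ∀ r, (B r)ᵀ = (-1 : 𝕜) ^ (α r + c) • B r)
    (A : Coeffs 𝕜 μ) (k r s : Fin N) (n : ℕ) :
    (pairing B A k r s n)ᵀ = (-1 : 𝕜) ^ (n + (α k + c)) • pairing B A k s r n := by
  rw [pairing, pairing, Matrix.transpose_sum, Finset.smul_sum, ← Finset.sum_range_reflect]
  refine Finset.sum_congr rfl fun l hl => ?_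
  rw [Finset.mem_range] at hl
  rw [show n + 1 - 1 - l = n - l by omega, show n - (n - l) = l by omega, Matrix.transpose_smul,
    Matrix.transpose_mul, Matrix.transpose_mul, Matrix.transpose_transpose, hBt, Matrix.smul_mul,
    Matrix.mul_smul, smul_smul, smul_smul, Matrix.mul_assoc, ← pow_add, ← pow_add]
  congr 1
  exact neg_one_pow_congr (by rw [Nat.even_iff, Nat.even_iff]; omega)

theorem transpose_mid {c : ℕ} (hBt : ∀ r, (B r)ᵀ = (-1 : 𝕜) ^ (α r + c) • B r)
    (A : Coeffs 𝕜 μ) (r : Fin N) (i j : ℕ) :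
    ((A r r i)ᵀ * B r * A r r j)ᵀ = (-1 : 𝕜) ^ (α r + c) • ((A r r j)ᵀ * B r * A r r i) := by
  simp only [Matrix.transpose_mul, Matrix.transpose_transpose, hBt, Matrix.smul_mul,
    Matrix.mul_smul, Matrix.mul_assoc]

/-- The symmetry of the remainder on the diagonal, which makes the equation for `A_j^{rr}`
solvable. -/
theorem remainder_transpose (hα : StrictAnti α) {c : ℕ}
    (hBt : ∀ r, (B r)ᵀ = (-1 : 𝕜) ^ (α r + c) • B r) (A : Coeffs 𝕜 μ) (r : Fin N) {j : ℕ}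
    (hj : 1 ≤ j) :
    (remainder α B A r r j)ᵀ = (-1 : 𝕜) ^ (j + (α r + c)) • remainder α B A r r j := by
  -- On the diagonal the first sum in the remainder is the pairing of the block `(r, r)` with itself
  -- without its two outer terms, and these are transposes of each other up to the sign.
  have hg : remainder α B A r r j = (pairing B A r r r j - (A r r 0)ᵀ * B r * A r r j -
      (-1 : 𝕜) ^ j • ((A r r j)ᵀ * B r * A r r 0)) +
      (∑ k ∈ Finset.univ.filter (fun k => k < r),
        if α k ≤ j + α r then (-1 : 𝕜) ^ (α k - α r) • pairing B A k r r (j + α r - α k) else 0) +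
      (∑ k ∈ Finset.univ.filter (fun k => r < k),
        if α r ≤ j + α k then pairing B A k r r (j + α k - α r) else 0) := by
    rw [remainder, pairing_eq B A r r r hj, if_neg (by simp), Finset.filter_false_of_mem
      (p := fun k => r < k ∧ k ≤ r) (fun k _ h => absurd h.1 h.2.not_gt)]
    simp only [Finset.sum_empty, add_zero]
    congr 2
    abel
  rw [hg]
  simp only [Matrix.transpose_add, Matrix.transpose_sub, smul_add, smul_sub,
    Matrix.transpose_sum, Finset.smul_sum]
  refine congrArg₂ _ (congrArg₂ _ ?_ ?_) ?_
  · rw [pairing_transpose B hBt, Matrix.transpose_smul, transpose_mid B hBt, transpose_mid B hBt,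
      smul_smul, smul_smul, ← pow_add, ← pow_add,
      neg_one_pow_congr (n := α r + c) (m := j + (α r + c) + j)
        (by rw [Nat.even_iff, Nat.even_iff]; omega)]
    abel
  · refine Finset.sum_congr rfl fun k hk => ?_
    simp only [Finset.mem_filter, Finset.mem_univ, true_and] at hk
    have := hα hk
    split_ifs with h
    · rw [Matrix.transpose_smul, pairing_transpose B hBt, smul_comm]
      congr 1
      rw [show j + α r - α k + (α k + c) = j + (α r + c) by omega]
    · simp
  · refine Finset.sum_congr rfl fun k hk => ?_
    simp only [Finset.mem_filter, Finset.mem_univ, true_and] at hk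
    have := hα hk
    split_ifs with h
    · rw [pairing_transpose B hBt]
      congr 1
      exact neg_one_pow_congr (by rw [Nat.even_iff, Nat.even_iff]; omega)
    · simp

/-- If `A₀` is an isometry of `B_r`, then `A₀ᵀ B_r` has the inverse `A₀ B_r⁻¹`. -/
theorem eq_mul_of_gram {r s : Fin N} {A₀ : Matrix (Fin (μ r)) (Fin (μ r)) 𝕜}
    (hBu : IsUnit (B r).det) (h : A₀ᵀ * B r * A₀ = B r) (X Y : Matrix (Fin (μ r)) (Fin (μ s)) 𝕜) :
    A₀ᵀ * B r * X = Y ↔ X = A₀ * (B r)⁻¹ * Y := by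
  have h1 : A₀ᵀ * B r * (A₀ * (B r)⁻¹) = 1 := by
    rw [← Matrix.mul_assoc, h, Matrix.mul_nonsing_inv _ hBu]
  have h2 := mul_eq_one_comm.1 h1
  constructor
  · rintro rfl
    rw [← Matrix.mul_assoc, h2, Matrix.one_mul]
  · rintro rfl
    rw [← Matrix.mul_assoc, h1, Matrix.one_mul]

/-- A Toeplitz block matrix preserves the form if and only if its leading diagonal coefficients do
and the other coefficients on and above the diagonal are computed by the recursive algorithm. -/
theorem preserves_iff_isComputed [CharZero 𝕜] (hα₀ : ∀ r, 0 < α r) (hα : StrictAnti α)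
    (hBu : ∀ r, IsUnit (B r).det) {c : ℕ}
    (hBt : ∀ r, (B r)ᵀ = (-1 : 𝕜) ^ (α r + c) • B r) (A : Coeffs 𝕜 μ) :
    (toeplitz α A)ᵀ * formT α B * toeplitz α A = formT α B ↔
      (∀ r, (A r r 0)ᵀ * B r * A r r 0 = B r) ∧
      ∃ Z, HasSign c α Z ∧ IsComputed α B Z A := by
  rw [preserves_iff_gramC B hα₀ hα hBu hBt]
  simp only [gramC_diag_zero B hα]
  refine and_congr_right fun h0 => ?_
  have hsign : ∀ {r : Fin N} {j : ℕ}, j < α r →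
      (-1 : 𝕜) ^ (α r - j + c + 1) = -(-1 : 𝕜) ^ (j + (α r + c)) := by
    intro r j hj
    rw [show j + (α r + c) = (α r - j + c) + 2 * j by omega, pow_add _ _ (2 * j), pow_succ]
    simp
  have hsq : ∀ n : ℕ, (-1 : 𝕜) ^ n * (-1) ^ n = 1 := fun n => by
    rw [← pow_add, ← two_mul]; simp
  have htr' : ∀ (r : Fin N) (j : ℕ), (-1 : 𝕜) ^ j • ((A r r j)ᵀ * B r * A r r 0) =
      (-1 : 𝕜) ^ (j + (α r + c)) • ((A r r 0)ᵀ * B r * A r r j)ᵀ := by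
    intro r j
    rw [transpose_mid B hBt, smul_smul, pow_add, _root_.mul_assoc ((-1 : 𝕜) ^ j), hsq,
      _root_.mul_one]
  constructor
  · rintro ⟨h1, h2⟩
    -- The recursion formula forces this choice of `Z`. The equation for the coefficient `(r, r, j)`
    -- says that it has the required symmetry.
    refine ⟨fun r j => (A r r 0)ᵀ * B r * A r r j + (1 / 2 : 𝕜) • remainder α B A r r j,
      fun r j hj hj' => ?_, fun r j hj hj' => ?_, fun r s hrs j hj => ?_⟩
    · have h3 := h1 r j hj hj'
      rw [gramC_diag B hα A r hj, htr'] at h3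
      have h4 : ((A r r 0)ᵀ * B r * A r r j)ᵀ = (-1 : 𝕜) ^ (j + (α r + c)) •
          (-((A r r 0)ᵀ * B r * A r r j) - remainder α B A r r j) := by
        have h5 : (-1 : 𝕜) ^ (j + (α r + c)) • ((A r r 0)ᵀ * B r * A r r j)ᵀ =
            -((A r r 0)ᵀ * B r * A r r j) - remainder α B A r r j := by
          rw [eq_sub_iff_add_eq, eq_neg_iff_add_eq_zero, ← h3]
          abel
        rw [← h5, smul_smul, hsq, one_smul]
      rw [Matrix.transpose_add, Matrix.transpose_smul, h4, remainder_transpose B hα hBt A r hj,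
        hsign hj']
      module
    · rw [← eq_mul_of_gram B (hBu r) (h0 r), add_sub_cancel_right]
    · rw [← Matrix.mul_neg, ← eq_mul_of_gram B (hBu r) (h0 r)]
      have := h2 r s hrs j hj
      rw [gramC_of_lt B hα A hrs] at this
      exact eq_neg_of_add_eq_zero_left this
  · rintro ⟨Z, hZ, h1, h2⟩
    refine ⟨fun r j hj hj' => ?_, fun r s hrs j hj => ?_⟩
    · have h3 := h1 r j hj hj'
      rw [← eq_mul_of_gram B (hBu r) (h0 r)] at h3
      rw [gramC_diag B hα A r hj, htr', h3, Matrix.transpose_sub, Matrix.transpose_smul,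
        hZ r j hj hj',
        remainder_transpose B hα hBt A r hj, hsign hj']
      simp only [smul_sub, smul_smul, neg_smul, smul_neg]
      rw [hsq, mul_comm (1 / 2 : 𝕜), ← mul_assoc, hsq]
      module
    · have := h2 r s hrs j hj
      rw [← Matrix.mul_neg, ← eq_mul_of_gram B (hBu r) (h0 r)] at this
      rw [gramC_of_lt B hα A hrs, this, neg_add_cancel]

end Form

/-! ### The recursion and the isotropy group in Toeplitz form -/

section Recursion

variable {𝕜 : Type*} [Field 𝕜] {N : ℕ} {α μ : Fin N → ℕ}
variable (B : ∀ r : Fin N, Matrix (Fin (μ r)) (Fin (μ r)) 𝕜)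

theorem pairing_congr {A A' : Coeffs 𝕜 μ} {k r s : Fin N} {n : ℕ}
    (h : ∀ l ≤ n, A k r l = A' k r l) (h' : ∀ l ≤ n, A k s l = A' k s l) :
    pairing B A k r s n = pairing B A' k r s n := by
  refine Finset.sum_congr rfl fun l hl => ?_
  rw [Finset.mem_range] at hl
  rw [h l (by omega), h' (n - l) (by omega)]

/-- The remainder involves only coefficients that precede the one to be computed. -/
theorem remainder_congr (hα : StrictAnti α) (A A' : Coeffs 𝕜 μ) (r s : Fin N) (j : ℕ)
    (hrs : r ≤ s) (h : ∀ r' s' j', Precedes r' s' j' r s j → A r' s' j' = A' r' s' j') :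
    remainder α B A r s j = remainder α B A' r s j := by
  have hv : (r : ℕ) ≤ s := hrs
  unfold remainder
  refine congrArg₂ _ (congrArg₂ _ (congrArg₂ _ (congrArg₂ _ ?_ ?_) ?_) ?_) ?_
  · refine Finset.sum_congr rfl fun l hl => ?_
    rw [Finset.mem_Ico] at hl
    rw [h r r l (Or.inr ⟨le_rfl, Or.inl hl.2⟩), h r s (j - l) (Or.inr ⟨hrs, Or.inl (by omega)⟩)]
  · split_ifs with h1
    · have h2 : (r : ℕ) < s := h1.1
      rw [h r r j (Or.inr ⟨le_rfl, Or.inr ⟨rfl, by omega⟩⟩), h r s 0 (Or.inr ⟨hrs, Or.inl h1.2⟩)]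
    · rfl
  · refine Finset.sum_congr rfl fun k hk => ?_
    simp only [Finset.mem_filter, Finset.mem_univ, true_and] at hk
    have := hα hk
    split_ifs
    · rw [pairing_congr B (A := A) (A' := A')]
      · exact fun l hl => h k r l (Or.inr ⟨hk.le, Or.inl (by omega)⟩)
      · exact fun l hl => h k s l (Or.inr ⟨hk.le.trans hrs, Or.inl (by omega)⟩)
    · rfl
  · refine Finset.sum_congr rfl fun k hk => ?_
    simp only [Finset.mem_filter, Finset.mem_univ, true_and] at hk
    have h1 : (r : ℕ) < k := hk.1
    have h2 : (k : ℕ) ≤ s := hk.2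
    refine pairing_congr B (fun l _ => h k r l (Or.inl hk.1)) fun l hl => ?_
    refine h k s l (Or.inr ⟨hk.2, ?_⟩)
    omega
  · refine Finset.sum_congr rfl fun k hk => ?_
    simp only [Finset.mem_filter, Finset.mem_univ, true_and] at hk
    split_ifs
    · exact pairing_congr B (fun l _ => h k r l (Or.inl (hrs.trans_lt hk)))
        fun l _ => h k s l (Or.inl hk)
    · rfl

/-- The step of the algorithm at which a coefficient is computed. -/
def rank (r s : Fin N) (j : ℕ) : ℕ := if s < r then 0 else j * (N + 1) + ((s : ℕ) - r) + 1

theorem rank_lt_of_precedes {r' s' r s : Fin N} {j' j : ℕ} (hrs : r ≤ s)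
    (h : Precedes r' s' j' r s j) : rank r' s' j' < rank r s j := by
  unfold rank
  rw [if_neg hrs.not_gt]
  have hs := s.2
  have hs' := s'.2
  rcases h with h | ⟨h, h'⟩
  · rw [if_pos h]
    omega
  · rw [if_neg h.not_gt]
    rcases h' with h' | ⟨rfl, h'⟩
    · have : (j' + 1) * (N + 1) ≤ j * (N + 1) := Nat.mul_le_mul_right _ h'
      rw [Nat.add_mul] at this
      omega
    · omega

/-- Induction along the order of the computation. -/
theorem precedes_induction {P : Fin N → Fin N → ℕ → Prop}
    (h : ∀ r s j, r ≤ s → (∀ r' s' j', r' ≤ s' → Precedes r' s' j' r s j → P r' s' j') →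
      P r s j) (r s : Fin N) (j : ℕ) (hrs : r ≤ s) : P r s j := by
  induction hn : rank r s j using Nat.strong_induction_on generalizing r s j with
  | _ n ih =>
    exact h r s j hrs fun r' s' j' h' hp =>
      ih _ (hn ▸ rank_lt_of_precedes hrs hp) r' s' j' h' rfl

/-- A recursion in which every value depends only on values of smaller rank has a solution. -/
theorem exists_fixed_of_rank {ι : Type*} {X : ι → Type*} [∀ i, Zero (X i)] (ρ : ι → ℕ)
    (Φ : (∀ i, X i) → ∀ i, X i)
    (hΦ : ∀ f g i, (∀ k, ρ k < ρ i → f k = g k) → Φ f i = Φ g i) : ∃ f, Φ f = f := by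
  have key : ∀ n m, n ≤ m → ∀ i, ρ i < n →
      (Φ^[m] fun _ => 0) i = (Φ^[n] fun _ => 0) i := by
    intro n
    induction n with
    | zero => intro m _ i hi; omega
    | succ n ih =>
      intro m hm i hi
      obtain ⟨m, rfl⟩ : ∃ m', m = m' + 1 := ⟨m - 1, by omega⟩
      rw [Function.iterate_succ_apply', Function.iterate_succ_apply']
      exact hΦ _ _ _ fun k hk => ih m (by omega) k (by omega)
  refine ⟨fun i => (Φ^[ρ i + 1] fun _ => 0) i, ?_⟩
  funext i
  rw [Function.iterate_succ_apply']
  exact hΦ _ _ _ fun k hk => (key (ρ k + 1) (ρ i) hk k (by omega)).symm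

/-- The algorithm produces a family of coefficients for every input. -/
theorem exists_isComputed (hα₀ : ∀ r, 0 < α r) (hα : StrictAnti α)
    (A₀ : ∀ r : Fin N, Matrix (Fin (μ r)) (Fin (μ r)) 𝕜) (L : Coeffs 𝕜 μ)
    (Z : ∀ r : Fin N, ℕ → Matrix (Fin (μ r)) (Fin (μ r)) 𝕜) :
    ∃ A : Coeffs 𝕜 μ, (∀ r s j, min (α r) (α s) ≤ j → A r s j = 0) ∧ (∀ r, A r r 0 = A₀ r) ∧
      (∀ r s, s < r → ∀ j < α r, A r s j = L r s j) ∧ IsComputed α B Z A := by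
  classical
  -- One step of the algorithm, applied to all coefficients at once. The coefficients of the desired
  -- element form a fixed point of it.
  let Φ : Coeffs 𝕜 μ → Coeffs 𝕜 μ := fun A r s j =>
    if min (α r) (α s) ≤ j then 0 else if s < r then L r s j else
      if h : r = s then if j = 0 then h ▸ A₀ r else
        h ▸ (A₀ r * (B r)⁻¹ * (Z r j - (1 / 2 : 𝕜) • remainder α B A r r j))
      else -(A₀ r * (B r)⁻¹ * remainder α B A r s j)
  obtain ⟨f, hf⟩ := exists_fixed_of_rank
    (X := fun i : Fin N × Fin N × ℕ => Matrix (Fin (μ i.1)) (Fin (μ i.2.1)) 𝕜)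
    (fun i => rank i.1 i.2.1 i.2.2) (fun f i => Φ (fun r s j => f (r, s, j)) i.1 i.2.1 i.2.2) (by
      rintro f g ⟨r, s, j⟩ h
      have hr : r ≤ s → remainder α B (fun r s j => f (r, s, j)) r s j =
          remainder α B (fun r s j => g (r, s, j)) r s j := fun hrs =>
        remainder_congr B hα _ _ r s j hrs fun r' s' j' hp =>
          h (r', s', j') (rank_lt_of_precedes hrs hp)
      simp only [Φ]
      split_ifs with h1 h2 h3 h4
      · rfl
      · rfl
      · rfl
      · subst h3
        rw [hr le_rfl]
      · rw [hr (not_lt.1 h2)])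
  have hA : ∀ r s j, Φ (fun r s j => f (r, s, j)) r s j = f (r, s, j) := fun r s j =>
    congrFun hf (r, s, j)
  have h0 : ∀ r, f (r, r, 0) = A₀ r := fun r => by
    rw [← hA]
    simp [Φ, (hα₀ r).ne']
  refine ⟨fun r s j => f (r, s, j), fun r s j h => ?_, h0, fun r s hsr j hj => ?_,
    fun r j hj hj' => ?_, fun r s hrs j hj => ?_⟩
  · simp only [← hA r s j, Φ, if_pos h]
  · have := hα hsr
    simp only [← hA r s j, Φ]
    rw [if_neg (by omega), if_pos hsr]
  · simp only [h0]
    simp only [← hA r r j, Φ]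
    rw [if_neg (by simpa using hj'), if_neg (lt_irrefl r), dif_pos trivial, if_neg (by omega)]
  · have := hα hrs
    simp only [h0]
    simp only [← hA r s j, Φ]
    rw [if_neg (by omega), if_neg hrs.not_gt, dif_neg hrs.ne]

/-- The output of the algorithm is determined by the input. -/
theorem IsComputed.unique (hα : StrictAnti α)
    {Z : ∀ r : Fin N, ℕ → Matrix (Fin (μ r)) (Fin (μ r)) 𝕜} {A A' : Coeffs 𝕜 μ}
    (hA : IsComputed α B Z A) (hA' : IsComputed α B Z A') (h0 : ∀ r, A r r 0 = A' r r 0)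
    (hlow : ∀ r s, s < r → ∀ j < α r, A r s j = A' r s j)
    (hout : ∀ r s j, min (α r) (α s) ≤ j → A r s j = A' r s j) : A = A' := by
  have hlow' : ∀ r s j, s < r → A r s j = A' r s j := fun r s j h => by
    have := hα h
    rcases lt_or_ge j (α r) with h1 | h1
    · exact hlow r s h j h1
    · exact hout r s j (by omega)
  have key : ∀ r s j, r ≤ s → A r s j = A' r s j := precedes_induction fun r s j hrs ih => by
    have hr : remainder α B A r s j = remainder α B A' r s j :=
      remainder_congr B hα A A' r s j hrs fun r' s' j' hp => by
        rcases lt_or_ge s' r' with h1 | h1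
        · exact hlow' r' s' j' h1
        · exact ih r' s' j' h1 hp
    by_cases h1 : min (α r) (α s) ≤ j
    · exact hout r s j h1
    · rcases hrs.eq_or_lt with rfl | hrs
      · rcases Nat.eq_zero_or_pos j with rfl | hj
        · exact h0 r
        · rw [hA.1 r j hj (by omega), hA'.1 r j hj (by omega), hr, h0]
      · rw [hA.2 r s hrs j (by omega), hA'.2 r s hrs j (by omega), hr, h0]
  funext r s j
  rcases lt_or_ge s r with h | h
  · exact hlow' r s j h
  · exact key r s j h

variable (α) in
/-- The isotropy group in Toeplitz form: the isometries of the form that commute with the nilpotent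
matrix. -/
abbrev isoT : Subgroup (GeneralLinearGroup (TIdx α μ) 𝕜) :=
  stab (formGroup (formT α B)) (shiftT 𝕜 α μ)

theorem mem_stab_iff {ι : Type*} [Fintype ι] [DecidableEq ι]
    {G : Subgroup (GeneralLinearGroup ι 𝕜)} {M : Matrix ι ι 𝕜} {Q : GeneralLinearGroup ι 𝕜} :
    Q ∈ stab G M ↔ Q ∈ G ∧ Commute (Q : Matrix ι ι 𝕜) M := by
  refine and_congr_right fun _ => ?_
  change (↑Q⁻¹ : Matrix ι ι 𝕜) * M * (Q : Matrix ι ι 𝕜) = M ↔ _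
  rw [commute_iff_eq, _root_.mul_assoc, Units.inv_mul_eq_iff_eq_mul, eq_comm]

theorem mem_formGroup_iff {ι : Type*} [Fintype ι] [DecidableEq ι] {H : Matrix ι ι 𝕜}
    {Q : GeneralLinearGroup ι 𝕜} :
    Q ∈ formGroup H ↔ (Q : Matrix ι ι 𝕜)ᵀ * H * (Q : Matrix ι ι 𝕜) = H := Iff.rfl

theorem mem_isoT_iff {X : GeneralLinearGroup (TIdx α μ) 𝕜} :
    X ∈ isoT α B ↔ (X : Matrix _ _ 𝕜)ᵀ * formT α B * (X : Matrix _ _ 𝕜) = formT α B ∧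
      Commute (X : Matrix _ _ 𝕜) (shiftT 𝕜 α μ) := by
  rw [mem_stab_iff, mem_formGroup_iff]

theorem toeplitz_coeff_of_mem {X : GeneralLinearGroup (TIdx α μ) 𝕜}
    (hX : X ∈ toeplitzSet 𝕜 α μ) : toeplitz α (coeff X) = (X : Matrix _ _ 𝕜) := by
  obtain ⟨A, hA, -⟩ := hX
  rw [coeff_eq_matCoeff, hA, toeplitz_matCoeff_toeplitz]

theorem ext_of_coeff {X Y : GeneralLinearGroup (TIdx α μ) 𝕜} (hX : X ∈ toeplitzSet 𝕜 α μ)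
    (hY : Y ∈ toeplitzSet 𝕜 α μ)
    (h : ∀ r s j, j < min (α r) (α s) → coeff X r s j = coeff Y r s j) : X = Y := by
  refine Units.ext ?_
  rw [← toeplitz_coeff_of_mem hX, ← toeplitz_coeff_of_mem hY]
  exact toeplitz_congr h

theorem coeff_of_le (X : GeneralLinearGroup (TIdx α μ) 𝕜) {r s : Fin N} {j : ℕ}
    (h : min (α r) (α s) ≤ j) : coeff X r s j = 0 := by
  rw [coeff_eq_matCoeff, matCoeff_of_le _ h]

/-- The hypotheses on the sizes and on the forms `B_r` under which the isotropy group is studied: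
the sizes decrease, and `B_r` is nonsingular and symmetric or skew-symmetric according to the
parity of `α_r + c`. -/
structure IsAdmissible (c : ℕ) (α : Fin N → ℕ) (B : ∀ r : Fin N, Matrix (Fin (μ r)) (Fin (μ r)) 𝕜) :
    Prop where
  pos : ∀ r, 0 < α r
  anti : StrictAnti α
  isUnit : ∀ r, IsUnit (B r).det
  transpose : ∀ r, (B r)ᵀ = (-1 : 𝕜) ^ (α r + c) • B r

variable {B} {c : ℕ}

theorem IsAdmissible.isUnit_of_gram (h : IsAdmissible c α B) {r : Fin N}
    {A₀ : Matrix (Fin (μ r)) (Fin (μ r)) 𝕜} (hA : A₀ᵀ * B r * A₀ = B r) : IsUnit A₀ := by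
  refine IsUnit.of_mul_eq_one_right ((B r)⁻¹ * (A₀ᵀ * B r)) ?_
  rw [Matrix.mul_assoc, hA, Matrix.nonsing_inv_mul _ (h.isUnit r)]

/-- The isotropy group consists of the Toeplitz block matrices whose coefficients are an output of
the algorithm. -/
theorem IsAdmissible.mem_isoT_iff [CharZero 𝕜] (h : IsAdmissible c α B)
    {X : GeneralLinearGroup (TIdx α μ) 𝕜} :
    X ∈ isoT α B ↔ X ∈ toeplitzSet 𝕜 α μ ∧
      (∀ r, (coeff X r r 0)ᵀ * B r * coeff X r r 0 = B r) ∧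
      ∃ Z, HasSign c α Z ∧ IsComputed α B Z (coeff X) := by
  rw [BlockToeplitz.mem_isoT_iff]
  constructor
  · rintro ⟨h1, h2⟩
    have h3 := toeplitz_matCoeff_of_commute h2
    rw [← coeff_eq_matCoeff] at h3
    rw [← h3, preserves_iff_isComputed B h.pos h.anti h.isUnit h.transpose] at h1
    exact ⟨⟨_, h3.symm, fun r => h.isUnit_of_gram (h1.1 r)⟩, h1⟩
  · rintro ⟨h1, h2⟩
    have h3 := toeplitz_coeff_of_mem h1
    rw [← preserves_iff_isComputed B h.pos h.anti h.isUnit h.transpose, h3] at h2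
    exact ⟨h2, h3 ▸ toeplitz_commute_shiftT _⟩

theorem IsAdmissible.isoT_subset [CharZero 𝕜] (h : IsAdmissible c α B) :
    (isoT α B : Set (GeneralLinearGroup (TIdx α μ) 𝕜)) ⊆ toeplitzSet 𝕜 α μ :=
  fun _ hX => (h.mem_isoT_iff.1 hX).1

/-- A Toeplitz block matrix that preserves the form is invertible, hence an element of the isotropy
group. -/
theorem IsAdmissible.exists_of_preserves (h : IsAdmissible c α B)
    {M : Matrix (TIdx α μ) (TIdx α μ) 𝕜}
    (hM : Mᵀ * formT α B * M = formT α B) (hc : Commute M (shiftT 𝕜 α μ)) :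
    ∃ X ∈ isoT α B, (X : Matrix (TIdx α μ) (TIdx α μ) 𝕜) = M := by
  have hu : IsUnit M := by
    refine IsUnit.of_mul_eq_one_right ((formT α B)⁻¹ * (Mᵀ * formT α B)) ?_
    rw [Matrix.mul_assoc, hM, Matrix.nonsing_inv_mul _ (isUnit_det_formT B h.isUnit)]
  obtain ⟨X, rfl⟩ := hu
  exact ⟨X, (BlockToeplitz.mem_isoT_iff B).2 ⟨hM, hc⟩, rfl⟩

/-- For every input of the algorithm there is an element of the isotropy group. -/
theorem IsAdmissible.exists_mem_isoT [CharZero 𝕜] (h : IsAdmissible c α B)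
    (A₀ : ∀ r : Fin N, Matrix (Fin (μ r)) (Fin (μ r)) 𝕜) (L : Coeffs 𝕜 μ)
    (Z : ∀ r : Fin N, ℕ → Matrix (Fin (μ r)) (Fin (μ r)) 𝕜)
    (hA₀ : ∀ r, (A₀ r)ᵀ * B r * A₀ r = B r) (hZ : HasSign c α Z) :
    ∃ X ∈ isoT α B, (∀ r, coeff X r r 0 = A₀ r) ∧
      (∀ r s, s < r → ∀ j < α r, coeff X r s j = L r s j) ∧ IsComputed α B Z (coeff X) := by
  obtain ⟨A, h1, h2, h3, h4⟩ := exists_isComputed B h.pos h.anti A₀ L Z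
  obtain ⟨X, hX, hXA⟩ := h.exists_of_preserves
    ((preserves_iff_isComputed B h.pos h.anti h.isUnit h.transpose A).2
      ⟨fun r => by rw [h2]; exact hA₀ r, Z, hZ, h4⟩) (toeplitz_commute_shiftT A)
  have : coeff X = A := by
    funext r s j
    rw [coeff_eq_matCoeff, hXA, matCoeff_toeplitz]
    split_ifs with h5
    · rfl
    · exact (h1 r s j (not_lt.1 h5)).symm
  exact ⟨X, hX, by rw [this]; exact ⟨h2, h3, h4⟩⟩

end Recursion

/-! ### The binomial series for the square root -/

section Sqrt

variable {𝕜 : Type*} [Field 𝕜]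

/-- The coefficients of the power series of `√(1 - y)`. -/
def sqrtCoeff (𝕜 : Type*) [Field 𝕜] (n : ℕ) : 𝕜 := if n = 0 then 1 else catalanCoeff 𝕜 (n - 1)

theorem sqrtCoeff_mk_mul_self [CharZero 𝕜] :
    PowerSeries.mk (sqrtCoeff 𝕜) * PowerSeries.mk (sqrtCoeff 𝕜) = 1 - PowerSeries.X := by
  have h1 : PowerSeries.mk (sqrtCoeff 𝕜) =
      1 + PowerSeries.X * PowerSeries.mk (catalanCoeff 𝕜) := by
    ext n
    cases n with
    | zero => simp [sqrtCoeff]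
    | succ n => simp [sqrtCoeff, PowerSeries.coeff_succ_X_mul, PowerSeries.coeff_one]
  -- This functional equation of the generating series is the recursion of the Catalan numbers.
  have h2 : 2 * PowerSeries.mk (catalanCoeff 𝕜) + PowerSeries.X *
      (PowerSeries.mk (catalanCoeff 𝕜) * PowerSeries.mk (catalanCoeff 𝕜)) = -1 := by
    have h3 : (2 : PowerSeries 𝕜) = PowerSeries.C (2 : 𝕜) := (map_ofNat PowerSeries.C 2).symm
    rw [h3]
    ext n
    cases n with
    | zero => norm_num [catalanCoeff]
    | succ n =>
      rw [map_add, PowerSeries.coeff_C_mul, PowerSeries.coeff_succ_X_mul, PowerSeries.coeff_mul]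
      simp only [PowerSeries.coeff_mk, map_neg, PowerSeries.coeff_one, Nat.add_eq_zero_iff,
        one_ne_zero, and_false, if_false, neg_zero]
      have h4 : ∀ x ∈ Finset.HasAntidiagonal.antidiagonal n,
          catalanCoeff 𝕜 x.1 * catalanCoeff 𝕜 x.2 =
          ((catalan x.1 * catalan x.2 : ℕ) : 𝕜) / 2 ^ (2 * n + 2) := by
        intro x hx
        rw [Finset.HasAntidiagonal.mem_antidiagonal] at hx
        rw [← hx, catalanCoeff, catalanCoeff, neg_div, neg_div, neg_mul_neg, div_mul_div_comm,
          ← pow_add]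
        push_cast
        congr 2
        ring
      rw [Finset.sum_congr rfl h4, ← Finset.sum_div, ← Nat.cast_sum, ← catalan_succ', catalanCoeff]
      field_simp
      ring
  calc _ = 1 + PowerSeries.X * (2 * PowerSeries.mk (catalanCoeff 𝕜) + PowerSeries.X *
      (PowerSeries.mk (catalanCoeff 𝕜) * PowerSeries.mk (catalanCoeff 𝕜))) := by rw [h1]; ring
    _ = _ := by rw [h2]; ring

/-- At a nilpotent element the truncated binomial series is a square root of `1 - y`. -/
theorem sqrtCoeff_sum_mul_self [CharZero 𝕜] {R : Type*} [Ring R] [Algebra 𝕜 R] {y : R}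
    {K : ℕ} (hy : y ^ K = 0) :
    (∑ l ∈ Finset.range K, sqrtCoeff 𝕜 l • y ^ l) * ∑ l ∈ Finset.range K, sqrtCoeff 𝕜 l • y ^ l =
      1 - y := by
  set p : Polynomial 𝕜 := ∑ l ∈ Finset.range K, Polynomial.monomial l (sqrtCoeff 𝕜 l) with hp
  have hev : Polynomial.aeval y p = ∑ l ∈ Finset.range K, sqrtCoeff 𝕜 l • y ^ l := by
    simp [hp, Polynomial.aeval_monomial, Algebra.smul_def]
  have hcoef : ∀ l < K, p.coeff l = sqrtCoeff 𝕜 l := by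
    intro l hl
    simp [hp, Polynomial.finsetSum_coeff, Polynomial.coeff_monomial, hl]
  -- The truncated series satisfies the identity for the full series modulo `X ^ K`.
  have hdvd : Polynomial.X ^ K ∣ p * p - (1 - Polynomial.X) := by
    rw [Polynomial.X_pow_dvd_iff]
    intro d hd
    have h1 : (p * p).coeff d = PowerSeries.coeff d
        (PowerSeries.mk (sqrtCoeff 𝕜) * PowerSeries.mk (sqrtCoeff 𝕜)) := by
      rw [Polynomial.coeff_mul, PowerSeries.coeff_mul]
      refine Finset.sum_congr rfl fun x hx => ?_
      rw [Finset.HasAntidiagonal.mem_antidiagonal] at hx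
      rw [hcoef _ (by omega), hcoef _ (by omega), PowerSeries.coeff_mk, PowerSeries.coeff_mk]
    rw [Polynomial.coeff_sub, h1, sqrtCoeff_mk_mul_self]
    simp [Polynomial.coeff_one, Polynomial.coeff_X, PowerSeries.coeff_one, PowerSeries.coeff_X,
      eq_comm]
  obtain ⟨q, hq⟩ := hdvd
  have h2 := congrArg (Polynomial.aeval y) hq
  simp only [map_sub, map_mul, map_one, map_pow, Polynomial.aeval_X, hev, hy, zero_mul] at h2
  exact sub_eq_zero.1 h2

end Sqrt

/-! ### The generators -/

section Generators

variable {𝕜 : Type*} [Field 𝕜] {N : ℕ} {α μ : Fin N → ℕ}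

/-- The family of coefficients whose only nonzero member is `A_k^{tp} = F`. -/
def single (t p : Fin N) (k : ℕ) (F : Matrix (Fin (μ t)) (Fin (μ p)) 𝕜) : Coeffs 𝕜 μ :=
  Pi.single t (Pi.single p (Pi.single k F))

theorem single_same (t p : Fin N) (k : ℕ) (F : Matrix (Fin (μ t)) (Fin (μ p)) 𝕜) (j : ℕ) :
    single t p k F t p j = if j = k then F else 0 := by
  simp only [single, Pi.single_eq_same, Pi.single_apply]

theorem single_of_ne {t p : Fin N} {k : ℕ} (F : Matrix (Fin (μ t)) (Fin (μ p)) 𝕜) {r s : Fin N}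
    {j : ℕ} (h : ¬(r = t ∧ s = p ∧ j = k)) : single t p k F r s j = 0 := by
  by_cases h1 : r = t
  · subst h1
    by_cases h2 : s = p
    · subst h2
      rw [single_same, if_neg (fun h3 => h ⟨rfl, rfl, h3⟩)]
    · simp only [single, Pi.single_eq_same]
      rw [Pi.single_eq_of_ne h2]
      rfl
  · simp only [single]
    rw [Pi.single_eq_of_ne h1]
    rfl

theorem toeplitz_single_mul (t p u : Fin N) (k k' : ℕ) (F : Matrix (Fin (μ t)) (Fin (μ p)) 𝕜)
    (F' : Matrix (Fin (μ p)) (Fin (μ u)) 𝕜) :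
    toeplitz α (single t p k F) * toeplitz α (single p u k' F') =
      toeplitz α (single t u (k + k' + gap α t p u) (F * F')) := by
  rw [toeplitz_mul]
  congr 1
  funext r s j
  rw [conv]
  by_cases hr : r = t
  · subst hr
    by_cases hs : s = u
    · subst hs
      rw [Finset.sum_eq_single p]
      · rw [single_same]
        simp only [single_same]
        split_ifs with h1 h2 h2
        · rw [Finset.sum_eq_single k]
          · rw [if_pos rfl, if_pos (by omega)]
          · intro l _ hl
            rw [if_neg hl, Matrix.zero_mul]
          · intro h
            rw [Finset.mem_range] at h
            omega
        · refine Finset.sum_eq_zero fun l hl => ?_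
          rw [Finset.mem_range] at hl
          by_cases hl' : l = k
          · rw [if_neg (c := j - gap α r p s - l = k') (by omega), Matrix.mul_zero]
          · rw [if_neg hl', Matrix.zero_mul]
        · omega
        · rfl
      · intro x _ hx
        split_ifs
        · refine Finset.sum_eq_zero fun l _ => ?_
          rw [single_of_ne F (by tauto), Matrix.zero_mul]
        · rfl
      · simp
    · rw [single_of_ne _ (by tauto)]
      refine Finset.sum_eq_zero fun x _ => ?_
      split_ifs
      · refine Finset.sum_eq_zero fun l _ => ?_
        rw [single_of_ne F' (by tauto), Matrix.mul_zero]
      · rfl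
  · rw [single_of_ne _ (by tauto)]
    refine Finset.sum_eq_zero fun x _ => ?_
    split_ifs
    · refine Finset.sum_eq_zero fun l _ => ?_
      rw [single_of_ne F (by tauto), Matrix.zero_mul]
    · rfl

theorem toeplitz_single_mul_of_ne {p q : Fin N} (h : p ≠ q) (t u : Fin N) (k k' : ℕ)
    (F : Matrix (Fin (μ t)) (Fin (μ p)) 𝕜) (F' : Matrix (Fin (μ q)) (Fin (μ u)) 𝕜) :
    toeplitz α (single t p k F) * toeplitz α (single q u k' F') = 0 := by
  rw [toeplitz_mul]
  have : conv α (single t p k F) (single q u k' F') = 0 := by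
    funext r s j
    refine Finset.sum_eq_zero fun x _ => ?_
    split_ifs
    · refine Finset.sum_eq_zero fun l _ => ?_
      by_cases hx : x = p
      · rw [single_of_ne F' (by rintro ⟨h1, -⟩; exact h (hx.symm.trans h1)), Matrix.mul_zero]
      · rw [single_of_ne F (by tauto), Matrix.zero_mul]
    · rfl
  rw [this]
  refine ext_blk fun r i s i' => ?_
  rw [blk_toeplitz]
  split_ifs <;> rfl

theorem toeplitz_single_pow (p : Fin N) (w : ℕ) (M : Matrix (Fin (μ p)) (Fin (μ p)) 𝕜) {n : ℕ}
    (hn : 1 ≤ n) :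
    toeplitz α (single p p w M) ^ n = toeplitz α (single p p (n * w) (M ^ n)) := by
  induction n, hn using Nat.le_induction with
  | base => simp
  | succ n _ ih =>
    rw [pow_succ, ih, toeplitz_single_mul, pow_succ]
    congr 2
    simp [gap, Nat.add_mul]

theorem toeplitz_single_eq_zero {t p : Fin N} {k : ℕ} (h : min (α t) (α p) ≤ k)
    (F : Matrix (Fin (μ t)) (Fin (μ p)) 𝕜) : toeplitz α (single t p k F) = 0 := by
  have h1 : toeplitz α (0 : Coeffs 𝕜 μ) = 0 := by
    refine ext_blk fun r i s i' => ?_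
    rw [blk_toeplitz]
    split_ifs <;> rfl
  rw [← h1]
  refine toeplitz_congr fun r s j hj => single_of_ne F ?_
  rintro ⟨rfl, rfl, rfl⟩
  omega

theorem adjC_single (B : ∀ r : Fin N, Matrix (Fin (μ r)) (Fin (μ r)) 𝕜) (t p : Fin N) (k : ℕ)
    (F : Matrix (Fin (μ t)) (Fin (μ p)) 𝕜) :
    adjC B α (single t p k F) =
      single p t k ((-1 : 𝕜) ^ (k + (α t - α p)) • ((B p)⁻¹ * Fᵀ * B t)) := by
  funext r s j
  rw [adjC]
  by_cases h : s = t ∧ r = p ∧ j = k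
  · obtain ⟨rfl, rfl, rfl⟩ := h
    rw [single_same, single_same, if_pos rfl, if_pos rfl]
  · rw [single_of_ne F h, single_of_ne _ (by tauto)]
    simp

theorem conj_pow {R : Type*} [Monoid R] {P Q : R} (h : P * Q = 1) (h' : Q * P = 1) (X : R) (n : ℕ) :
    P * X ^ n * Q = (P * X * Q) ^ n := by
  induction n with
  | zero => simp [h]
  | succ n ih =>
    rw [pow_succ, pow_succ, ← ih]
    simp only [mul_assoc]
    rw [← mul_assoc Q P, h', one_mul]

theorem transpose_pow_mul {ι : Type*} [Fintype ι] [DecidableEq ι] {H y : Matrix ι ι 𝕜}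
    (h : yᵀ * H = H * y) (n : ℕ) : (y ^ n)ᵀ * H = H * y ^ n := by
  induction n with
  | zero => simp
  | succ n ih =>
    rw [pow_succ, Matrix.transpose_mul, Matrix.mul_assoc, ih, ← Matrix.mul_assoc, h,
      Matrix.mul_assoc, ← pow_succ', ← pow_succ]

/-- If `Φ² = 0`, `Ψ² = 0` and `Ψ` is the adjoint of `Φ`, then `Φ - Ψ + √(1 - ΨΦ - ΦΨ)` is an
isometry: `θ = Φ - Ψ` is skew-adjoint with `θ² = -(ΨΦ + ΦΨ)`, and it commutes with the self-adjoint
square root of `1 + θ²`. -/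
theorem isometry_of_sqrt [CharZero 𝕜] {ι : Type*} [Fintype ι] [DecidableEq ι]
    {H Φ Ψ : Matrix ι ι 𝕜} (h1 : Φᵀ * H = H * Ψ) (h2 : Ψᵀ * H = H * Φ) (h3 : Φ * Φ = 0)
    (h4 : Ψ * Ψ = 0) {K : ℕ} (hy : (Ψ * Φ + Φ * Ψ) ^ K = 0) :
    let Y := Φ - Ψ + ∑ l ∈ Finset.range K, sqrtCoeff 𝕜 l • (Ψ * Φ + Φ * Ψ) ^ l
    Yᵀ * H * Y = H := by
  intro Y
  set y := Ψ * Φ + Φ * Ψ with hyd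
  set s := ∑ l ∈ Finset.range K, sqrtCoeff 𝕜 l • y ^ l with hs
  have hss : s * s = 1 - y := sqrtCoeff_sum_mul_self hy
  have hyt : yᵀ * H = H * y := by
    rw [hyd, Matrix.transpose_add, Matrix.transpose_mul, Matrix.transpose_mul, Matrix.add_mul,
      Matrix.mul_add, Matrix.mul_assoc, h2, ← Matrix.mul_assoc, h1, Matrix.mul_assoc Ψᵀ, h1,
      ← Matrix.mul_assoc Ψᵀ, h2, Matrix.mul_assoc, Matrix.mul_assoc]
  have hst : sᵀ * H = H * s := by
    rw [hs, Matrix.transpose_sum, Finset.sum_mul, Finset.mul_sum]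
    refine Finset.sum_congr rfl fun l _ => ?_
    rw [Matrix.transpose_smul, Matrix.smul_mul, transpose_pow_mul hyt, Matrix.mul_smul]
  have hθ : (Φ - Ψ) * (Φ - Ψ) = -y := by
    rw [Matrix.sub_mul, Matrix.mul_sub, Matrix.mul_sub, h3, h4, hyd]
    abel
  have hc : Commute (Φ - Ψ) s := by
    have h5 : Commute (Φ - Ψ) y := by
      have : y = -((Φ - Ψ) * (Φ - Ψ)) := by rw [hθ, neg_neg]
      rw [this]
      exact ((Commute.refl _).mul_right (Commute.refl _)).neg_right
    exact Commute.sum_right _ _ _ fun l _ => (h5.pow_right l).smul_right _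
  have hYt : Yᵀ * H = H * (s - (Φ - Ψ)) := by
    change ((Φ - Ψ + s)ᵀ) * H = _
    rw [Matrix.transpose_add, Matrix.transpose_sub, Matrix.add_mul, Matrix.sub_mul, h1, h2, hst,
      ← Matrix.mul_sub, ← Matrix.mul_add]
    congr 1
    abel
  rw [hYt, Matrix.mul_assoc]
  change H * ((s - (Φ - Ψ)) * (Φ - Ψ + s)) = H
  have : (s - (Φ - Ψ)) * (Φ - Ψ + s) = 1 := by
    rw [Matrix.sub_mul, Matrix.mul_add, Matrix.mul_add, hss, hθ, ← hc.eq]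
    abel
  rw [this, Matrix.mul_one]

variable {B : ∀ r : Fin N, Matrix (Fin (μ r)) (Fin (μ r)) 𝕜} {c : ℕ}

theorem matCoeff_toeplitz_single (t p : Fin N) (k : ℕ) (F : Matrix (Fin (μ t)) (Fin (μ p)) 𝕜)
    {r s : Fin N} {j : ℕ} (hj : j < min (α r) (α s)) :
    matCoeff (toeplitz α (single t p k F)) r s j = single t p k F r s j := by
  rw [matCoeff_toeplitz, if_pos hj]

/-- For every value of the parameters the generator of the second kind exists and lies in the
isotropy group. -/
theorem IsAdmissible.exists_isOffDiagGen [CharZero 𝕜] (h : IsAdmissible c α B) {p t : Fin N}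
    (hpt : p < t) {k : ℕ} (hk : k < α t) (F : Matrix (Fin (μ t)) (Fin (μ p)) 𝕜) :
    ∃ X ∈ isoT α B, IsOffDiagGen B p t k F X := by
  have hα := h.anti hpt
  have hα₀ := h.pos t
  set w := 2 * k + (α p - α t) with hw
  have hw0 : 0 < w := by omega
  -- The block `(p, t)` of the generator is `-G`, where `G` is the coefficient of the adjoint of the
  -- Toeplitz matrix with the single coefficient `F`. The products `GF` and `FG` occur with the
  -- shift `w`.
  set G : Matrix (Fin (μ p)) (Fin (μ t)) 𝕜 := (-1 : 𝕜) ^ k • ((B p)⁻¹ * Fᵀ * B t) with hG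
  set Φ := toeplitz α (single t p k F) with hΦ
  set Ψ := toeplitz α (single p t k G) with hΨ
  have hadj : Φᵀ * formT α B = formT α B * Ψ := by
    rw [hΦ, transpose_toeplitz_mul_formT B h.isUnit, adjC_single, Nat.sub_eq_zero_of_le hα.le,
      add_zero]
  have hadj' : Ψᵀ * formT α B = formT α B * Φ := by
    have h1 := congrArg Matrix.transpose hadj
    rw [Matrix.transpose_mul, Matrix.transpose_mul, Matrix.transpose_transpose,
      formT_transpose B h.transpose, Matrix.smul_mul, Matrix.mul_smul] at h1
    have h2 := congrArg (fun M => (-1 : 𝕜) ^ (c + 1) • M) h1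
    simp only [smul_smul, ← pow_add, ← two_mul] at h2
    simpa using h2.symm
  have hy : Ψ * Φ + Φ * Ψ = toeplitz α (single p p w (G * F)) +
      toeplitz α (single t t w (F * G)) := by
    rw [hΦ, hΨ, toeplitz_single_mul, toeplitz_single_mul]
    congr 3 <;> · unfold gap; omega
  -- The two summands of `Ψ * Φ + Φ * Ψ` live in different diagonal blocks, so powers are taken
  -- separately.
  have hypow : ∀ l, 1 ≤ l → (Ψ * Φ + Φ * Ψ) ^ l = toeplitz α (single p p (l * w) ((G * F) ^ l)) +
      toeplitz α (single t t (l * w) ((F * G) ^ l)) := by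
    intro l hl
    rw [← toeplitz_single_pow _ _ _ hl, ← toeplitz_single_pow _ _ _ hl, hy]
    induction l, hl using Nat.le_induction with
    | base => simp
    | succ l hl ih =>
      rw [pow_succ, ih, pow_succ, pow_succ, Matrix.add_mul, Matrix.mul_add, Matrix.mul_add,
        toeplitz_single_pow _ _ _ hl, toeplitz_single_pow _ _ _ hl,
        toeplitz_single_mul_of_ne hpt.ne, toeplitz_single_mul_of_ne hpt.ne', add_zero, zero_add]
  have hynil : (Ψ * Φ + Φ * Ψ) ^ α p = 0 := by
    have h1 : α p ≤ α p * w := Nat.le_mul_of_pos_right _ hw0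
    rw [hypow _ (by omega), toeplitz_single_eq_zero, toeplitz_single_eq_zero, add_zero]
    · omega
    · omega
  have hiso := isometry_of_sqrt (𝕜 := 𝕜) hadj hadj' (toeplitz_single_mul_of_ne hpt.ne _ _ _ _ _ _)
    (toeplitz_single_mul_of_ne hpt.ne' _ _ _ _ _ _) hynil
  have hsum : ∑ l ∈ Finset.range (α p), sqrtCoeff 𝕜 l • (Ψ * Φ + Φ * Ψ) ^ l =
      1 + ∑ l ∈ Finset.Ico 1 (α p), catalanCoeff 𝕜 (l - 1) •
        (toeplitz α (single p p (l * w) ((G * F) ^ l)) +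
          toeplitz α (single t t (l * w) ((F * G) ^ l))) := by
    rw [Finset.range_eq_Ico, Finset.sum_eq_sum_Ico_succ_bot (by omega)]
    congr 1
    · simp [sqrtCoeff]
    · refine Finset.sum_congr rfl fun l hl => ?_
      rw [Finset.mem_Ico] at hl
      rw [hypow l hl.1, sqrtCoeff, if_neg (by omega)]
  simp only [hsum] at hiso
  obtain ⟨X, hX, hXY⟩ := h.exists_of_preserves hiso (by
    refine ((toeplitz_commute_shiftT _).sub_left (toeplitz_commute_shiftT _)).add_left
      ((Commute.one_left _).add_left (Commute.sum_left _ _ _ fun l _ => ?_))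
    exact ((toeplitz_commute_shiftT _).add_left (toeplitz_commute_shiftT _)).smul_left _)
  -- The coefficients of the isometry, from which the defining properties of the generator are read
  -- off block by block.
  have hco : ∀ r s j, j < min (α r) (α s) → coeff X r s j =
      single t p k F r s j - single p t k G r s j +
      (matCoeff (1 : Matrix (TIdx α μ) (TIdx α μ) 𝕜) r s j +
        ∑ l ∈ Finset.Ico 1 (α p), catalanCoeff 𝕜 (l - 1) •
        (single p p (l * w) ((G * F) ^ l) r s j + single t t (l * w) ((F * G) ^ l) r s j)) := by
    intro r s j hj
    rw [coeff_eq_matCoeff, hXY]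
    simp only [matCoeff_add, matCoeff_sub, matCoeff_sum, matCoeff_smul, Pi.add_apply, Pi.sub_apply,
      Finset.sum_apply, Pi.smul_apply, hΦ, hΨ, matCoeff_toeplitz_single _ _ _ _ hj]
  have hout : ∀ r s j, ¬ j < min (α r) (α s) → coeff X r s j = 0 := fun r s j hj =>
    coeff_of_le X (not_lt.1 hj)
  have hpow : ∀ (n : ℕ) (a : 𝕜) (q : Fin N) (M : Matrix (Fin (μ q)) (Fin (μ q)) 𝕜),
      (a • M) ^ n = a ^ n • M ^ n := fun n a q M => smul_pow a M n
  refine ⟨X, hX, h.isoT_subset hX, ?_, ?_, ?_, ?_, ?_, ?_, ?_⟩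
  · intro r
    rw [hco r r 0 (by simpa using h.pos r), single_of_ne F, single_of_ne G,
      matCoeff_one_zero r (h.pos r), Finset.sum_eq_zero]
    · simp
    · intro l hl
      rw [Finset.mem_Ico] at hl
      have : 0 < l * w := Nat.mul_pos (by omega) hw0
      rw [single_of_ne _ (by omega), single_of_ne _ (by omega)]
      simp
    · rintro ⟨rfl, h2, -⟩
      exact hpt.ne h2
    · rintro ⟨rfl, h2, -⟩
      exact hpt.ne h2.symm
  · intro r hrp hrt j hj
    by_cases hj' : j < min (α r) (α r)
    · rw [hco r r j hj', single_of_ne F (by tauto), single_of_ne G (by tauto),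
        matCoeff_one_same r hj, Finset.sum_eq_zero]
      · simp
      · intro l _
        rw [single_of_ne _ (by tauto), single_of_ne _ (by tauto)]
        simp
    · exact hout r r j hj'
  · intro r s hrs h1 h2 j
    by_cases hj' : j < min (α r) (α s)
    · rw [hco r s j hj', single_of_ne F (by tauto), single_of_ne G (by tauto),
        matCoeff_one_ne hrs, Finset.sum_eq_zero]
      · simp
      · intro l _
        rw [single_of_ne _ (by rintro ⟨rfl, rfl, -⟩; exact hrs rfl),
          single_of_ne _ (by rintro ⟨rfl, rfl, -⟩; exact hrs rfl)]
        simp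
    · exact hout r s j hj'
  · intro j
    by_cases hj' : j < min (α t) (α p)
    · rw [hco t p j hj', single_same, single_of_ne G (fun h => hpt.ne' h.1),
        matCoeff_one_ne hpt.ne', Finset.sum_eq_zero]
      · simp
      · intro l _
        rw [single_of_ne _ (fun h => hpt.ne' h.1), single_of_ne _ (fun h => hpt.ne h.2.1)]
        simp
    · rw [hout t p j hj', if_neg (by omega)]
  · intro j
    by_cases hj' : j < min (α p) (α t)
    · rw [hco p t j hj', single_same, single_of_ne F (fun h => hpt.ne h.1),
        matCoeff_one_ne hpt.ne, Finset.sum_eq_zero]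
      · rw [hG, pow_succ]
        split_ifs <;> simp
      · intro l _
        rw [single_of_ne _ (fun h => hpt.ne' h.2.1), single_of_ne _ (fun h => hpt.ne h.1)]
        simp
    · rw [hout p t j hj', if_neg (by omega)]
  · intro j hj hj'
    simp only [← hw]
    rw [hco p p j (by simpa using hj'), single_of_ne F (fun h => hpt.ne h.1),
      single_of_ne G (fun h => hpt.ne h.2.1), matCoeff_one_same p hj]
    have h0 : ∀ l, single t t (l * w) ((F * G) ^ l) p p j = 0 := fun l =>
      single_of_ne _ (fun h => hpt.ne h.1)
    simp only [h0, single_same, add_zero, sub_zero, zero_add]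
    split_ifs with hd
    · obtain ⟨n, rfl⟩ := hd
      rw [Nat.mul_div_cancel_left _ hw0]
      have hn : 1 ≤ n := by
        rcases Nat.eq_zero_or_pos n with rfl | h
        · omega
        · exact h
      have hn' : n ≤ w * n := Nat.le_mul_of_pos_left _ hw0
      rw [Finset.sum_eq_single n]
      · rw [if_pos (mul_comm _ _), hG, Matrix.smul_mul, hpow, smul_smul, mul_comm, ← pow_mul]
        congr 1
        rw [conj_pow (Matrix.nonsing_inv_mul _ (h.isUnit p))
          (Matrix.mul_nonsing_inv _ (h.isUnit p))]
        simp only [Matrix.mul_assoc, Matrix.nonsing_inv_mul _ (h.isUnit p), Matrix.mul_one]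
      · intro l _ hl
        rw [if_neg, smul_zero]
        intro h'
        rw [mul_comm] at h'
        exact hl (Nat.eq_of_mul_eq_mul_right hw0 h'.symm)
      · intro h'
        rw [Finset.mem_Ico] at h'
        omega
    · refine Finset.sum_eq_zero fun l _ => ?_
      rw [if_neg, smul_zero]
      rintro rfl
      exact hd (Dvd.intro_left l rfl)
  · intro j hj hj'
    simp only [← hw]
    rw [hco t t j (by simpa using hj'), single_of_ne F (fun h => hpt.ne' h.2.1),
      single_of_ne G (fun h => hpt.ne' h.1), matCoeff_one_same t hj]
    have h0 : ∀ l, single p p (l * w) ((G * F) ^ l) t t j = 0 := fun l =>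
      single_of_ne _ (fun h => hpt.ne' h.1)
    simp only [h0, single_same, sub_zero, zero_add]
    split_ifs with hd
    · obtain ⟨n, rfl⟩ := hd
      rw [Nat.mul_div_cancel_left _ hw0]
      have hn : 1 ≤ n := by
        rcases Nat.eq_zero_or_pos n with rfl | h
        · omega
        · exact h
      have hn' : n ≤ w * n := Nat.le_mul_of_pos_left _ hw0
      rw [Finset.sum_eq_single n]
      · rw [if_pos (mul_comm _ _), hG, Matrix.mul_smul, hpow, smul_smul, mul_comm, ← pow_mul]
        congr 1
        rw [conj_pow (Matrix.nonsing_inv_mul _ (h.isUnit t))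
          (Matrix.mul_nonsing_inv _ (h.isUnit t))]
        simp only [Matrix.mul_assoc]
        rw [← Matrix.mul_assoc (B t)⁻¹ (B t), Matrix.nonsing_inv_mul _ (h.isUnit t),
          Matrix.one_mul]
      · intro l _ hl
        rw [if_neg, smul_zero]
        intro h'
        rw [mul_comm] at h'
        exact hl (Nat.eq_of_mul_eq_mul_right hw0 h'.symm)
      · intro h'
        rw [Finset.mem_Ico] at h'
        omega
    · refine Finset.sum_eq_zero fun l _ => ?_
      rw [if_neg, smul_zero]
      rintro rfl
      exact hd (Dvd.intro_left l rfl)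

end Generators

/-! ### Generation of the unipotent part -/

section Generation

variable {𝕜 : Type*} [Field 𝕜] {N : ℕ} {α μ : Fin N → ℕ}
variable {B : ∀ r : Fin N, Matrix (Fin (μ r)) (Fin (μ r)) 𝕜} {c : ℕ}

theorem remainder_diag_of_offDiag_eq_zero {A : Coeffs 𝕜 μ} (h : ∀ r s, r ≠ s → ∀ j, A r s j = 0)
    (r : Fin N) (j : ℕ) : remainder α B A r r j =
      ∑ k ∈ Finset.Ico 1 j, (-1 : 𝕜) ^ k • ((A r r k)ᵀ * B r * A r r (j - k)) := by
  have hp : ∀ k n, k ≠ r → pairing B A k r r n = 0 := fun k n hk =>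
    Finset.sum_eq_zero fun l _ => by rw [h k r hk l]; simp
  rw [remainder, if_neg (by simp), Finset.sum_eq_zero (s := Finset.univ.filter fun k => k < r),
    Finset.sum_eq_zero (s := Finset.univ.filter fun k => r < k ∧ k ≤ r),
    Finset.sum_eq_zero (s := Finset.univ.filter fun k => r < k)]
  · simp
  · intro k hk
    simp only [Finset.mem_filter, Finset.mem_univ, true_and] at hk
    simp [hp k _ hk.ne']
  · intro k hk
    simp only [Finset.mem_filter, Finset.mem_univ, true_and] at hk
    exact hp k _ hk.1.ne'
  · intro k hk
    simp only [Finset.mem_filter, Finset.mem_univ, true_and] at hk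
    simp [hp k _ hk.ne]

theorem remainder_offDiag_eq_zero {A : Coeffs 𝕜 μ} (h : ∀ r s, r ≠ s → ∀ j, A r s j = 0)
    {r s : Fin N} (hrs : r < s) (j : ℕ) : remainder α B A r s j = 0 := by
  have hp : ∀ k n, pairing B A k r s n = 0 := fun k n =>
    Finset.sum_eq_zero fun l _ => by
      by_cases hk : k = r
      · rw [h k s (by rintro rfl; exact hrs.ne hk.symm) (n - l)]; simp
      · rw [h k r hk l]; simp
  have hs := h r s hrs.ne
  simp [remainder, hp, hs]

/-- If the blocks below the diagonal vanish, the algorithm returns zero above the diagonal. -/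
theorem IsComputed.offDiag_eq_zero (hα : StrictAnti α)
    {Z : ∀ r : Fin N, ℕ → Matrix (Fin (μ r)) (Fin (μ r)) 𝕜} {A : Coeffs 𝕜 μ}
    (hA : IsComputed α B Z A) (hlow : ∀ r s, s < r → ∀ j, A r s j = 0)
    (hout : ∀ r s j, min (α r) (α s) ≤ j → A r s j = 0) : ∀ r s, r ≠ s → ∀ j, A r s j = 0 := by
  classical
  have key : ∀ r s j, r ≤ s → (r ≠ s → A r s j = 0) := by
    refine precedes_induction fun r s j hrs ih hne => ?_
    have hlt := lt_of_le_of_ne hrs hne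
    by_cases hj : min (α r) (α s) ≤ j
    · exact hout r s j hj
    · rw [hA.2 r s hlt j (by omega),
        remainder_congr B hα A (fun r s j => if r = s then A r s j else 0) r s j hrs,
        remainder_offDiag_eq_zero (fun r s h j => if_neg h) hlt]
      · simp
      · intro r' s' j' hp
        split_ifs with h
        · rfl
        · rcases lt_or_ge s' r' with h1 | h1
          · exact hlow r' s' h1 j'
          · exact ih r' s' j' h1 hp h
  intro r s hne j
  rcases lt_or_ge s r with h | h
  · exact hlow r s h j
  · exact key r s j h hne

/-- The formula for `W_j^r` is the recursion of the algorithm for leading coefficients `1` and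
vanishing blocks off the diagonal. -/
theorem IsDiagGen.mem_isoT [CharZero 𝕜] (h : IsAdmissible c α B)
    {Z : ∀ r : Fin N, ℕ → Matrix (Fin (μ r)) (Fin (μ r)) 𝕜} (hZ : HasSign c α Z)
    {X : GeneralLinearGroup (TIdx α μ) 𝕜} (hX : IsDiagGen B Z X) : X ∈ isoT α B := by
  obtain ⟨h1, h2, h3, h4⟩ := hX
  refine h.mem_isoT_iff.2 ⟨h1, fun r => by simp [h3], Z, hZ, fun r j hj hj' => ?_,
    fun r s hrs j _ => ?_⟩
  · rw [h3, Matrix.one_mul, remainder_diag_of_offDiag_eq_zero h2, h4 r j hj hj']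
  · rw [h2 r s hrs.ne, remainder_offDiag_eq_zero h2 hrs]
    simp

/-- An element of the isotropy group with leading coefficients `1` and no coefficients below the
diagonal is a generator of the first kind. -/
theorem isDiagGen_of_lower_eq_zero [CharZero 𝕜] (h : IsAdmissible c α B)
    {X : GeneralLinearGroup (TIdx α μ) 𝕜} (hX : X ∈ toeplitzSet 𝕜 α μ)
    {Z : ∀ r : Fin N, ℕ → Matrix (Fin (μ r)) (Fin (μ r)) 𝕜} (hZ : IsComputed α B Z (coeff X))
    (h1 : ∀ r, coeff X r r 0 = 1) (hlow : ∀ r s, s < r → ∀ j < α r, coeff X r s j = 0) :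
    IsDiagGen B Z X := by
  have hlow' : ∀ r s, s < r → ∀ j, coeff X r s j = 0 := fun r s hsr j => by
    rcases lt_or_ge j (α r) with hj | hj
    · exact hlow r s hsr j hj
    · exact coeff_of_le X ((min_le_left _ _).trans hj)
  have h2 := hZ.offDiag_eq_zero h.anti hlow' fun r s j hj => coeff_of_le X hj
  refine ⟨hX, h2, h1, fun r j hj hj' => ?_⟩
  conv_lhs => rw [hZ.1 r j hj hj', h1, Matrix.one_mul, remainder_diag_of_offDiag_eq_zero h2]

/-- For every value of the parameters the generator of the first kind exists. -/
theorem IsAdmissible.exists_isDiagGen [CharZero 𝕜] (h : IsAdmissible c α B)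
    {Z : ∀ r : Fin N, ℕ → Matrix (Fin (μ r)) (Fin (μ r)) 𝕜} (hZ : HasSign c α Z) :
    ∃ X : GeneralLinearGroup (TIdx α μ) 𝕜, IsDiagGen B Z X := by
  obtain ⟨X, hX, h1, h2, h3⟩ := h.exists_mem_isoT (fun _ => 1) 0 Z (by simp) hZ
  exact ⟨X, isDiagGen_of_lower_eq_zero h (h.isoT_subset hX) h3 h1 h2⟩

/-- All coefficients of a generator of the second kind are prescribed. The generator is therefore
the isometry constructed in `exists_isOffDiagGen`. -/
theorem IsOffDiagGen.unique {p t : Fin N} (hpt : p ≠ t) {k : ℕ}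
    {F : Matrix (Fin (μ t)) (Fin (μ p)) 𝕜}
    {X Y : GeneralLinearGroup (TIdx α μ) 𝕜} (hX : IsOffDiagGen B p t k F X)
    (hY : IsOffDiagGen B p t k F Y) : X = Y := by
  obtain ⟨x1, x2, x3, x4, x5, x6, x7, x8⟩ := hX
  obtain ⟨y1, y2, y3, y4, y5, y6, y7, y8⟩ := hY
  refine ext_of_coeff x1 y1 fun r s j hj => ?_
  by_cases hrs : r = s
  · subst hrs
    rcases Nat.eq_zero_or_pos j with rfl | hj0
    · rw [x2, y2]
    · by_cases hp : r = p
      · subst hp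
        rw [x7 j hj0 (by omega), y7 j hj0 (by omega)]
      · by_cases ht : r = t
        · subst ht
          rw [x8 j hj0 (by omega), y8 j hj0 (by omega)]
        · rw [x3 r hp ht j hj0, y3 r hp ht j hj0]
  · by_cases h1 : r = p ∧ s = t
    · obtain ⟨rfl, rfl⟩ := h1
      rw [x6, y6]
    · by_cases h2 : r = t ∧ s = p
      · obtain ⟨rfl, rfl⟩ := h2
        rw [x5, y5]
      · rw [x4 r s hrs h1 h2, y4 r s hrs h1 h2]

theorem IsOffDiagGen.mem_isoT [CharZero 𝕜] (h : IsAdmissible c α B) {p t : Fin N} (hpt : p < t)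
    {k : ℕ} (hk : k < α t) {F : Matrix (Fin (μ t)) (Fin (μ p)) 𝕜}
    {X : GeneralLinearGroup (TIdx α μ) 𝕜} (hX : IsOffDiagGen B p t k F X) : X ∈ isoT α B := by
  obtain ⟨Y, hY, hY'⟩ := h.exists_isOffDiagGen hpt hk F
  rwa [hX.unique hpt.ne hY']

/-- Multiplicativity of the leading diagonal coefficients on the isotropy group. -/
theorem IsAdmissible.coeff_mul_zero (h : IsAdmissible c α B)
    {X Y : GeneralLinearGroup (TIdx α μ) 𝕜} (hX : X ∈ isoT α B) (hY : Y ∈ isoT α B) (r : Fin N) :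
    coeff (X * Y) r r 0 = coeff X r r 0 * coeff Y r r 0 := by
  rw [BlockToeplitz.mem_isoT_iff] at hX hY
  simp only [coeff_eq_matCoeff, Units.val_mul]
  exact matCoeff_mul_zero h.anti.injective h.pos hX.2 hY.2 r

theorem IsAdmissible.coeff_one_zero (h : IsAdmissible c α B) (r : Fin N) :
    coeff (1 : GeneralLinearGroup (TIdx α μ) 𝕜) r r 0 = 1 := by
  rw [coeff_eq_matCoeff, Units.val_one, matCoeff_one_zero r (h.pos r)]

theorem IsAdmissible.coeff_inv_zero_mul (h : IsAdmissible c α B)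
    {X : GeneralLinearGroup (TIdx α μ) 𝕜} (hX : X ∈ isoT α B) (r : Fin N) :
    coeff X⁻¹ r r 0 * coeff X r r 0 = 1 := by
  rw [← h.coeff_mul_zero (inv_mem hX) hX, inv_mul_cancel, h.coeff_one_zero]

/-- The kernel of `X ↦ (A_0^{rr})_r` on the isotropy group. -/
def unipT (h : IsAdmissible c α B) : Subgroup (GeneralLinearGroup (TIdx α μ) 𝕜) where
  carrier := {X | X ∈ isoT α B ∧ ∀ r, coeff X r r 0 = 1}
  one_mem' := ⟨one_mem _, h.coeff_one_zero⟩
  mul_mem' := by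
    rintro X Y ⟨hX, hX'⟩ ⟨hY, hY'⟩
    exact ⟨mul_mem hX hY, fun r => by rw [h.coeff_mul_zero hX hY, hX', hY', Matrix.one_mul]⟩
  inv_mem' := by
    rintro X ⟨hX, hX'⟩
    refine ⟨inv_mem hX, fun r => ?_⟩
    have := h.coeff_inv_zero_mul hX r
    rwa [hX', Matrix.mul_one] at this

/-- If the leading diagonal coefficients are `1` and the other coefficients of weight less than
`w` vanish, then `X - 1` raises the height by at least `w`. -/
theorem raises_sub_one {w : ℕ} (hα₀ : ∀ r, 0 < α r)
    {X : GeneralLinearGroup (TIdx α μ) 𝕜} (hX : X ∈ toeplitzSet 𝕜 α μ)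
    (h0 : ∀ r, coeff X r r 0 = 1)
    (h1 : ∀ r s j, j < min (α r) (α s) → wt α r s j < w → (r ≠ s ∨ 1 ≤ j) → coeff X r s j = 0) :
    Raises w ((X : Matrix (TIdx α μ) (TIdx α μ) 𝕜) - 1) := by
  have hc : Commute ((X : Matrix (TIdx α μ) (TIdx α μ) 𝕜) - 1) (shiftT 𝕜 α μ) := by
    rw [← toeplitz_coeff_of_mem hX]
    exact (toeplitz_commute_shiftT _).sub_left (Commute.one_left _)
  rw [← toeplitz_matCoeff_of_commute hc]
  refine raises_toeplitz fun r s j hj hw => ?_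
  rw [matCoeff_sub, ← coeff_eq_matCoeff]
  change coeff X r s j - matCoeff 1 r s j = 0
  by_cases hrs : r = s
  · subst hrs
    rcases Nat.eq_zero_or_pos j with rfl | hj0
    · rw [h0, matCoeff_one_zero r (hα₀ r), sub_self]
    · rw [h1 r r j hj hw (Or.inr hj0), matCoeff_one_same r hj0, sub_self]
  · rw [h1 r s j hj hw (Or.inl hrs), matCoeff_one_ne hrs, sub_self]

/-- As the sizes `α_r` are distinct, every coefficient other than `A_0^{rr}` has positive weight.
-/
theorem raises_one_of_mem_unipT [CharZero 𝕜] {h : IsAdmissible c α B}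
    {X : GeneralLinearGroup (TIdx α μ) 𝕜} (hX : X ∈ unipT h) :
    Raises 1 ((X : Matrix (TIdx α μ) (TIdx α μ) 𝕜) - 1) := by
  refine raises_sub_one (w := 1) h.pos (h.isoT_subset hX.1) hX.2 fun r s j hj hw hrs => ?_
  exfalso
  unfold wt at hw
  rcases hrs with hrs | hrs
  · exact hrs (h.anti.injective (by omega))
  · omega

variable (c α B) in
/-- The group generated by the matrices of the two kinds. -/
def genU : Subgroup (GeneralLinearGroup (TIdx α μ) 𝕜) :=
  Subgroup.closure
    ({X | ∃ Z, HasSign c α Z ∧ IsDiagGen B Z X} ∪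
     {X | ∃ p t k F, p < t ∧ k < α t ∧ IsOffDiagGen B p t k F X})

theorem genU_le_unipT [CharZero 𝕜] (h : IsAdmissible c α B) : genU α B c ≤ unipT h := by
  refine (Subgroup.closure_le _).2 ?_
  rintro X (⟨Z, hZ, hX⟩ | ⟨p, t, k, F, hpt, hk, hX⟩)
  · exact ⟨hX.mem_isoT h hZ, hX.2.2.1⟩
  · exact ⟨hX.mem_isoT h hpt hk, hX.2.1⟩

/-- Multiplication by a generator of the second kind removes one coefficient below the diagonal
without changing the others of the same or of smaller weight. -/
theorem exists_kill_coeff [CharZero 𝕜] (h : IsAdmissible c α B)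
    {X : GeneralLinearGroup (TIdx α μ) 𝕜} (hX : X ∈ unipT h) {p t : Fin N} (hpt : p < t) {k : ℕ}
    (hk : k < α t) : ∃ Y ∈ genU α B c, coeff (X * Y) t p k = 0 ∧
      ∀ r s j, s < r → wt α r s j ≤ wt α t p k → ¬(r = t ∧ s = p ∧ j = k) →
        coeff (X * Y) r s j = coeff X r s j := by
  obtain ⟨Y, hYi, hY⟩ := h.exists_isOffDiagGen hpt hk (-coeff X t p k)
  have hYg : Y ∈ genU α B c := Subgroup.subset_closure (Or.inr ⟨p, t, k, _, hpt, hk, hY⟩)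
  have hlt := h.anti hpt
  have hYr : Raises (wt α t p k : ℕ) ((Y : Matrix (TIdx α μ) (TIdx α μ) 𝕜) - 1) := by
    obtain ⟨y1, y2, y3, y4, y5, y6, y7, y8⟩ := hY
    refine raises_sub_one h.pos y1 y2 fun r s j hj hw hrs => ?_
    -- The nonzero coefficients in the diagonal blocks have indices at least `2 k + α_p - α_t`, and
    -- hence weight larger than that of `A_k^{tp}`.
    have hdiv : r = s → (r = p ∨ r = t) → ¬ (2 * k + (α p - α t) ∣ j) := by
      rintro rfl - hd
      have hj1 : 1 ≤ j := by simpa using hrs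
      have := Nat.le_of_dvd (by omega) hd
      unfold wt at hw
      omega
    by_cases hrs' : r = s
    · subst hrs'
      have hj0 : 1 ≤ j := by simpa using hrs
      by_cases hp : r = p
      · subst hp
        rw [y7 j hj0 (by omega), if_neg (hdiv rfl (Or.inl rfl))]
      · by_cases ht : r = t
        · subst ht
          rw [y8 j hj0 (by omega), if_neg (hdiv rfl (Or.inr rfl))]
        · exact y3 r hp ht j hj0
    · by_cases h1 : r = p ∧ s = t
      · obtain ⟨rfl, rfl⟩ := h1
        rw [y6, if_neg]
        rintro rfl
        unfold wt at hw
        omega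
      · by_cases h2 : r = t ∧ s = p
        · obtain ⟨rfl, rfl⟩ := h2
          rw [y5, if_neg]
          rintro rfl
          omega
        · exact y4 r s hrs' h1 h2 j
  -- Up to this weight the coefficients of `X * Y` below the diagonal are the sums of those of `X`
  -- and `Y`, since `(X - 1) * (Y - 1)` raises the height by more.
  have hprod : ∀ r s j, s < r → wt α r s j ≤ wt α t p k →
      coeff (X * Y) r s j = coeff X r s j + coeff Y r s j := by
    intro r s j hsr hw
    have h1 : ((X * Y : GeneralLinearGroup (TIdx α μ) 𝕜) : Matrix (TIdx α μ) (TIdx α μ) 𝕜) =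
        (X + Y - 1) + ((X : Matrix (TIdx α μ) (TIdx α μ) 𝕜) - 1) * (Y - 1) := by
      rw [Units.val_mul, Matrix.mul_sub, Matrix.sub_mul, Matrix.mul_one, Matrix.one_mul]
      abel
    have h2 := ((raises_one_of_mem_unipT hX).mul hYr)
    have h3 : matCoeff (((X : Matrix (TIdx α μ) (TIdx α μ) 𝕜) - 1) *
        ((Y : Matrix (TIdx α μ) (TIdx α μ) 𝕜) - 1)) r s j = 0 :=
      Raises.matCoeff_eq_zero (w := 1 + wt α t p k) (by exact_mod_cast h2) (by omega)
    simp only [coeff_eq_matCoeff]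
    rw [h1, matCoeff_add, matCoeff_sub, matCoeff_add]
    simp only [Pi.add_apply, Pi.sub_apply, h3, matCoeff_one_ne hsr.ne', sub_zero, add_zero]
  refine ⟨Y, hYg, ?_, fun r s j hsr hw hne => ?_⟩
  · rw [hprod t p k hpt le_rfl, hY.2.2.2.2.1, if_pos rfl, add_neg_cancel]
  · rw [hprod r s j hsr hw]
    by_cases h2 : r = t ∧ s = p
    · obtain ⟨rfl, rfl⟩ := h2
      rw [hY.2.2.2.2.1, if_neg (by tauto), add_zero]
    · rw [hY.2.2.2.1 r s hsr.ne' (by rintro ⟨rfl, rfl⟩; exact absurd hsr hpt.not_gt) h2, add_zero]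

/-- The kernel of the leading diagonal coefficients is generated by the matrices of the two kinds:
the coefficients below the diagonal are removed in the order of their weights, and a matrix without
coefficients below the diagonal is a generator of the first kind. -/
theorem genU_eq_unipT [CharZero 𝕜] (h : IsAdmissible c α B) : genU α B c = unipT h := by
  classical
  refine le_antisymm (genU_le_unipT h) fun X hX => ?_
  have key : ∀ w : ℕ, ∃ Y ∈ genU α B c, ∀ r s j, s < r → wt α r s j < w →
      coeff (X * Y) r s j = 0 := by
    intro w
    induction w with
    | zero => exact ⟨1, one_mem _, fun r s j _ hw => absurd hw (Nat.not_lt_zero _)⟩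
    | succ w ih =>
      -- The coefficients of weight `w` are removed one at a time.
      have inner : ∀ T : Finset (Fin N × Fin N × ℕ), ∃ Y ∈ genU α B c,
          (∀ r s j, s < r → wt α r s j < w → coeff (X * Y) r s j = 0) ∧
          ∀ x ∈ T, x.2.1 < x.1 → wt α x.1 x.2.1 x.2.2 = w →
            coeff (X * Y) x.1 x.2.1 x.2.2 = 0 := by
        intro T
        induction T using Finset.induction_on with
        | empty =>
          obtain ⟨Y, hY, hY'⟩ := ih
          exact ⟨Y, hY, hY', by simp⟩
        | insert x T hx ihT =>
          obtain ⟨Y, hY, h1, h2⟩ := ihT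
          obtain ⟨t, p, k⟩ := x
          by_cases hcase : p < t ∧ k < α t ∧ wt α t p k = w
          · obtain ⟨hpt, hk, rfl⟩ := hcase
            obtain ⟨Y', hY', h3, h4⟩ :=
              exists_kill_coeff h (mul_mem hX (genU_le_unipT h hY)) hpt hk
            refine ⟨Y * Y', mul_mem hY hY', fun r s j hsr hw => ?_, fun x hx hlt hw => ?_⟩
            · rw [← _root_.mul_assoc, h4 r s j hsr hw.le, h1 r s j hsr hw]
              rintro ⟨rfl, rfl, rfl⟩
              exact lt_irrefl _ hw
            · rw [← _root_.mul_assoc]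
              rcases Finset.mem_insert.1 hx with rfl | hx
              · exact h3
              · by_cases he : x.1 = t ∧ x.2.1 = p ∧ x.2.2 = k
                · obtain ⟨t', p', k'⟩ := x
                  obtain ⟨rfl, rfl, rfl⟩ := he
                  exact h3
                · rw [h4 _ _ _ hlt hw.le he]
                  exact h2 x hx hlt hw
          · refine ⟨Y, hY, h1, fun x hx hlt hw => ?_⟩
            rcases Finset.mem_insert.1 hx with rfl | hx
            · refine coeff_of_le _ ((min_le_left _ _).trans ?_)
              by_contra hk
              exact hcase ⟨hlt, not_le.1 hk, hw⟩
            · exact h2 x hx hlt hw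
      obtain ⟨Y, hY, h1, h2⟩ := inner (Finset.univ ×ˢ Finset.univ ×ˢ Finset.range (w + 1))
      refine ⟨Y, hY, fun r s j hsr hw => ?_⟩
      rcases Nat.lt_succ_iff_lt_or_eq.1 hw with hw | hw
      · exact h1 r s j hsr hw
      · refine h2 (r, s, j) ?_ hsr hw
        simp only [Finset.mem_product, Finset.mem_univ, Finset.mem_range, true_and]
        unfold wt at hw
        omega
  -- The weight of a coefficient is `2 j + |α_r - α_s|`, which is at most `3 ∑ α_r`.
  obtain ⟨Y, hY, hlow⟩ := key (3 * (∑ r, α r) + 1)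
  have hS : ∀ r, α r ≤ ∑ r, α r := fun r =>
    Finset.single_le_sum (f := α) (fun _ _ => Nat.zero_le _) (by simp)
  have hXY := mul_mem hX (genU_le_unipT h hY)
  obtain ⟨h1, -, Z, hZ, h2⟩ := h.mem_isoT_iff.1 hXY.1
  have h3 : IsDiagGen B Z (X * Y) := isDiagGen_of_lower_eq_zero h h1 h2 hXY.2
    fun r s hsr j hj => hlow r s j hsr (by
      have := hS r
      have := hS s
      have := h.anti hsr
      unfold wt
      omega)
  have h4 : X * Y ∈ genU α B c := Subgroup.subset_closure (Or.inl ⟨Z, hZ, h3⟩)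
  have := mul_mem h4 (inv_mem hY)
  rwa [_root_.mul_assoc, mul_inv_cancel, _root_.mul_one] at this

end Generation

/-! ### Normal unipotent subgroups of orthogonal and symplectic groups -/

section NoUnipotent

variable {𝕜 : Type*} [Field 𝕜] [CharZero 𝕜] {ι : Type*} [Fintype ι] [DecidableEq ι]

/-- The group of isometries of the form `B` has no nontrivial normal unipotent subgroup. The
subgroups are represented by sets `S` of matrices closed under products, inverses and conjugation
by isometries. -/
def HasNoNormalUnipotent (B : Matrix ι ι 𝕜) : Prop :=
  ∀ S : Set (Matrix ι ι 𝕜), (∀ g ∈ S, gᵀ * B * g = B) → (∀ g ∈ S, IsNilpotent (g - 1)) →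
    (∀ g ∈ S, ∀ g' ∈ S, g * g' ∈ S) → (∀ g ∈ S, ∃ g' ∈ S, g' * g = 1) →
    (∀ g ∈ S, ∀ h h' : Matrix ι ι 𝕜, hᵀ * B * h = B → h * h' = 1 → h * g * h' ∈ S) →
    ∀ g ∈ S, g = 1

theorem trace_of_isNilpotent_sub_one {g : Matrix ι ι 𝕜} (h : IsNilpotent (g - 1)) :
    g.trace = Fintype.card ι := by
  have := (Matrix.isNilpotent_trace_of_isNilpotent h).eq_zero
  rwa [Matrix.trace_sub, Matrix.trace_one, sub_eq_zero] at this

/-- A unipotent involution is trivial: the product `(g + 1) (g - 1)` vanishes and `g + 1` is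
invertible. -/
theorem eq_one_of_sq_eq_one {g : Matrix ι ι 𝕜} (h : IsNilpotent (g - 1)) (h2 : g * g = 1) :
    g = 1 := by
  have h3 : IsUnit (g + 1) := by
    have h4 : g + 1 = (g - 1) + (2 : 𝕜) • 1 := by
      rw [two_smul]
      abel
    have h5 : IsUnit ((2 : 𝕜) • (1 : Matrix ι ι 𝕜)) :=
      IsUnit.of_mul_eq_one ((1 / 2 : 𝕜) • 1) (by simp [smul_smul])
    rw [h4]
    exact h.isUnit_add_right_of_commute h5 ((Commute.one_right _).smul_right _)
  have h4 : (g + 1) * (g - 1) = 0 := by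
    rw [Matrix.mul_sub, Matrix.add_mul, h2]
    simp [add_comm]
  exact sub_eq_zero.1 (h3.mul_right_eq_zero.1 h4)

/-- For a skew-symmetric form, the commutators of `g` with the transvections along `v` have trace
`n`, which forces `ω(v, g v) = 0` for every `v`; hence `g² = 1`. -/
theorem hasNoNormalUnipotent_of_skew {B : Matrix ι ι 𝕜} (hB : Bᵀ = -B) (hu : IsUnit B.det) :
    HasNoNormalUnipotent B := by
  intro S hS hnil hmul hinv hconj g hg
  have halt : ∀ v : ι → 𝕜, v ⬝ᵥ (B *ᵥ v) = 0 := by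
    intro v
    have h1 : v ⬝ᵥ (B *ᵥ v) = -(v ⬝ᵥ (B *ᵥ v)) := by
      conv_lhs => rw [dotProduct_comm, ← Matrix.vecMul_transpose, hB, ← dotProduct_mulVec]
      simp [Matrix.neg_mulVec]
    exact self_eq_neg.1 h1
  have key : ∀ v : ι → 𝕜, v ⬝ᵥ ((B * g) *ᵥ v) = 0 := by
    intro v
    obtain ⟨g', hg', hgg⟩ := hinv g hg
    have hBg' : B * g' = gᵀ * B := by
      rw [← hS g hg, Matrix.mul_assoc, mul_eq_one_comm.1 hgg, Matrix.mul_one, hS g hg]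
    -- The map `1 + T` is the symplectic transvection along `v`, with inverse `1 - T`.
    set T := vecMulVec v (v ᵥ* B) with hT
    have hTT : T * T = 0 := by
      rw [hT, vecMulVec_mul_vecMulVec, ← dotProduct_mulVec, halt]
      simp
    have hTB : Tᵀ * B = -(B * T) := by
      rw [hT, transpose_vecMulVec, vecMulVec_mul, mul_vecMulVec, ← Matrix.mulVec_transpose B v, hB,
        Matrix.neg_mulVec, neg_vecMulVec]
    have hiso : (1 + T)ᵀ * B * (1 + T) = B := by
      rw [Matrix.transpose_add, Matrix.transpose_one, Matrix.add_mul, Matrix.one_mul, hTB,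
        Matrix.add_mul, Matrix.mul_add, Matrix.neg_mul, Matrix.mul_add, Matrix.mul_assoc B T T, hTT]
      simp
    have hh : (1 + T) * (1 - T) = 1 := by
      rw [Matrix.mul_sub, Matrix.add_mul, Matrix.add_mul, hTT]
      simp
    -- The commutator of `g⁻¹` and the transvection belongs to `S`. Its trace is `n + ω(v, g v)²`.
    have h1 := trace_of_isNilpotent_sub_one (hnil _ (hmul _ hg' _ (hconj g hg _ _ hiso hh)))
    have h2 : g' * ((1 + T) * g * (1 - T)) = 1 - T + g' * T * g - g' * T * g * T := by
      rw [Matrix.add_mul, Matrix.mul_sub, Matrix.mul_sub, Matrix.mul_one, Matrix.mul_add,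
        Matrix.add_mul, Matrix.mul_add, Matrix.one_mul, hgg, ← Matrix.mul_assoc g',
        ← Matrix.mul_assoc g' g, hgg]
      simp only [Matrix.mul_assoc, Matrix.one_mul]
      abel
    have htrT : T.trace = 0 := by
      rw [hT, trace_vecMulVec, dotProduct_comm, ← dotProduct_mulVec, halt]
    have h3 : (g' * T * g * T).trace = 0 := by
      have h4 : (g' * T * g).trace = 0 := by
        rw [Matrix.trace_mul_comm, ← Matrix.mul_assoc, mul_eq_one_comm.1 hgg, Matrix.one_mul, htrT]
      rw [h2, Matrix.trace_sub, Matrix.trace_add, Matrix.trace_sub, htrT, h4,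
        Matrix.trace_one] at h1
      simpa using h1
    have h5 : g' * T * g * T = ((v ᵥ* B) ⬝ᵥ (g *ᵥ v)) • vecMulVec (g' *ᵥ v) (v ᵥ* B) := by
      have h6 : g' * T * g = vecMulVec (g' *ᵥ v) (v ᵥ* B ᵥ* g) := by
        rw [hT, mul_vecMulVec, vecMulVec_mul]
      rw [h6, hT, vecMulVec_mul_vecMulVec, vecMulVec_smul, ← dotProduct_mulVec]
    have h6 : (v ᵥ* B) ⬝ᵥ (g' *ᵥ v) = -((v ᵥ* B) ⬝ᵥ (g *ᵥ v)) := by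
      rw [← dotProduct_mulVec, Matrix.mulVec_mulVec, hBg', ← Matrix.mulVec_mulVec,
        dotProduct_mulVec, Matrix.vecMul_transpose, ← Matrix.mulVec_transpose B v, hB,
        Matrix.neg_mulVec, neg_dotProduct, neg_neg, dotProduct_comm]
    rw [h5, Matrix.trace_smul, trace_vecMulVec, dotProduct_comm (g' *ᵥ v), h6, smul_eq_mul, mul_neg,
      neg_eq_zero, mul_self_eq_zero] at h3
    rw [← Matrix.mulVec_mulVec, dotProduct_mulVec]
    exact h3
  have hskew : (B * g)ᵀ = -(B * g) := by
    ext i j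
    have h1 := key (Pi.single i 1 + Pi.single j 1)
    have h2 := key (Pi.single i 1)
    have h3 := key (Pi.single j 1)
    simp only [Matrix.mulVec_add, dotProduct_add, add_dotProduct] at h1
    rw [h2, h3] at h1
    simp only [Matrix.mulVec_single_one, single_one_dotProduct, Matrix.col_apply] at h1
    simp only [Matrix.transpose_apply, Matrix.neg_apply]
    linear_combination h1
  refine eq_one_of_sq_eq_one (hnil g hg) ?_
  have h1 := hS g hg
  rw [Matrix.transpose_mul, hB, Matrix.mul_neg, neg_inj] at hskew
  rw [hskew, Matrix.mul_assoc] at h1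
  have h2 := congrArg (fun M => B⁻¹ * M) h1
  simpa [← Matrix.mul_assoc, Matrix.nonsing_inv_mul _ hu] using h2

/-- For the standard symmetric form, the commutators of `g` with the reflections in `v` have trace
`n`, which forces `(v, g v)² = (v, v)²` for all non-isotropic `v`; hence `g + gᵀ = 2`, so that
`g - 1` is skew-symmetric with square zero. The same holds for the product of `g` and its conjugate
by the reflection in a coordinate vector `e`, and it follows that `g e = e`. -/
theorem hasNoNormalUnipotent_one : HasNoNormalUnipotent (1 : Matrix ι ι 𝕜) := by
  intro S hS hnil hmul hinv hconj
  simp only [Matrix.mul_one] at hS hconj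
  have hinv' : ∀ g ∈ S, gᵀ ∈ S := by
    intro g hg
    obtain ⟨g', hg', hgg⟩ := hinv g hg
    have : gᵀ = g' := by
      rw [← Matrix.mul_one gᵀ, ← mul_eq_one_comm.1 hgg, ← Matrix.mul_assoc, hS g hg, Matrix.one_mul]
    rwa [this]
  have hrefl : ∀ g ∈ S, ∀ v : ι → 𝕜, v ⬝ᵥ v ≠ 0 → (v ⬝ᵥ (g *ᵥ v)) ^ 2 = (v ⬝ᵥ v) ^ 2 := by
    intro g hg v hv
    -- The map `1 - P` is the reflection in the hyperplane orthogonal to `v`.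
    set q := v ⬝ᵥ v with hq
    set P := (2 / q) • vecMulVec v v with hP
    have hPt : Pᵀ = P := by rw [hP, Matrix.transpose_smul, transpose_vecMulVec]
    have hPP : P * P = (2 : 𝕜) • P := by
      rw [hP, Matrix.smul_mul, Matrix.mul_smul, vecMulVec_mul_vecMulVec, ← hq, vecMulVec_smul,
        smul_smul, smul_smul, smul_smul]
      congr 1
      field_simp
    have hh : (1 - P)ᵀ * (1 - P) = 1 := by
      rw [Matrix.transpose_sub, Matrix.transpose_one, hPt, Matrix.mul_sub, Matrix.sub_mul,
        Matrix.sub_mul, hPP, two_smul]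
      simp
    have hh' : (1 - P) * (1 - P) = 1 := by
      rw [Matrix.transpose_sub, Matrix.transpose_one, hPt] at hh
      exact hh
    have h1 := trace_of_isNilpotent_sub_one (hnil _ (hmul _ (hinv' g hg) _
      (hconj g hg _ _ hh hh')))
    have h2 : gᵀ * ((1 - P) * g * (1 - P)) = 1 - P - gᵀ * P * g + gᵀ * P * g * P := by
      rw [Matrix.sub_mul, Matrix.mul_sub, Matrix.mul_sub, Matrix.mul_one, Matrix.mul_sub,
        Matrix.sub_mul, Matrix.mul_sub, Matrix.one_mul, hS g hg, ← Matrix.mul_assoc gᵀ,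
        ← Matrix.mul_assoc gᵀ g, hS g hg]
      simp only [Matrix.mul_assoc, Matrix.one_mul]
      abel
    have htr : P.trace = 2 := by
      rw [hP, Matrix.trace_smul, trace_vecMulVec, ← hq, smul_eq_mul, div_mul_cancel₀ _ hv]
    have h3 : (gᵀ * P * g).trace = 2 := by
      rw [Matrix.trace_mul_comm, ← Matrix.mul_assoc, mul_eq_one_comm.1 (hS g hg), Matrix.one_mul,
        htr]
    have h4 : (gᵀ * P * g * P).trace = 4 / q ^ 2 * (v ⬝ᵥ (g *ᵥ v)) ^ 2 := by
      have h5 : gᵀ * P * g * P = (4 / q ^ 2 * (v ⬝ᵥ (g *ᵥ v))) • vecMulVec (gᵀ *ᵥ v) v := by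
        have h6 : gᵀ * P * g = (2 / q) • vecMulVec (gᵀ *ᵥ v) (v ᵥ* g) := by
          rw [hP, Matrix.mul_smul, mul_vecMulVec, Matrix.smul_mul, vecMulVec_mul]
        rw [h6, hP, Matrix.smul_mul, Matrix.mul_smul, vecMulVec_mul_vecMulVec, vecMulVec_smul,
          ← dotProduct_mulVec, smul_smul, smul_smul]
        congr 1
        field_simp
        ring
      rw [h5, Matrix.trace_smul, trace_vecMulVec, Matrix.mulVec_transpose, ← dotProduct_mulVec]
      simp only [smul_eq_mul]
      ring
    rw [h2, Matrix.trace_add, Matrix.trace_sub, Matrix.trace_sub, htr, h3, h4,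
      Matrix.trace_one] at h1
    have h6 : 4 / q ^ 2 * (v ⬝ᵥ (g *ᵥ v)) ^ 2 = 4 := by linear_combination h1
    field_simp at h6
    exact h6
  have hsum : ∀ g ∈ S, g + gᵀ = (2 : 𝕜) • 1 := by
    intro g hg
    have hquad : ∀ (i j : ι) (t : 𝕜), i ≠ j → (Pi.single i 1 + t • Pi.single j 1 : ι → 𝕜) ⬝ᵥ
        (g *ᵥ (Pi.single i 1 + t • Pi.single j 1)) =
        g i i + t * (g i j + g j i) + t ^ 2 * g j j := by
      intro i j t _
      simp only [Matrix.mulVec_add, Matrix.mulVec_smul, dotProduct_add, add_dotProduct,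
        smul_dotProduct, dotProduct_smul, Matrix.mulVec_single_one, single_one_dotProduct,
        Matrix.col_apply, smul_eq_mul]
      ring
    have hnorm : ∀ (i j : ι) (t : 𝕜), i ≠ j → (Pi.single i 1 + t • Pi.single j 1 : ι → 𝕜) ⬝ᵥ
        (Pi.single i 1 + t • Pi.single j 1) = 1 + t ^ 2 := by
      intro i j t hij
      simp only [dotProduct_add, add_dotProduct, smul_dotProduct, dotProduct_smul,
        single_one_dotProduct, smul_eq_mul, Pi.single_eq_same, Pi.single_eq_of_ne hij,
        Pi.single_eq_of_ne hij.symm]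
      ring
    -- The diagonal entries of `g` are signs; `hoff` makes them equal, and the trace makes them `1`.
    have hdiag : ∀ i, g i i ^ 2 = 1 := by
      intro i
      have h1 := hrefl g hg (Pi.single i 1) (by simp)
      simpa [Matrix.mulVec_single_one] using h1
    -- Expand `(v, g v)² = (v, v)²` at `v = e_i + t e_j` for three values of `t` with `1 + t² ≠ 0`.
    have hoff : ∀ i j, i ≠ j → g i j + g j i = 0 ∧ g i i * g j j = 1 := by
      intro i j hij
      have h1 := hrefl g hg _ (show (Pi.single i 1 + (1 : 𝕜) • Pi.single j 1 : ι → 𝕜) ⬝ᵥ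
        (Pi.single i 1 + (1 : 𝕜) • Pi.single j 1) ≠ 0 by rw [hnorm i j _ hij]; norm_num)
      have h2 := hrefl g hg _ (show (Pi.single i 1 + (-1 : 𝕜) • Pi.single j 1 : ι → 𝕜) ⬝ᵥ
        (Pi.single i 1 + (-1 : 𝕜) • Pi.single j 1) ≠ 0 by rw [hnorm i j _ hij]; norm_num)
      have h3 := hrefl g hg _ (show (Pi.single i 1 + (2 : 𝕜) • Pi.single j 1 : ι → 𝕜) ⬝ᵥ
        (Pi.single i 1 + (2 : 𝕜) • Pi.single j 1) ≠ 0 by rw [hnorm i j _ hij]; norm_num)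
      rw [hquad i j _ hij, hnorm i j _ hij] at h1 h2 h3
      have hi := hdiag i
      have hj := hdiag j
      generalize g i j + g j i = s at h1 h2 h3 ⊢
      generalize g i i = a at *
      generalize g j j = b at *
      have h4 : s * (a + b) = 0 := by linear_combination (h1 - h2) / 4
      have h5 : s * b = 0 := by
        linear_combination (h3 - 4 * (h1 + h2) / 2 + 3 * hi - 12 * hj) / 12 - h4 / 3
      have h6 : s = 0 := by linear_combination b * h5 - s * hj
      refine ⟨h6, ?_⟩
      rw [h6] at h1
      linear_combination (h1 - hi - hj) / 2
    rcases isEmpty_or_nonempty ι with hι | ⟨⟨i₀⟩⟩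
    · exact Subsingleton.elim _ _
    · have hall : ∀ i, g i i = g i₀ i₀ := by
        intro i
        by_cases h : i = i₀
        · rw [h]
        · linear_combination g i₀ i₀ * (hoff i i₀ h).2 - g i i * hdiag i₀
      have htr := trace_of_isNilpotent_sub_one (hnil g hg)
      have hone : g i₀ i₀ = 1 := by
        have h1 : g.trace = Fintype.card ι * g i₀ i₀ := by
          simp [Matrix.trace, hall]
        rw [htr] at h1
        have h2 : (Fintype.card ι : 𝕜) ≠ 0 :=
          Nat.cast_ne_zero.2 (Fintype.card_pos_iff.2 ⟨i₀⟩).ne'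
        exact (mul_left_cancel₀ h2 (by rw [← h1, mul_one])).symm
      ext i j
      by_cases h : i = j
      · subst h
        simp [hall, hone]
        norm_num
      · simp [h, (hoff i j h).1]
  have hskew : ∀ g ∈ S, (g - 1)ᵀ = -(g - 1) := by
    intro g hg
    have h1 := hsum g hg
    rw [two_smul] at h1
    rw [Matrix.transpose_sub, Matrix.transpose_one, neg_sub, sub_eq_sub_iff_add_eq_add,
      add_comm, h1]
  have hsq : ∀ g ∈ S, (g - 1) * (g - 1) = 0 := by
    intro g hg
    have h1 := hS g hg
    have h2 : gᵀ = 1 - (g - 1) := by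
      have := hskew g hg
      rw [Matrix.transpose_sub, Matrix.transpose_one, sub_eq_iff_eq_add] at this
      rw [this]
      abel
    rw [h2] at h1
    have h3 : (1 - (g - 1)) * g = 1 - (g - 1) * (g - 1) := by
      rw [Matrix.sub_mul 1, Matrix.one_mul, Matrix.mul_sub, Matrix.mul_one]
      abel
    rw [h3, sub_eq_self] at h1
    exact h1
  intro g hg
  set D := g - 1 with hD
  have hcol : ∀ i k, D k i = 0 := by
    intro i k
    -- The reflection `R = 1 - 2 P` in the `i`-th coordinate hyperplane. The product of `g` and
    -- `R g R` belongs to `S`, so it is skew-symmetric after subtraction of the identity. This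
    -- gives `D P D = 0`, and the diagonal entries of `D P D` are the squares of the entries of
    -- the `i`-th column of `D`, up to the sign.
    set P : Matrix ι ι 𝕜 := Matrix.single i i 1 with hP
    have hPt : Pᵀ = P := by simp [hP]
    have hPP : P * P = P := by simp [hP]
    have hii : D i i = 0 := by
      have := congrFun (congrFun (hskew g hg) i) i
      exact self_eq_neg.1 this
    have hPDP : P * D * P = 0 := by
      ext a b
      simp [hP, hii]
    have hh' : (1 - (2 : 𝕜) • P) * (1 - (2 : 𝕜) • P) = 1 := by
      rw [Matrix.mul_sub, Matrix.sub_mul, Matrix.sub_mul, Matrix.mul_smul, Matrix.smul_mul,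
        Matrix.smul_mul, Matrix.mul_smul, hPP]
      simp only [Matrix.mul_one, Matrix.one_mul]
      module
    have hh : (1 - (2 : 𝕜) • P)ᵀ * (1 - (2 : 𝕜) • P) = 1 := by
      rw [Matrix.transpose_sub, Matrix.transpose_one, Matrix.transpose_smul, hPt, hh']
    have h1 := hskew _ (hmul g hg _ (hconj g hg _ _ hh hh'))
    have hconjD : (1 - (2 : 𝕜) • P) * g * (1 - (2 : 𝕜) • P) =
        1 + D - (2 : 𝕜) • (P * D) - (2 : 𝕜) • (D * P) := by
      have hgD : g = 1 + D := by rw [hD]; abel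
      rw [hgD, Matrix.mul_add, Matrix.mul_one, Matrix.add_mul, hh']
      simp only [Matrix.mul_sub, Matrix.sub_mul, Matrix.mul_smul, Matrix.smul_mul, hPDP,
        Matrix.mul_one, Matrix.one_mul]
      simp only [smul_zero]
      module
    have hDD : D * D = 0 := hsq g hg
    have hprod : g * (1 + D - (2 : 𝕜) • (P * D) - (2 : 𝕜) • (D * P)) - 1 =
        D + (D - (2 : 𝕜) • (P * D) - (2 : 𝕜) • (D * P)) - (2 : 𝕜) • (D * P * D) := by
      have hgD : g = 1 + D := by rw [hD]; abel
      rw [hgD]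
      simp only [Matrix.add_mul, Matrix.mul_add, Matrix.mul_sub, Matrix.mul_smul, Matrix.mul_one,
        Matrix.one_mul, ← Matrix.mul_assoc, hDD, Matrix.zero_mul, smul_add, smul_zero]
      module
    have hDt : Dᵀ = -D := hskew g hg
    rw [hconjD, hprod] at h1
    simp only [Matrix.transpose_add, Matrix.transpose_sub, Matrix.transpose_smul,
      Matrix.transpose_mul, hDt, hPt] at h1
    have h2 : D * P * D = 0 := by
      simp only [Matrix.mul_neg, Matrix.neg_mul, Matrix.mul_assoc, smul_neg, neg_neg] at h1 ⊢
      have h3 : (4 : 𝕜) • (D * (P * D)) = 0 := by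
        rw [← sub_eq_zero] at h1
        rw [← neg_eq_zero, ← h1]
        module
      exact (smul_eq_zero.1 h3).resolve_left (by norm_num)
    have h3 := congrFun (congrFun h2 k) k
    have h4 : D i k = -D k i := congrFun (congrFun hDt k) i
    have h5 : (D * P * D) k k = D k i * D i k := by
      rw [Matrix.mul_apply, Finset.sum_eq_single i]
      · simp [hP]
      · intro j _ hj
        simp [hP, hj]
      · simp
    rw [h5, h4, mul_neg, Matrix.zero_apply, neg_eq_zero, mul_self_eq_zero] at h3
    exact h3
  have : D = 0 := by
    ext k i
    exact hcol i k
  exact sub_eq_zero.1 this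

end NoUnipotent

/-! ### The semidirect product decomposition and the unipotent radical -/

section Semidirect

/-- A criterion for internal semidirect products in terms of elements of the ambient group. -/
theorem isSemidirect_of {Γ : Type*} [Group Γ] {C L U : Subgroup Γ} (hL : L ≤ C) (hU : U ≤ C)
    (hn : ∀ g ∈ C, ∀ u ∈ U, g * u * g⁻¹ ∈ U) (hd : ∀ x, x ∈ L → x ∈ U → x = 1)
    (hp : ∀ g ∈ C, ∃ l ∈ L, ∃ u ∈ U, g = l * u) : IsSemidirect C L U := by
  refine ⟨hL, hU, ⟨fun u hu g => hn g g.2 u hu⟩,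
    Subgroup.isComplement'_of_disjoint_and_mul_eq_univ ?_ ?_⟩
  · rw [Subgroup.disjoint_def]
    intro x hx hx'
    exact Subtype.ext (hd x hx hx')
  · refine Set.eq_univ_of_forall fun g => ?_
    obtain ⟨l, hl, u, hu, hg⟩ := hp g g.2
    exact Set.mem_mul.2 ⟨⟨l, hL hl⟩, hl, ⟨u, hU hu⟩, hu, Subtype.ext hg.symm⟩

theorem IsSemidirect.exists_mul {Γ : Type*} [Group Γ] {C L U : Subgroup Γ}
    (h : IsSemidirect C L U) {g : Γ} (hg : g ∈ C) : ∃ l ∈ L, ∃ u ∈ U, l * u = g := by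
  obtain ⟨⟨⟨l, hl⟩, ⟨u, hu⟩⟩, hlu⟩ := h.2.2.2.2 ⟨g, hg⟩
  exact ⟨l, hl, u, hu, congrArg Subtype.val hlu⟩

theorem conj_mem_of_normal_subgroupOf {Γ : Type*} [Group Γ] {C U : Subgroup Γ}
    (h : (U.subgroupOf C).Normal) (hU : U ≤ C) {g u : Γ} (hg : g ∈ C) (hu : u ∈ U) :
    g * u * g⁻¹ ∈ U :=
  h.conj_mem ⟨u, hU hu⟩ hu ⟨g, hg⟩

theorem IsSemidirect.comap {Γ Γ' : Type*} [Group Γ] [Group Γ'] (e : Γ ≃* Γ')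
    {C L U : Subgroup Γ'} (h : IsSemidirect C L U) :
    IsSemidirect (C.comap e.toMonoidHom) (L.comap e.toMonoidHom) (U.comap e.toMonoidHom) := by
  obtain ⟨hL, hU, hn, hc⟩ := h
  refine isSemidirect_of (Subgroup.comap_mono hL) (Subgroup.comap_mono hU) ?_ ?_ ?_
  · intro g hg u hu
    have := conj_mem_of_normal_subgroupOf hn hU (g := e g) (u := e u) hg hu
    simpa using this
  · intro x hx hx'
    have : (⟨e x, hL hx⟩ : C) = 1 := (Subgroup.disjoint_def.1 hc.disjoint) hx hx'
    simpa using congrArg Subtype.val this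
  · intro g hg
    obtain ⟨l, hl, u, hu, hlu⟩ := IsSemidirect.exists_mul ⟨hL, hU, hn, hc⟩ (g := e g) hg
    exact ⟨e.symm l, by simpa using hl, e.symm u, by simpa using hu,
      e.injective (by simp [hlu])⟩

variable {𝕜 : Type*} [Field 𝕜] {N : ℕ} {α μ : Fin N → ℕ}
variable {B : ∀ r : Fin N, Matrix (Fin (μ r)) (Fin (μ r)) 𝕜} {c : ℕ}

theorem blk_diagHom_same (Q : ∀ r, Matrix (Fin (μ r)) (Fin (μ r)) 𝕜) (r : Fin N) (i i') :
    blk (diagHom 𝕜 α μ Q) r i r i' = if i = i' then Q r else 0 := by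
  ext p q
  simp only [blk, diagHom, MonoidHom.coe_mk, OneHom.coe_mk, Matrix.of_apply,
    Matrix.blockDiagonal'_apply_eq, kroneckerMap_apply, Matrix.one_apply]
  split_ifs <;> simp

theorem matCoeff_diagHom_zero (hα₀ : ∀ r, 0 < α r) (Q : ∀ r, Matrix (Fin (μ r)) (Fin (μ r)) 𝕜)
    (r : Fin N) : matCoeff (diagHom 𝕜 α μ Q) r r 0 = Q r := by
  have := hα₀ r
  rw [matCoeff, dif_pos (by omega), blk_diagHom_same, if_pos]
  ext
  simp

theorem diagHom_commute_shiftT (Q : ∀ r, Matrix (Fin (μ r)) (Fin (μ r)) 𝕜) :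
    Commute (diagHom 𝕜 α μ Q) (shiftT 𝕜 α μ) := by
  simp only [diagHom, shiftT, MonoidHom.coe_mk, OneHom.coe_mk, commute_iff_eq]
  rw [← Matrix.blockDiagonal'_mul, ← Matrix.blockDiagonal'_mul]
  congr 1
  funext r
  rw [← Matrix.mul_kronecker_mul, ← Matrix.mul_kronecker_mul]
  simp

theorem diagHom_preserves (Q : ∀ r, Matrix (Fin (μ r)) (Fin (μ r)) 𝕜)
    (hQ : ∀ r, (Q r)ᵀ * B r * Q r = B r) :
    (diagHom 𝕜 α μ Q)ᵀ * formT α B * diagHom 𝕜 α μ Q = formT α B := by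
  simp only [diagHom, formT, MonoidHom.coe_mk, OneHom.coe_mk]
  rw [Matrix.blockDiagonal'_transpose, ← Matrix.blockDiagonal'_mul, ← Matrix.blockDiagonal'_mul]
  congr 1
  funext r
  rw [← Matrix.kroneckerMap_transpose, Matrix.mul_smul, Matrix.smul_mul, ← Matrix.mul_kronecker_mul,
    ← Matrix.mul_kronecker_mul, hQ]
  simp

variable (α B) in
/-- The block diagonal isometries `⨁_r (Q_r ⊕ … ⊕ Q_r)`. -/
def genO : Subgroup (GeneralLinearGroup (TIdx α μ) 𝕜) :=
  (Subgroup.pi Set.univ fun r => formGroup (B r)).map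
    ((Units.map (diagHom 𝕜 α μ)).comp MulEquiv.piUnits.symm.toMonoidHom)

theorem exists_mem_genO {X : GeneralLinearGroup (TIdx α μ) 𝕜} (hX : X ∈ genO α B) :
    ∃ Q : ∀ r, Matrix (Fin (μ r)) (Fin (μ r)) 𝕜, (∀ r, (Q r)ᵀ * B r * Q r = B r) ∧
      (X : Matrix (TIdx α μ) (TIdx α μ) 𝕜) = diagHom 𝕜 α μ Q := by
  obtain ⟨Q, hQ, rfl⟩ := hX
  exact ⟨fun r => Q r, fun r => hQ r trivial, rfl⟩

theorem IsAdmissible.mem_genO (h : IsAdmissible c α B)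
    {Q : ∀ r, Matrix (Fin (μ r)) (Fin (μ r)) 𝕜} (hQ : ∀ r, (Q r)ᵀ * B r * Q r = B r) :
    ∃ X ∈ genO α B, (X : Matrix (TIdx α μ) (TIdx α μ) 𝕜) = diagHom 𝕜 α μ Q := by
  choose u hu using fun r => h.isUnit_of_gram (hQ r)
  refine ⟨_, ⟨u, fun r _ => ?_, rfl⟩, ?_⟩
  · change (u r : Matrix _ _ 𝕜)ᵀ * B r * (u r : Matrix _ _ 𝕜) = B r
    rw [hu, hQ]
  · have : (fun r => (u r : Matrix _ _ 𝕜)) = Q := funext hu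
    rw [← this]
    rfl

theorem genO_le_isoT : genO α B ≤ isoT α B := by
  intro X hX
  obtain ⟨Q, hQ, hXQ⟩ := exists_mem_genO hX
  rw [mem_isoT_iff, hXQ]
  exact ⟨diagHom_preserves Q hQ, diagHom_commute_shiftT Q⟩

/-- The isotropy group is the semidirect product of the block diagonal isometries and the kernel of
the leading diagonal coefficients. -/
theorem IsAdmissible.isSemidirect [CharZero 𝕜] (h : IsAdmissible c α B) :
    IsSemidirect (isoT α B) (genO α B) (genU α B c) := by
  rw [genU_eq_unipT h]
  refine isSemidirect_of genO_le_isoT (fun X hX => hX.1) ?_ ?_ ?_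
  · rintro g hg u ⟨hu, hu'⟩
    refine ⟨mul_mem (mul_mem hg hu) (inv_mem hg), fun r => ?_⟩
    rw [h.coeff_mul_zero (mul_mem hg hu) (inv_mem hg), h.coeff_mul_zero hg hu, hu', Matrix.mul_one,
      ← h.coeff_mul_zero hg (inv_mem hg), mul_inv_cancel, h.coeff_one_zero]
  · rintro X hX ⟨-, hX'⟩
    obtain ⟨Q, hQ, hXQ⟩ := exists_mem_genO hX
    have : Q = 1 := by
      funext r
      have := hX' r
      rwa [coeff_eq_matCoeff, hXQ, matCoeff_diagHom_zero h.pos] at this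
    refine Units.ext ?_
    rw [hXQ, this, map_one, Units.val_one]
  · intro g hg
    -- The block diagonal matrix with the leading coefficients of `g` is an isometry, and it splits
    -- off on the left.
    obtain ⟨D, hD, hDQ⟩ := h.mem_genO (h.mem_isoT_iff.1 hg).2.1
    have hD' := genO_le_isoT hD
    refine ⟨D, hD, D⁻¹ * g, ⟨mul_mem (inv_mem hD') hg, fun r => ?_⟩, by simp⟩
    have h1 : coeff D r r 0 = coeff g r r 0 := by
      rw [coeff_eq_matCoeff D, hDQ, matCoeff_diagHom_zero h.pos]
    rw [h.coeff_mul_zero (inv_mem hD') hg, ← h1, h.coeff_inv_zero_mul hD']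

theorem IsAdmissible.sup_eq_isoT [CharZero 𝕜] (h : IsAdmissible c α B) :
    genO α B ⊔ genU α B c = isoT α B := by
  refine le_antisymm (sup_le h.isSemidirect.1 h.isSemidirect.2.1) fun g hg => ?_
  obtain ⟨l, hl, u, hu, rfl⟩ := h.isSemidirect.exists_mul hg
  exact mul_mem (Subgroup.mem_sup_left hl) (Subgroup.mem_sup_right hu)

/-- The leading diagonal coefficients of a unipotent element of the isotropy group are unipotent.
-/
theorem matCoeff_sub_one_pow (h : IsAdmissible c α B) {g : GeneralLinearGroup (TIdx α μ) 𝕜}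
    (hg : g ∈ isoT α B) (r : Fin N) (n : ℕ) :
    matCoeff (((g : Matrix (TIdx α μ) (TIdx α μ) 𝕜) - 1) ^ n) r r 0 =
      (coeff g r r 0 - 1) ^ n := by
  have hc : Commute ((g : Matrix (TIdx α μ) (TIdx α μ) 𝕜) - 1) (shiftT 𝕜 α μ) :=
    ((mem_isoT_iff B).1 hg).2.sub_left (Commute.one_left _)
  induction n with
  | zero => rw [pow_zero, pow_zero, matCoeff_one_zero r (h.pos r)]
  | succ n ih =>
    rw [pow_succ, pow_succ, matCoeff_mul_zero h.anti.injective h.pos (hc.pow_left n) hc, ih,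
      matCoeff_sub, coeff_eq_matCoeff]
    simp only [Pi.sub_apply, matCoeff_one_zero r (h.pos r)]

/-- A unipotent group of elements of the isotropy group that is normalized by the block diagonal
isometries has trivial leading diagonal coefficients. -/
theorem coeff_zero_eq_one_of_unipotent [CharZero 𝕜] (h : IsAdmissible c α B)
    (hB : ∀ r, HasNoNormalUnipotent (B r)) {V : Subgroup (GeneralLinearGroup (TIdx α μ) 𝕜)}
    (hV : V ≤ isoT α B) (hVn : ∀ x ∈ genO α B, ∀ g ∈ V, x * g * x⁻¹ ∈ V)
    (hVu : ∀ g ∈ V, IsNilpotent ((g : Matrix (TIdx α μ) (TIdx α μ) 𝕜) - 1)) :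
    ∀ g ∈ V, ∀ r, coeff g r r 0 = 1 := by
  classical
  intro g hg r
  -- The leading coefficients `A_0^{rr}` of the elements of `V` form a normal unipotent group of
  -- isometries of `B_r`: an isometry `P` of `B_r` is extended by `1` to a block diagonal one.
  refine hB r {M | ∃ g ∈ V, coeff g r r 0 = M} ?_ ?_ ?_ ?_ ?_ _ ⟨g, hg, rfl⟩
  · rintro _ ⟨g, hg, rfl⟩
    exact (h.mem_isoT_iff.1 (hV hg)).2.1 r
  · rintro _ ⟨g, hg, rfl⟩
    obtain ⟨n, hn⟩ := hVu g hg
    exact ⟨n, by rw [← matCoeff_sub_one_pow h (hV hg), hn, matCoeff_zero]; rfl⟩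
  · rintro _ ⟨g, hg, rfl⟩ _ ⟨g', hg', rfl⟩
    exact ⟨g * g', mul_mem hg hg', h.coeff_mul_zero (hV hg) (hV hg') r⟩
  · rintro _ ⟨g, hg, rfl⟩
    exact ⟨_, ⟨g⁻¹, inv_mem hg, rfl⟩, h.coeff_inv_zero_mul (hV hg) r⟩
  · rintro _ ⟨g, hg, rfl⟩ P P' hP hPP
    have hQ : ∀ s, (Function.update (fun s => (1 : Matrix (Fin (μ s)) (Fin (μ s)) 𝕜)) r P s)ᵀ *
        B s *
        Function.update (fun s => (1 : Matrix (Fin (μ s)) (Fin (μ s)) 𝕜)) r P s = B s := by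
      intro s
      by_cases hs : s = r
      · subst hs
        rw [Function.update_self, hP]
      · rw [Function.update_of_ne hs]
        simp
    obtain ⟨x, hx, hxQ⟩ := h.mem_genO hQ
    have hx' := genO_le_isoT hx
    have h1 : coeff x r r 0 = P := by
      rw [coeff_eq_matCoeff, hxQ, matCoeff_diagHom_zero h.pos, Function.update_self]
    have h2 : coeff x⁻¹ r r 0 = P' := by
      have := h.coeff_inv_zero_mul hx' r
      rw [h1] at this
      rw [← Matrix.mul_one (coeff x⁻¹ r r 0), ← hPP, ← Matrix.mul_assoc, this, Matrix.one_mul]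
    refine ⟨x * g * x⁻¹, hVn x hx g hg, ?_⟩
    rw [h.coeff_mul_zero (mul_mem hx' (hV hg)) (inv_mem hx'), h.coeff_mul_zero hx' (hV hg), h1, h2]

/-- The elements of the kernel of the leading coefficients raise the height, so they are
unipotent. Conversely, the leading coefficients of a normal unipotent subgroup are trivial. -/
theorem IsAdmissible.isUnipotentRadical [CharZero 𝕜] (h : IsAdmissible c α B)
    (hB : ∀ r, HasNoNormalUnipotent (B r)) :
    IsUnipotentRadical (isoT α B) (genU α B c) := by
  obtain ⟨h1, h2, h3, -⟩ := h.isSemidirect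
  refine ⟨⟨h2, h3, fun g hg => ?_⟩, ?_⟩
  · rw [genU_eq_unipT h] at hg
    exact (raises_one_of_mem_unipT hg).isNilpotent
  · rintro V ⟨hV, hVn, hVu⟩ g hg
    rw [genU_eq_unipT h]
    refine ⟨hV hg, coeff_zero_eq_one_of_unipotent h hB hV (fun x hx g hg => ?_) hVu g hg⟩
    exact hVn.conj_mem ⟨g, hV hg⟩ hg ⟨x, h1 hx⟩

theorem IsAdmissible.isReductive [CharZero 𝕜] (h : IsAdmissible c α B)
    (hB : ∀ r, HasNoNormalUnipotent (B r)) : IsReductive (genO α B) := by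
  refine ⟨⟨bot_le, ⟨fun x hx g => ?_⟩, fun g hg => ?_⟩, ?_⟩
  · have hx1 : x = 1 := Subtype.ext (Subgroup.mem_bot.1 hx)
    subst hx1
    rw [mul_one, mul_inv_cancel]
    exact one_mem _
  · rw [Subgroup.mem_bot.1 hg, Units.val_one, sub_self]
    exact IsNilpotent.zero
  · rintro V ⟨hV, hVn, hVu⟩ g hg
    have h1 := coeff_zero_eq_one_of_unipotent h hB (hV.trans genO_le_isoT) (fun x hx g hg =>
      hVn.conj_mem ⟨g, hV hg⟩ hg ⟨x, hx⟩) hVu g hg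
    obtain ⟨Q, -, hgQ⟩ := exists_mem_genO (hV hg)
    have h2 : Q = 1 := by
      funext r
      have := h1 r
      rwa [coeff_eq_matCoeff, hgQ, matCoeff_diagHom_zero h.pos] at this
    rw [Subgroup.mem_bot]
    refine Units.ext ?_
    rw [hgQ, h2, map_one, Units.val_one]

/-- Transport of the unipotent radical along a conjugation. -/
theorem IsUnipotentRadical.comap {ι κ : Type*} [Fintype ι] [DecidableEq ι] [Fintype κ]
    [DecidableEq κ] (e : GeneralLinearGroup ι 𝕜 ≃* GeneralLinearGroup κ 𝕜)
    (he : ∀ g : GeneralLinearGroup ι 𝕜, IsNilpotent ((g : Matrix ι ι 𝕜) - 1) ↔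
      IsNilpotent ((e g : Matrix κ κ 𝕜) - 1))
    {C U : Subgroup (GeneralLinearGroup κ 𝕜)} (h : IsUnipotentRadical C U) :
    IsUnipotentRadical (C.comap e.toMonoidHom) (U.comap e.toMonoidHom) := by
  obtain ⟨⟨h1, h2, h3⟩, h4⟩ := h
  refine ⟨⟨Subgroup.comap_mono h1, ⟨fun x hx g => ?_⟩, fun g hg => (he g).2 (h3 _ hg)⟩, ?_⟩
  · have := conj_mem_of_normal_subgroupOf h2 h1 (g := e g) (u := e x) g.2 hx
    change e ((g : GeneralLinearGroup ι 𝕜) * x * (g : GeneralLinearGroup ι 𝕜)⁻¹) ∈ U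
    rwa [map_mul, map_mul, map_inv]
  · rintro V ⟨v1, v2, v3⟩
    rw [← Subgroup.map_le_iff_le_comap]
    refine h4 _ ⟨Subgroup.map_le_iff_le_comap.2 v1, ⟨?_⟩, ?_⟩
    · rintro ⟨_, hxC⟩ ⟨x, hx, rfl⟩ ⟨g, hg⟩
      have h5 : e.symm g ∈ C.comap e.toMonoidHom := by simpa using hg
      exact ⟨_, conj_mem_of_normal_subgroupOf v2 v1 h5 hx, by simp⟩
    · rintro _ ⟨x, hx, rfl⟩
      exact (he x).1 (v3 x hx)

end Semidirect

/-! ### Polynomial dependence of the coefficients -/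

section Polynomial

variable {𝕜 : Type*} [Field 𝕜] {N : ℕ} {α μ : Fin N → ℕ} {k l n : Type*}

/-- On the set `S` of families of coefficients, the matrix valued function `f` is given by
polynomials in the entries that belong to `V`. -/
def IsPolyOn (S : Set (Coeffs 𝕜 μ)) (V : Set (Coord μ)) (f : Coeffs 𝕜 μ → Matrix k l 𝕜) : Prop :=
  ∃ P : Matrix k l (MvPolynomial (Coord μ) 𝕜),
    (∀ p q, P p q ∈ MvPolynomial.supported 𝕜 V) ∧ ∀ A ∈ S, f A = polyEval P A

variable {S : Set (Coeffs 𝕜 μ)} {V : Set (Coord μ)}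

theorem IsPolyOn.const (M : Matrix k l 𝕜) : IsPolyOn S V fun _ => M := by
  refine ⟨M.map MvPolynomial.C, fun p q => (MvPolynomial.supported 𝕜 V).algebraMap_mem _,
    fun A _ => ?_⟩
  ext p q
  simp [polyEval]

theorem IsPolyOn.coord {r s : Fin N} {j : ℕ} (h : ∀ p q, (⟨(r, s), j, p, q⟩ : Coord μ) ∈ V) :
    IsPolyOn S V fun A => A r s j := by
  refine ⟨Matrix.of fun p q => MvPolynomial.X ⟨(r, s), j, p, q⟩,
    fun p q => MvPolynomial.X_mem_supported.2 (h p q), fun A _ => ?_⟩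
  ext p q
  simp [polyEval]

theorem IsPolyOn.add {f g : Coeffs 𝕜 μ → Matrix k l 𝕜} (hf : IsPolyOn S V f)
    (hg : IsPolyOn S V g) : IsPolyOn S V fun A => f A + g A := by
  obtain ⟨P, hP, hP'⟩ := hf
  obtain ⟨Q, hQ, hQ'⟩ := hg
  refine ⟨P + Q, fun p q => add_mem (hP p q) (hQ p q), fun A hA => ?_⟩
  beta_reduce
  rw [hP' A hA, hQ' A hA]
  ext p q
  simp [polyEval]

theorem IsPolyOn.smul {f : Coeffs 𝕜 μ → Matrix k l 𝕜} (a : 𝕜) (hf : IsPolyOn S V f) :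
    IsPolyOn S V fun A => a • f A := by
  obtain ⟨P, hP, hP'⟩ := hf
  refine ⟨a • P, fun p q => (MvPolynomial.supported 𝕜 V).smul_mem (hP p q) a, fun A hA => ?_⟩
  beta_reduce
  rw [hP' A hA]
  ext p q
  simp [polyEval]

theorem IsPolyOn.neg {f : Coeffs 𝕜 μ → Matrix k l 𝕜} (hf : IsPolyOn S V f) :
    IsPolyOn S V fun A => -f A := by
  simpa using hf.smul (-1)

theorem IsPolyOn.mul [Fintype l] {f : Coeffs 𝕜 μ → Matrix k l 𝕜} {g : Coeffs 𝕜 μ → Matrix l n 𝕜}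
    (hf : IsPolyOn S V f) (hg : IsPolyOn S V g) : IsPolyOn S V fun A => f A * g A := by
  obtain ⟨P, hP, hP'⟩ := hf
  obtain ⟨Q, hQ, hQ'⟩ := hg
  refine ⟨P * Q, fun p q => sum_mem fun x _ => mul_mem (hP p x) (hQ x q), fun A hA => ?_⟩
  beta_reduce
  rw [hP' A hA, hQ' A hA]
  ext p q
  simp [polyEval, Matrix.mul_apply]

theorem IsPolyOn.transpose {f : Coeffs 𝕜 μ → Matrix k l 𝕜} (hf : IsPolyOn S V f) :
    IsPolyOn S V fun A => (f A)ᵀ := by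
  obtain ⟨P, hP, hP'⟩ := hf
  refine ⟨Pᵀ, fun p q => hP q p, fun A hA => ?_⟩
  beta_reduce
  rw [hP' A hA]
  rfl

theorem IsPolyOn.sum {ι : Type*} (T : Finset ι) {f : ι → Coeffs 𝕜 μ → Matrix k l 𝕜}
    (hf : ∀ x ∈ T, IsPolyOn S V (f x)) : IsPolyOn S V fun A => ∑ x ∈ T, f x A := by
  classical
  induction T using Finset.induction_on with
  | empty => simpa using IsPolyOn.const 0
  | insert a T ha ih =>
    simp only [Finset.sum_insert ha]
    exact (hf a (Finset.mem_insert_self a T)).add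
      (ih fun x hx => hf x (Finset.mem_insert_of_mem hx))

theorem IsPolyOn.ite {f g : Coeffs 𝕜 μ → Matrix k l 𝕜} {p : Prop} [Decidable p]
    (hf : p → IsPolyOn S V f) (hg : ¬ p → IsPolyOn S V g) :
    IsPolyOn S V fun A => if p then f A else g A := by
  by_cases h : p
  · simpa [h] using hf h
  · simpa [h] using hg h

theorem IsPolyOn.mono {V' : Set (Coord μ)} (hV : V ⊆ V') {f : Coeffs 𝕜 μ → Matrix k l 𝕜}
    (hf : IsPolyOn S V f) : IsPolyOn S V' f := by
  obtain ⟨P, hP, hP'⟩ := hf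
  exact ⟨P, fun p q => MvPolynomial.supported_mono hV (hP p q), hP'⟩

theorem IsPolyOn.congr {f g : Coeffs 𝕜 μ → Matrix k l 𝕜} (hf : IsPolyOn S V f)
    (h : ∀ A ∈ S, g A = f A) : IsPolyOn S V g := by
  obtain ⟨P, hP, hP'⟩ := hf
  exact ⟨P, hP, fun A hA => (h A hA).trans (hP' A hA)⟩

variable {B : ∀ r : Fin N, Matrix (Fin (μ r)) (Fin (μ r)) 𝕜} {c : ℕ}

theorem IsPolyOn.pairing {k r s : Fin N} {n : ℕ} (h : ∀ l ≤ n, IsPolyOn S V fun A => A k r l)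
    (h' : ∀ l ≤ n, IsPolyOn S V fun A => A k s l) :
    IsPolyOn S V fun A => pairing B A k r s n := by
  refine IsPolyOn.sum _ fun l hl => ?_
  rw [Finset.mem_range] at hl
  exact (((h l (by omega)).transpose.mul (IsPolyOn.const _)).mul (h' (n - l) (by omega))).smul _

/-- The remainder at `(r, s, j)` involves preceding coefficients in the block columns up to `s` or
below the diagonal only. -/
theorem IsPolyOn.remainder (hα : StrictAnti α) {r s : Fin N} {j : ℕ} (hrs : r ≤ s)
    (h : ∀ r' s' j', Precedes r' s' j' r s j → (s' < r' ∨ s' ≤ s) →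
      IsPolyOn S V fun A => A r' s' j') :
    IsPolyOn S V fun A => remainder α B A r s j := by
  have hv : (r : ℕ) ≤ s := hrs
  refine (((IsPolyOn.add ?_ ?_).add ?_).add ?_).add ?_
  · refine IsPolyOn.sum _ fun l hl => ?_
    rw [Finset.mem_Ico] at hl
    exact (((h r r l (Or.inr ⟨le_rfl, Or.inl hl.2⟩) (Or.inr hrs)).transpose.mul
      (IsPolyOn.const _)).mul
      (h r s (j - l) (Or.inr ⟨hrs, Or.inl (by omega)⟩) (Or.inr le_rfl))).smul _
  · refine IsPolyOn.ite (fun h1 => ?_) fun _ => IsPolyOn.const 0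
    have h2 : (r : ℕ) < s := h1.1
    exact (((h r r j (Or.inr ⟨le_rfl, Or.inr ⟨rfl, by omega⟩⟩) (Or.inr hrs)).transpose.mul
      (IsPolyOn.const _)).mul (h r s 0 (Or.inr ⟨hrs, Or.inl h1.2⟩) (Or.inr le_rfl))).smul _
  · refine IsPolyOn.sum _ fun k hk => ?_
    simp only [Finset.mem_filter, Finset.mem_univ, true_and] at hk
    have := hα hk
    refine IsPolyOn.ite (fun _ => IsPolyOn.smul _ (IsPolyOn.pairing ?_ ?_)) fun _ =>
      IsPolyOn.const 0
    · exact fun l hl => h k r l (Or.inr ⟨hk.le, Or.inl (by omega)⟩) (Or.inr hrs)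
    · exact fun l hl => h k s l (Or.inr ⟨hk.le.trans hrs, Or.inl (by omega)⟩) (Or.inr le_rfl)
  · refine IsPolyOn.sum _ fun k hk => ?_
    simp only [Finset.mem_filter, Finset.mem_univ, true_and] at hk
    have h1 : (r : ℕ) < k := hk.1
    have h2 : (k : ℕ) ≤ s := hk.2
    refine IsPolyOn.pairing (fun l _ => h k r l (Or.inl hk.1) (Or.inl hk.1)) fun l hl => ?_
    refine h k s l (Or.inr ⟨hk.2, ?_⟩) (Or.inr le_rfl)
    omega
  · refine IsPolyOn.sum _ fun k hk => ?_
    simp only [Finset.mem_filter, Finset.mem_univ, true_and] at hk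
    refine IsPolyOn.ite (fun _ => IsPolyOn.pairing ?_ ?_) fun _ => IsPolyOn.const 0
    · exact fun l _ => h k r l (Or.inl (hrs.trans_lt hk)) (Or.inl (hrs.trans_lt hk))
    · exact fun l _ => h k s l (Or.inl hk) (Or.inl hk)

/-- On the isotropy group the coefficients above the diagonal are polynomials in the coefficients
below the diagonal and in the diagonal coefficients that are not computed later. -/
theorem IsAdmissible.isPolyOn_upper [CharZero 𝕜] (h : IsAdmissible c α B) {r s : Fin N}
    (hrs : r < s) (j : ℕ) :
    IsPolyOn (coeff '' (isoT α B : Set (GeneralLinearGroup (TIdx α μ) 𝕜)))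
      {x | x.1.2 < x.1.1 ∨ (x.1.1 = x.1.2 ∧ x.1.1 ≤ s ∧ x.2.1 ≤ j)} fun A => A r s j := by
  have key : ∀ (r s : Fin N) (j : ℕ), r ≤ s → r < s →
      IsPolyOn (coeff '' (isoT α B : Set (GeneralLinearGroup (TIdx α μ) 𝕜)))
        {x | x.1.2 < x.1.1 ∨ (x.1.1 = x.1.2 ∧ x.1.1 ≤ s ∧ x.2.1 ≤ j)} fun A => A r s j := by
    refine precedes_induction fun r s j hrs ih hlt => ?_
    by_cases hj : j < α s
    · have h1 : ∀ r' s' j', Precedes r' s' j' r s j → (s' < r' ∨ s' ≤ s) →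
          IsPolyOn (coeff '' (isoT α B : Set (GeneralLinearGroup (TIdx α μ) 𝕜)))
            {x | x.1.2 < x.1.1 ∨ (x.1.1 = x.1.2 ∧ x.1.1 ≤ s ∧ x.2.1 ≤ j)}
            fun A => A r' s' j' := by
        intro r' s' j' hp hs'
        rcases lt_trichotomy s' r' with h2 | rfl | h2
        · exact IsPolyOn.coord fun p q => Or.inl h2
        · refine IsPolyOn.coord fun p q => Or.inr ⟨rfl, ?_, ?_⟩
          · exact hs'.resolve_left (lt_irrefl _)
          · rcases hp with hp | ⟨-, hp⟩
            · exact absurd hp (lt_irrefl _)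
            · change j' ≤ j
              omega
        · have h3 := hs'.resolve_left h2.not_gt
          have h4 : j' ≤ j := by
            rcases hp with hp | ⟨-, hp⟩
            · exact absurd hp h2.not_gt
            · omega
          refine (ih r' s' j' h2.le hp h2).mono ?_
          rintro x (hx | ⟨hx, hx', hx''⟩)
          · exact Or.inl hx
          · exact Or.inr ⟨hx, hx'.trans h3, hx''.trans h4⟩
      refine IsPolyOn.congr (((IsPolyOn.mul (IsPolyOn.mul (IsPolyOn.coord (r := r) (s := r) (j := 0)
        fun p q => Or.inr ⟨rfl, hrs, Nat.zero_le j⟩) (IsPolyOn.const (B r)⁻¹))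
        (IsPolyOn.remainder (B := B) h.anti hrs h1))).neg) ?_
      rintro _ ⟨X, hX, rfl⟩
      obtain ⟨-, -, Z, -, hZ⟩ := h.mem_isoT_iff.1 hX
      exact hZ.2 r s hlt j hj
    · refine (IsPolyOn.const 0).congr ?_
      rintro _ ⟨X, -, rfl⟩
      exact coeff_of_le X ((min_le_right _ _).trans (not_lt.1 hj))
  exact key r s j hrs.le hrs

/-- On the isotropy group the contribution of the remainder to a diagonal coefficient is a
polynomial in the coefficients below the diagonal and in the diagonal coefficients of smaller index. -/
theorem IsAdmissible.isPolyOn_diag [CharZero 𝕜] (h : IsAdmissible c α B) (r : Fin N) {j : ℕ}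
    (hj : 1 ≤ j) :
    IsPolyOn (coeff '' (isoT α B : Set (GeneralLinearGroup (TIdx α μ) 𝕜)))
      {x | x.1.2 < x.1.1 ∨ (x.1.1 = x.1.2 ∧ x.1.1 ≤ r ∧ x.2.1 < j)}
      fun A => -(A r r 0 * (B r)⁻¹ * ((1 / 2 : 𝕜) • remainder α B A r r j)) := by
  refine (IsPolyOn.mul (IsPolyOn.mul (IsPolyOn.coord fun p q => Or.inr ⟨rfl, le_rfl, hj⟩)
    (IsPolyOn.const _)) ((IsPolyOn.remainder h.anti le_rfl ?_).smul _)).neg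
  intro r' s' j' hp hs'
  rcases lt_trichotomy s' r' with h2 | rfl | h2
  · exact IsPolyOn.coord fun p q => Or.inl h2
  · refine IsPolyOn.coord fun p q => Or.inr ⟨rfl, hs'.resolve_left (lt_irrefl _), ?_⟩
    rcases hp with hp | ⟨-, hp⟩
    · exact absurd hp (lt_irrefl _)
    · change j' < j
      omega
  · have h3 := hs'.resolve_left h2.not_gt
    have h4 : j' < j := by
      rcases hp with hp | ⟨-, hp⟩
      · exact absurd hp h2.not_gt
      · omega
    refine (h.isPolyOn_upper h2 j').mono ?_
    rintro x (hx | ⟨hx, hx', hx''⟩)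
    · exact Or.inl hx
    · exact Or.inr ⟨hx, hx'.trans h3, lt_of_le_of_lt hx'' h4⟩

/-- The polynomials required by the conditions are those of the recursion: the part `D_j^r` of a
diagonal coefficient is `-½ A_0^{rr} B_r⁻¹` times the remainder, and the coefficients above the
diagonal are eliminated by induction. -/
theorem IsAdmissible.satisfiesConditions [CharZero 𝕜] (h : IsAdmissible c α B) :
    SatisfiesConditions c B (isoT α B : Set (GeneralLinearGroup (TIdx α μ) 𝕜)) := by
  classical
  -- Only `1 ≤ j` (in `hD`) and `r < s` (in `hE`) matter; the other values are set to zero.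
  have hD : ∀ (r : Fin N) (j : ℕ),
      IsPolyOn (coeff '' (isoT α B : Set (GeneralLinearGroup (TIdx α μ) 𝕜)))
      {x | x.1.2 < x.1.1 ∨ (x.1.1 = x.1.2 ∧ x.1.1 ≤ r ∧ x.2.1 < j)} fun A => if 1 ≤ j then
        -(A r r 0 * (B r)⁻¹ * ((1 / 2 : 𝕜) • BlockToeplitz.remainder α B A r r j)) else 0 :=
    fun r j => IsPolyOn.ite (fun hj => h.isPolyOn_diag r hj) fun _ => IsPolyOn.const 0
  have hE : ∀ (r s : Fin N) (j : ℕ),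
      IsPolyOn (coeff '' (isoT α B : Set (GeneralLinearGroup (TIdx α μ) 𝕜)))
      {x | x.1.2 ≤ x.1.1} fun A => if r < s then A r s j else 0 :=
    fun r s j => IsPolyOn.ite (fun hrs => (h.isPolyOn_upper hrs j).mono fun x hx => by
      rcases hx with hx | hx
      · exact hx.le
      · exact hx.1.ge) fun _ => IsPolyOn.const 0
  choose D hDv hD using hD
  choose E hEv hE using hE
  have hDe : ∀ X ∈ isoT α B, ∀ r j, 1 ≤ j → polyEval (D r j) (coeff X) =
      -(coeff X r r 0 * (B r)⁻¹ * ((1 / 2 : 𝕜) • BlockToeplitz.remainder α B (coeff X) r r j)) := by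
    intro X hX r j hj
    have := hD r j _ ⟨X, hX, rfl⟩
    simp only [hj, if_true] at this
    exact this.symm
  have hform : ∀ X ∈ isoT α B, ∀ (Z : ∀ r : Fin N, ℕ → Matrix (Fin (μ r)) (Fin (μ r)) 𝕜) (r : Fin N)
      (j : ℕ), 1 ≤ j → coeff X r r 0 * (B r)⁻¹ * Z r j + polyEval (D r j) (coeff X) =
        coeff X r r 0 * (B r)⁻¹ *
          (Z r j - (1 / 2 : 𝕜) • BlockToeplitz.remainder α B (coeff X) r r j) := by
    intro X hX Z r j hj
    rw [hDe X hX r j hj, Matrix.mul_sub, sub_eq_add_neg]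
  refine ⟨D, E, fun r j p q x hx => ?_, fun r s j p q x hx => ?_, fun X hX => ?_, fun X hX => ?_,
    fun X hX r s hrs j hj => ?_, fun A₀ L Z hA₀ hZ => ?_⟩
  · exact MvPolynomial.mem_supported.1 (hDv r j p q) hx
  · exact MvPolynomial.mem_supported.1 (hEv r s j p q) hx
  · exact (h.mem_isoT_iff.1 hX).2.1
  · obtain ⟨-, -, Z, hZ, hZX⟩ := h.mem_isoT_iff.1 hX
    refine ⟨Z, hZ, fun r j hj hj' => ?_⟩
    rw [hform X hX Z r j hj]
    exact hZX.1 r j hj hj'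
  · have := hE r s j _ ⟨X, hX, rfl⟩
    simp only [hrs, if_true] at this
    exact this
  · obtain ⟨X, hX, h1, h2, h3⟩ := h.exists_mem_isoT A₀ L Z hA₀ hZ
    refine ⟨X, ⟨hX, h1, h2, fun r j hj hj' => ?_⟩, ?_⟩
    · rw [← h1, hform X hX Z r j hj]
      exact h3.1 r j hj hj'
    · rintro Y ⟨hY, y1, y2, y3⟩
      obtain ⟨yT, -, Z', -, hZ'⟩ := h.mem_isoT_iff.1 hY
      have hYc : IsComputed α B Z (coeff Y) := by
        refine ⟨fun r j hj hj' => ?_, hZ'.2⟩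
        rw [← hform Y hY Z r j hj, y1]
        exact y3 r j hj hj'
      have := hYc.unique B h.anti h3 (fun r => by rw [y1, h1])
        (fun r s hsr j hj => by rw [y2 r s hsr j hj, h2 r s hsr j hj])
        (fun r s j hj => by rw [coeff_of_le Y hj, coeff_of_le X hj])
      exact ext_of_coeff yT (h.isoT_subset hX) fun r s j _ => by rw [this]

end Polynomial

/-! ### The conjugation by `Ψ` -/

section Psi

variable (𝕜 : Type*) [Field 𝕜]

theorem gammaMat_transpose (a : ℕ) : (gammaMat 𝕜 a)ᵀ = (-1 : 𝕜) ^ (a + 1) • gammaMat 𝕜 a := by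
  ext i j
  simp only [Matrix.transpose_apply, Matrix.smul_apply, gammaMat, Matrix.of_apply, smul_eq_mul,
    mul_ite, mul_zero, ← pow_add]
  by_cases h : (i : ℕ) + j + 1 = a
  · rw [if_pos (by omega), if_pos h, show a + 1 + i = (j : ℕ) + 2 * (i + 1) by omega, pow_add,
      pow_mul]
    simp
  · rw [if_neg (by omega), if_neg h]

theorem gammaMat_mul_self (a : ℕ) : gammaMat 𝕜 a * gammaMat 𝕜 a = (-1 : 𝕜) ^ (a + 1) • 1 := by
  have h := gammaMat_mul_transpose 𝕜 a
  rw [gammaMat_transpose, Matrix.mul_smul] at h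
  rw [← h, smul_smul, ← pow_add, ← two_mul, pow_mul]
  simp

theorem gammaMat_mul_jordanZero_transpose (a : ℕ) :
    gammaMat 𝕜 a * (jordanZero 𝕜 a)ᵀ = -(jordanZero 𝕜 a * gammaMat 𝕜 a) := by
  ext i j
  rw [Matrix.neg_apply, Matrix.mul_apply, Matrix.mul_apply]
  simp only [Matrix.transpose_apply, gammaMat, jordanZero, Matrix.of_apply]
  by_cases h : (i : ℕ) + j + 2 = a
  · rw [Finset.sum_eq_single (⟨j + 1, by omega⟩ : Fin a), Finset.sum_eq_single
      (⟨i + 1, by omega⟩ : Fin a)]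
    · rw [if_pos (by simp; omega), if_pos rfl, if_pos rfl, if_pos (by simp; omega)]
      simp [pow_succ]
    · intro k _ hk
      rw [if_neg (fun e => hk (Fin.ext e.symm)), zero_mul]
    · simp
    · intro k _ hk
      rw [if_neg (c := (j : ℕ) + 1 = k) (fun e => hk (Fin.ext e.symm)), mul_zero]
    · simp
  · rw [Finset.sum_eq_zero, Finset.sum_eq_zero, neg_zero]
    · intro k _
      split_ifs <;> first | (exfalso; omega) | simp
    · intro k _
      split_ifs <;> first | (exfalso; omega) | simp

theorem jordanZero_transpose_mul_gammaMat (a : ℕ) :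
    (jordanZero 𝕜 a)ᵀ * gammaMat 𝕜 a = -(gammaMat 𝕜 a * jordanZero 𝕜 a) := by
  have h : gammaMat 𝕜 a * gammaMat 𝕜 a * (jordanZero 𝕜 a)ᵀ * gammaMat 𝕜 a =
      -(gammaMat 𝕜 a * jordanZero 𝕜 a * (gammaMat 𝕜 a * gammaMat 𝕜 a)) := by
    rw [Matrix.mul_assoc (gammaMat 𝕜 a), gammaMat_mul_jordanZero_transpose]
    simp only [Matrix.mul_neg, Matrix.neg_mul, Matrix.mul_assoc]
  have h1 : ((-1 : 𝕜) ^ (a + 1)) ≠ 0 := pow_ne_zero _ (by simp)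
  rw [gammaMat_mul_self, Matrix.smul_mul, Matrix.smul_mul, Matrix.mul_smul, ← smul_neg,
    Matrix.one_mul, Matrix.mul_one] at h
  exact smul_right_injective _ h1 h

theorem stdSkew_transpose (k m : ℕ) (hm : 0 < m) : (stdSkew 𝕜 k m)ᵀ = -stdSkew 𝕜 k m := by
  ext i j
  simp only [Matrix.transpose_apply, Matrix.neg_apply, stdSkew, Matrix.of_apply]
  split_ifs <;> first | (exfalso; omega) | simp

theorem stdSkew_mul_self (m : ℕ) (hm : 0 < m) :
    stdSkew 𝕜 (2 * m) m * stdSkew 𝕜 (2 * m) m = -1 := by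
  ext i j
  rw [Matrix.mul_apply, Matrix.neg_apply, Matrix.one_apply]
  simp only [stdSkew, Matrix.of_apply, Fin.ext_iff]
  by_cases h : (i : ℕ) < m
  · rw [Finset.sum_eq_single (⟨i + m, by omega⟩ : Fin (2 * m))]
    · simp only [if_true]
      split_ifs <;> first | (exfalso; omega) | simp
    · intro k _ hk
      have : ¬ (k : ℕ) = i + m := fun e => hk (Fin.ext e)
      rw [if_neg this, if_neg (by omega), zero_mul]
    · simp
  · rw [Finset.sum_eq_single (⟨i - m, by omega⟩ : Fin (2 * m))]
    · simp only
      split_ifs <;> first | (exfalso; omega) | simp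
    · intro k _ hk
      have : ¬ (i : ℕ) = k + m := fun e => hk (Fin.ext (by simp; omega))
      rw [if_neg (by omega), if_neg this, zero_mul]
    · simp

variable {N : ℕ} (c : ℕ) {α m : Fin N → ℕ}

theorem mult_of_even {c a : ℕ} (h : Even (c + a)) : mult c a = 1 := if_pos h

theorem mult_of_not_even {c a : ℕ} (h : ¬ Even (c + a)) : mult c a = 2 := if_neg h

theorem stdSkew_mu_mul_self (r : Fin N) (hm : 0 < m r) (h : ¬ Even (c + α r)) :
    stdSkew 𝕜 (mu c α m r) (m r) * stdSkew 𝕜 (mu c α m r) (m r) = -1 := by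
  have : ∀ k, k = 2 * m r → stdSkew 𝕜 k (m r) * stdSkew 𝕜 k (m r) = -1 := by
    rintro k rfl
    exact stdSkew_mul_self 𝕜 (m r) hm
  exact this _ (by rw [mu, mult_of_not_even h])

theorem isAdmissible_matB (hα : StrictAnti α) (hα₀ : ∀ r, 0 < α r) (hm : ∀ r, 0 < m r) :
    IsAdmissible c α (matB 𝕜 c α m) where
  pos := hα₀
  anti := hα
  isUnit r := by
    refine (Matrix.isUnit_iff_isUnit_det _).1 ?_
    by_cases h : Even (c + α r)
    · rw [matB, if_pos h]
      exact IsUnit.of_mul_eq_one ((-1 : 𝕜) ^ c • 1) (by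
        rw [Matrix.smul_mul, Matrix.mul_smul, smul_smul, ← mul_pow]; simp)
    · rw [matB, if_neg h]
      exact IsUnit.of_mul_eq_one (-stdSkew 𝕜 _ (m r)) (by
        rw [Matrix.mul_neg, stdSkew_mu_mul_self 𝕜 c r (hm r) h, neg_neg])
  transpose r := by
    by_cases h : Even (c + α r)
    · rw [matB, if_pos h, add_comm, h.neg_one_pow]
      simp
    · rw [matB, if_neg h, add_comm, (Nat.not_even_iff_odd.1 h).neg_one_pow,
        stdSkew_transpose 𝕜 _ _ (hm r), neg_one_smul]

variable {𝕜} {c} in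
theorem smul_form_iff {ι : Type*} [Fintype ι] [DecidableEq ι] {a : 𝕜} (ha : a ≠ 0)
    (B Q : Matrix ι ι 𝕜) : Qᵀ * (a • B) * Q = a • B ↔ Qᵀ * B * Q = B := by
  rw [Matrix.mul_smul, Matrix.smul_mul, (smul_right_injective _ ha).eq_iff]

theorem groupG_eq_formGroup (r : Fin N) : groupG 𝕜 c α m r = formGroup (matB 𝕜 c α m r) := by
  by_cases h : Even (c + α r)
  · rw [groupG, matB, if_pos h, if_pos h]
    ext Q
    exact (smul_form_iff (pow_ne_zero c (neg_ne_zero.2 one_ne_zero)) 1 Q.val).symm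
  · rw [groupG, matB, if_neg h, if_neg h]

theorem groupO_eq_genO : groupO 𝕜 c α m = genO α (matB 𝕜 c α m) := by
  rw [groupO, genO]
  simp only [groupG_eq_formGroup]

theorem hasNoNormalUnipotent_matB {𝕜 : Type*} [Field 𝕜] [CharZero 𝕜] (c : ℕ)
    (hα : StrictAnti α) (hα₀ : ∀ r, 0 < α r) (hm : ∀ r, 0 < m r) (r : Fin N) :
    HasNoNormalUnipotent (matB 𝕜 c α m r) := by
  by_cases h : Even (c + α r)
  · rw [matB, if_pos h]
    intro S h1 h2 h3 h4 h5
    have ha : ((-1 : 𝕜) ^ c) ≠ 0 := pow_ne_zero c (by simp)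
    exact hasNoNormalUnipotent_one S (fun g hg => (smul_form_iff ha 1 g).1 (h1 g hg)) h2 h3 h4
      fun g hg k k' hk => h5 g hg k k' ((smul_form_iff ha 1 k).2 hk)
  · refine hasNoNormalUnipotent_of_skew ?_ ((isAdmissible_matB 𝕜 c hα hα₀ hm).isUnit r)
    rw [matB, if_neg h, stdSkew_transpose 𝕜 _ _ (hm r)]

/-- The factor of the block `r` of `Ψ` that acts on the coordinates of the `b`-th Jordan chain. -/
def psiFactor (a b : ℕ) : Matrix (Fin a) (Fin a) 𝕜 := if b = 0 then 1 else -gammaMat 𝕜 a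

theorem psiBlock_apply (c a m : ℕ) (i : Fin a) (b' : Fin (mult c a)) (j' : Fin m)
    (y : (Fin (mult c a) × Fin a) × Fin m) :
    psiBlock 𝕜 c a m (i, finProdFinEquiv (b', j')) y =
      if b' = y.1.1 ∧ j' = y.2 then psiFactor 𝕜 a b' i y.1.2 else 0 := by
  simp only [psiBlock, Matrix.of_apply, EmbeddingLike.apply_eq_iff_eq, Prod.mk.injEq, psiFactor]
  by_cases h : b' = y.1.1 ∧ j' = y.2
  · rw [if_pos h, if_pos h, h.1]
    split_ifs <;> rfl
  · rw [if_neg h, if_neg h]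

theorem psiBlock_mul_apply (c a m : ℕ) (i : Fin a) (b' : Fin (mult c a)) (j' : Fin m)
    (M : Matrix (Fin (mult c a) × Fin a) (Fin (mult c a) × Fin a) 𝕜)
    (y : (Fin (mult c a) × Fin a) × Fin m) :
    (psiBlock 𝕜 c a m * Matrix.blockDiagonal fun _ : Fin m => M) (i, finProdFinEquiv (b', j')) y =
      if j' = y.2 then ∑ k, psiFactor 𝕜 a b' i k * M (b', k) y.1 else 0 := by
  rw [Matrix.mul_apply]
  simp only [psiBlock_apply, Fintype.sum_prod_type, Matrix.blockDiagonal_apply]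
  rw [Finset.sum_eq_single b' _ (by simp)]
  · by_cases h : j' = y.2
    · rw [if_pos h]
      refine Finset.sum_congr rfl fun k _ => ?_
      rw [Finset.sum_eq_single j' _ (by simp)]
      · simp [h]
      · intro x _ hx
        simp [Ne.symm hx]
    · rw [if_neg h]
      refine Finset.sum_eq_zero fun k _ => Finset.sum_eq_zero fun x _ => ?_
      by_cases hx : j' = x
      · rw [if_neg (c := x = y.2) (fun e => h (hx.trans e)), mul_zero]
      · simp [hx]
  · intro b _ hb
    simp [Ne.symm hb]

theorem kronecker_mul_psiBlock_apply (c a m : ℕ) (i : Fin a) (q : Fin (mult c a * m))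
    (M : Matrix (Fin a) (Fin a) 𝕜) (B : Matrix (Fin (mult c a * m)) (Fin (mult c a * m)) 𝕜)
    (y : (Fin (mult c a) × Fin a) × Fin m) :
    ((M ⊗ₖ B) * psiBlock 𝕜 c a m) (i, q) y =
      B q (finProdFinEquiv (y.1.1, y.2)) * (M * psiFactor 𝕜 a y.1.1) i y.1.2 := by
  rw [Matrix.mul_apply, Fintype.sum_prod_type, Matrix.mul_apply, Finset.mul_sum]
  refine Finset.sum_congr rfl fun k _ => ?_
  rw [← finProdFinEquiv.sum_comp, Finset.sum_eq_single (y.1.1, y.2) _ (by simp)]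
  · rw [psiBlock_apply, if_pos ⟨rfl, rfl⟩, kroneckerMap_apply]
    ring
  · rintro ⟨b, j⟩ _ hb
    rw [psiBlock_apply, if_neg, mul_zero]
    rintro ⟨rfl, rfl⟩
    exact hb rfl

/-- `Ψ` carries `𝒜` to a direct sum of Jordan blocks with multiplicities: `-Γ` intertwines
`-J_a(0)ᵀ` with `J_a(0)`, and `Π` collects equal positions in the chains. -/
theorem psi_mul_matA : psi 𝕜 c α m * matA 𝕜 c α m = shiftT 𝕜 α (mu c α m) * psi 𝕜 c α m := by
  rw [psi, matA, shiftT, ← Matrix.blockDiagonal'_mul, ← Matrix.blockDiagonal'_mul]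
  congr 1
  funext r
  ext ⟨i, q⟩ y
  obtain ⟨⟨b', j'⟩, rfl⟩ := finProdFinEquiv.surjective q
  rw [psiBlock_mul_apply, kronecker_mul_psiBlock_apply, Matrix.one_apply]
  simp only [EmbeddingLike.apply_eq_iff_eq, Prod.mk.injEq]
  by_cases hj : j' = y.2
  · by_cases hb : b' = y.1.1
    · rw [if_pos hj, if_pos ⟨hb, hj⟩, one_mul, hb]
      simp only [blockA, Matrix.of_apply, if_true, psiFactor]
      by_cases h0 : (y.1.1 : ℕ) = 0
      · simp [h0, Matrix.one_apply]
      · simp only [h0, if_false]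
        rw [Matrix.mul_neg, ← gammaMat_mul_jordanZero_transpose, Matrix.mul_apply]
        simp
    · simp [hj, hb, blockA]
  · simp [hj]

/-- `Ψ` carries `H` to the form `⨁_r (-1)^{α_r} Γ ⊗ B_r`. -/
theorem psi_mul_matH :
    psi 𝕜 c α m * matH 𝕜 c α m = formT α (matB 𝕜 c α m) * psi 𝕜 c α m := by
  rw [psi, matH, formT, ← Matrix.blockDiagonal'_mul, ← Matrix.blockDiagonal'_mul]
  congr 1
  funext r
  ext ⟨i, q⟩ y
  obtain ⟨⟨b', j'⟩, rfl⟩ := finProdFinEquiv.surjective q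
  rw [psiBlock_mul_apply, Matrix.smul_mul, Matrix.smul_apply, kronecker_mul_psiBlock_apply]
  by_cases h : Even (c + α r)
  · have hb : ∀ b : Fin (mult c (α r)), (b : ℕ) = 0 := fun b => by
      have := b.2.trans_eq (mult_of_even h)
      omega
    have hbb : b' = y.1.1 := Fin.ext (by rw [hb, hb])
    simp only [blockH, matB, h, if_true, Matrix.of_apply, psiFactor, hb, Matrix.smul_apply,
      Matrix.one_apply, EmbeddingLike.apply_eq_iff_eq, Prod.mk.injEq, hbb, true_and, Matrix.mul_one]
    by_cases hj : j' = y.2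
    · have : (-1 : 𝕜) ^ α r * ((-1) ^ c * gammaMat 𝕜 (α r) i y.1.2) = gammaMat 𝕜 (α r) i y.1.2 := by
        rw [← _root_.mul_assoc, ← pow_add, add_comm, h.neg_one_pow, one_mul]
      simp [hj, this]
    · simp [hj]
  · have hb : ∀ b : Fin (mult c (α r)), (b : ℕ) < 2 := fun b =>
      b.2.trans_eq (mult_of_not_even h)
    have hodd := Nat.not_even_iff_odd.1 h
    have hval : ∀ (b : Fin (mult c (α r))) (j : Fin (m r)),
        ((finProdFinEquiv (b, j) : Fin (mult c (α r) * m r)) : ℕ) = j + m r * b := fun _ _ => rfl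
    have h1 := hb b'
    have h2 := hb y.1.1
    -- The skew form `B_r` pairs the first `m_r` coordinates with the last `m_r` ones.
    have hB : matB 𝕜 c α m r (finProdFinEquiv (b', j')) (finProdFinEquiv (y.1.1, y.2)) =
        if j' = y.2 then (if (b' : ℕ) = y.1.1 then 0 else if (b' : ℕ) = 0 then 1 else -1)
          else 0 := by
      have e1 := j'.2
      have e2 := y.2.2
      simp only [matB, h, if_false, stdSkew, Matrix.of_apply, hval, Fin.ext_iff]
      obtain h3 | h3 : (b' : ℕ) = 0 ∨ (b' : ℕ) = 1 := by omega
      all_goals obtain h4 | h4 : (y.1.1 : ℕ) = 0 ∨ (y.1.1 : ℕ) = 1 := by omega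
      all_goals
        rw [h3, h4]
        split_ifs <;> first | (exfalso; omega) | rfl
    -- The sign of the upper right block: `(-1)^{α_r} Γ (-Γ) = 1`, because `Γ² = (-1)^{α_r + 1}`.
    have hsq : (-1 : 𝕜) ^ α r * (-1 : 𝕜) ^ (α r + 1) = -1 := by
      rw [← pow_add, show α r + (α r + 1) = 2 * α r + 1 by ring, pow_succ, pow_mul]
      simp
    rw [hB]
    by_cases hj : j' = y.2
    · simp only [hj, if_true, blockH, h, if_false, Matrix.of_apply]
      by_cases hbb : b' = y.1.1
      · simp [hbb]
      · have hbb' : ¬ (b' : ℕ) = y.1.1 := fun e => hbb (Fin.ext e)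
        by_cases h0 : (b' : ℕ) = 0
        · have h3 : (y.1.1 : ℕ) ≠ 0 := by omega
          simp only [hbb, h0, h3, if_false, if_true, psiFactor, Matrix.mul_neg, gammaMat_mul_self,
            Ne.symm h3]
          rw [one_mul, Matrix.neg_apply, Matrix.smul_apply, smul_eq_mul, smul_eq_mul, mul_neg,
            ← _root_.mul_assoc, hsq, neg_one_mul, neg_neg]
          simp [Matrix.one_apply]
        · have h3 : (y.1.1 : ℕ) = 0 := by omega
          have hs : (-1 : 𝕜) ^ (c + 1) = (-1) ^ α r := by
            have h4 : (-1 : 𝕜) ^ c * (-1) ^ α r = -1 := by rw [← pow_add, hodd.neg_one_pow]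
            have h5 : (-1 : 𝕜) ^ α r * (-1) ^ α r = 1 := by rw [← mul_pow]; simp
            linear_combination (-(-1 : 𝕜) ^ α r) * h4 + (-1 : 𝕜) ^ c * h5
          simp only [hbb, h0, h3, if_false, if_true, psiFactor, Matrix.mul_one, hs]
          simp [Matrix.one_apply, mul_comm]
    · simp [hj]

end Psi

section PsiConj

variable {𝕜 : Type*} [Field 𝕜] {N : ℕ} {c : ℕ} {α m : Fin N → ℕ}

theorem psi_conj_matA : psi 𝕜 c α m * matA 𝕜 c α m * (psi 𝕜 c α m)ᵀ = shiftT 𝕜 α (mu c α m) := by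
  rw [psi_mul_matA, Matrix.mul_assoc, psi_mul_transpose, Matrix.mul_one]

theorem psi_conj_matH :
    psi 𝕜 c α m * matH 𝕜 c α m * (psi 𝕜 c α m)ᵀ = formT α (matB 𝕜 c α m) := by
  rw [psi_mul_matH, Matrix.mul_assoc, psi_mul_transpose, Matrix.mul_one]

theorem psi_conj_injective :
    Function.Injective fun M : Matrix (NIdx c α m) (NIdx c α m) 𝕜 =>
      psi 𝕜 c α m * M * (psi 𝕜 c α m)ᵀ := by
  have key : ∀ M : Matrix (NIdx c α m) (NIdx c α m) 𝕜,
      (psi 𝕜 c α m)ᵀ * (psi 𝕜 c α m * M * (psi 𝕜 c α m)ᵀ) * psi 𝕜 c α m = M := by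
    intro M
    calc _ = ((psi 𝕜 c α m)ᵀ * psi 𝕜 c α m) * M * ((psi 𝕜 c α m)ᵀ * psi 𝕜 c α m) := by
          simp only [Matrix.mul_assoc]
      _ = M := by rw [transpose_mul_psi, Matrix.one_mul, Matrix.mul_one]
  intro M M' h
  have h' : psi 𝕜 c α m * M * (psi 𝕜 c α m)ᵀ = psi 𝕜 c α m * M' * (psi 𝕜 c α m)ᵀ := h
  rw [← key M, ← key M', h']

theorem psi_conj_mul (M M' : Matrix (NIdx c α m) (NIdx c α m) 𝕜) :
    psi 𝕜 c α m * (M * M') * (psi 𝕜 c α m)ᵀ =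
      (psi 𝕜 c α m * M * (psi 𝕜 c α m)ᵀ) * (psi 𝕜 c α m * M' * (psi 𝕜 c α m)ᵀ) := by
  calc psi 𝕜 c α m * (M * M') * (psi 𝕜 c α m)ᵀ
      = psi 𝕜 c α m * M * ((psi 𝕜 c α m)ᵀ * psi 𝕜 c α m) * M' * (psi 𝕜 c α m)ᵀ := by
        rw [transpose_mul_psi, Matrix.mul_one, Matrix.mul_assoc (psi 𝕜 c α m) M M']
    _ = _ := by simp only [Matrix.mul_assoc]

theorem psi_conj_transpose (M : Matrix (NIdx c α m) (NIdx c α m) 𝕜) :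
    psi 𝕜 c α m * Mᵀ * (psi 𝕜 c α m)ᵀ = (psi 𝕜 c α m * M * (psi 𝕜 c α m)ᵀ)ᵀ := by
  simp only [Matrix.transpose_mul, Matrix.transpose_transpose, Matrix.mul_assoc]

theorem psi_conj_pow (M : Matrix (NIdx c α m) (NIdx c α m) 𝕜) (k : ℕ) :
    psi 𝕜 c α m * M ^ k * (psi 𝕜 c α m)ᵀ = (psi 𝕜 c α m * M * (psi 𝕜 c α m)ᵀ) ^ k := by
  induction k with
  | zero => rw [pow_zero, pow_zero, Matrix.mul_one, psi_mul_transpose]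
  | succ k ih => rw [pow_succ, psi_conj_mul, ih, pow_succ]

theorem psi_conj_eq_zero_iff {M : Matrix (NIdx c α m) (NIdx c α m) 𝕜} :
    psi 𝕜 c α m * M * (psi 𝕜 c α m)ᵀ = 0 ↔ M = 0 := by
  refine ⟨fun h => psi_conj_injective (c := c) (α := α) (m := m) (h.trans ?_), fun h => ?_⟩
  · simp
  · simp [h]

theorem isNilpotent_psi_conj_iff {M : Matrix (NIdx c α m) (NIdx c α m) 𝕜} :
    IsNilpotent (psi 𝕜 c α m * M * (psi 𝕜 c α m)ᵀ) ↔ IsNilpotent M := by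
  simp only [IsNilpotent, ← psi_conj_pow, psi_conj_eq_zero_iff]

theorem isNilpotent_sub_one_conjPsi_iff (g : GeneralLinearGroup (NIdx c α m) 𝕜) :
    IsNilpotent ((g : Matrix (NIdx c α m) (NIdx c α m) 𝕜) - 1) ↔
      IsNilpotent ((conjPsi 𝕜 c α m g : Matrix (TIdx α (mu c α m)) (TIdx α (mu c α m)) 𝕜) - 1) := by
  rw [← isNilpotent_psi_conj_iff]
  have : psi 𝕜 c α m * ((g : Matrix (NIdx c α m) (NIdx c α m) 𝕜) - 1) * (psi 𝕜 c α m)ᵀ =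
      (conjPsi 𝕜 c α m g : Matrix (TIdx α (mu c α m)) (TIdx α (mu c α m)) 𝕜) - 1 := by
    rw [Matrix.mul_sub, Matrix.sub_mul, Matrix.mul_one, psi_mul_transpose]
    rfl
  rw [this]

/-- The isotropy group of `𝒜` is conjugated by `Ψ` to the isotropy group in Toeplitz form. -/
theorem stab_matA_eq_comap :
    stab (formGroup (matH 𝕜 c α m)) (matA 𝕜 c α m) =
      (isoT α (matB 𝕜 c α m)).comap (conjPsi 𝕜 c α m).toMonoidHom := by
  ext Q
  rw [Subgroup.mem_comap, mem_isoT_iff, mem_stab_iff, mem_formGroup_iff]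
  have h : (((conjPsi 𝕜 c α m).toMonoidHom Q : GeneralLinearGroup _ 𝕜) :
      Matrix (TIdx α (mu c α m)) (TIdx α (mu c α m)) 𝕜) =
        psi 𝕜 c α m * Q.val * (psi 𝕜 c α m)ᵀ := rfl
  rw [h, ← psi_conj_transpose, ← psi_conj_matH, ← psi_conj_matA, ← psi_conj_mul, ← psi_conj_mul,
    commute_iff_eq, commute_iff_eq, ← psi_conj_mul, ← psi_conj_mul]
  exact and_congr (psi_conj_injective (c := c) (α := α) (m := m)).eq_iff.symm
    (psi_conj_injective (c := c) (α := α) (m := m)).eq_iff.symm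

theorem raises_shiftT {μ : Fin N → ℕ} : Raises 1 (shiftT 𝕜 α μ) := by
  rintro ⟨r, i, p⟩ ⟨s, i', q⟩ h
  by_cases hrs : r = s
  · subst hrs
    rw [shiftT, Matrix.blockDiagonal'_apply_eq, kroneckerMap_apply, jordanZero] at h
    have h1 : (i : ℕ) + 1 = i' := by
      by_contra h2
      simp [h2] at h
    simp only [ht]
    omega
  · rw [shiftT, Matrix.blockDiagonal'_apply_ne _ _ _ hrs] at h
    exact absurd rfl h

theorem isNilpotent_matA : IsNilpotent (matA 𝕜 c α m) := by
  rw [← isNilpotent_psi_conj_iff, psi_conj_matA]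
  exact raises_shiftT.isNilpotent

theorem isUnit_det_matH (hα : StrictAnti α) (hα₀ : ∀ r, 0 < α r) (hm : ∀ r, 0 < m r) :
    IsUnit (matH 𝕜 c α m).det := by
  refine (Matrix.isUnit_iff_isUnit_det _).1 ?_
  have h := Matrix.mul_nonsing_inv _ (isUnit_det_formT (α := α) (matB 𝕜 c α m)
    (isAdmissible_matB 𝕜 c hα hα₀ hm).isUnit)
  refine IsUnit.of_mul_eq_one ((psi 𝕜 c α m)ᵀ * (formT α (matB 𝕜 c α m))⁻¹ * psi 𝕜 c α m)
    (psi_conj_injective (c := c) (α := α) (m := m) ?_)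
  change psi 𝕜 c α m * _ * (psi 𝕜 c α m)ᵀ = psi 𝕜 c α m * _ * (psi 𝕜 c α m)ᵀ
  rw [psi_conj_mul, psi_conj_matH, Matrix.mul_one, psi_mul_transpose]
  calc _ = formT α (matB 𝕜 c α m) * ((psi 𝕜 c α m * (psi 𝕜 c α m)ᵀ) *
          (formT α (matB 𝕜 c α m))⁻¹ * (psi 𝕜 c α m * (psi 𝕜 c α m)ᵀ)) := by
        simp only [Matrix.mul_assoc]
    _ = 1 := by rw [psi_mul_transpose, Matrix.one_mul, Matrix.mul_one, h]

theorem matH_transpose (hα : StrictAnti α) (hα₀ : ∀ r, 0 < α r) (hm : ∀ r, 0 < m r) :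
    (matH 𝕜 c α m)ᵀ = (-1 : 𝕜) ^ (c + 1) • matH 𝕜 c α m := by
  refine psi_conj_injective (c := c) (α := α) (m := m) ?_
  change psi 𝕜 c α m * _ * (psi 𝕜 c α m)ᵀ = psi 𝕜 c α m * _ * (psi 𝕜 c α m)ᵀ
  rw [psi_conj_transpose, Matrix.mul_smul, Matrix.smul_mul, psi_conj_matH]
  exact formT_transpose _ (isAdmissible_matB 𝕜 c hα hα₀ hm).transpose

theorem shiftT_transpose_mul_formT {μ : Fin N → ℕ}
    (B : ∀ r : Fin N, Matrix (Fin (μ r)) (Fin (μ r)) 𝕜) :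
    (shiftT 𝕜 α μ)ᵀ * formT α B = -(formT α B * shiftT 𝕜 α μ) := by
  rw [shiftT, formT, Matrix.blockDiagonal'_transpose, ← Matrix.blockDiagonal'_mul,
    ← Matrix.blockDiagonal'_mul, ← Matrix.blockDiagonal'_neg]
  congr 1
  funext r
  rw [← Matrix.kroneckerMap_transpose, Matrix.mul_smul, ← Matrix.mul_kronecker_mul,
    jordanZero_transpose_mul_gammaMat, Pi.neg_apply, Matrix.smul_mul, ← Matrix.mul_kronecker_mul,
    Matrix.transpose_one, Matrix.one_mul, Matrix.mul_one, ← smul_neg]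
  congr 1
  ext
  simp

theorem matA_transpose_mul_matH :
    (matA 𝕜 c α m)ᵀ * matH 𝕜 c α m = -(matH 𝕜 c α m * matA 𝕜 c α m) := by
  refine psi_conj_injective (c := c) (α := α) (m := m) ?_
  change psi 𝕜 c α m * _ * (psi 𝕜 c α m)ᵀ = psi 𝕜 c α m * _ * (psi 𝕜 c α m)ᵀ
  rw [psi_conj_mul, psi_conj_transpose, Matrix.mul_neg, Matrix.neg_mul, psi_conj_mul, psi_conj_matA,
    psi_conj_matH]
  exact shiftT_transpose_mul_formT _

end PsiConj

/-! ### The exponential -/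

section Exponential

/-- If `A` is nilpotent, then whatever commutes with a matrix `A + A² p(A)` commutes with `A`: going
down from the highest nonzero power, `Aᵏ` is the `k`-th power of that matrix up to a combination of
higher powers of `A`. -/
theorem commute_of_commute_aeval {𝕜 R : Type*} [Field 𝕜] [Ring R] [Algebra 𝕜 R] {A Q : R}
    (hA : IsNilpotent A) (p : Polynomial 𝕜)
    (h : Commute Q (Polynomial.aeval A (Polynomial.X + Polynomial.X ^ 2 * p))) : Commute Q A := by
  obtain ⟨n, hn⟩ := hA
  have key : ∀ d k : ℕ, n ≤ k + d → Commute Q (A ^ (k + 1)) := by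
    intro d
    induction d with
    | zero =>
      intro k hk
      rw [pow_eq_zero_of_le (by omega) hn]
      exact Commute.zero_right Q
    | succ d ih =>
      intro k hk
      obtain ⟨q, hq⟩ : Polynomial.X ∣ (1 + Polynomial.X * p) ^ (k + 1) - 1 := by
        have := sub_dvd_pow_sub_pow (1 + Polynomial.X * p) 1 (k + 1)
        rw [one_pow, add_sub_cancel_left] at this
        exact (Dvd.intro _ rfl).trans this
      have h1 : (Polynomial.X : Polynomial 𝕜) ^ (k + 1) =
          (Polynomial.X + Polynomial.X ^ 2 * p) ^ (k + 1) - Polynomial.X ^ (k + 2) * q := by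
        rw [show (Polynomial.X + Polynomial.X ^ 2 * p : Polynomial 𝕜) =
          Polynomial.X * (1 + Polynomial.X * p) by ring, mul_pow, sub_eq_iff_eq_add.1 hq]
        ring
      have h2 := congrArg (Polynomial.aeval A) h1
      rw [map_pow, Polynomial.aeval_X, map_sub, map_pow, map_mul, map_pow, Polynomial.aeval_X,
        Polynomial.aeval_eq_sum_range (p := q), Finset.mul_sum] at h2
      rw [h2]
      refine (h.pow_right _).sub_right (Commute.sum_right _ _ _ fun i _ => ?_)
      rw [mul_smul_comm, ← pow_add, show k + 2 + i = k + 1 + i + 1 by ring]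
      exact (ih (k + 1 + i) (by omega)).smul_right _
  simpa using key n 0 (by omega)

variable {ι 𝕜 : Type*} [Fintype ι] [DecidableEq ι] [RCLike 𝕜]

/-- For nilpotent `A` the exponential series is a polynomial `1 + A + A² p(A)`. -/
theorem exp_eq_aeval_of_isNilpotent {A : Matrix ι ι 𝕜} (hA : IsNilpotent A) :
    ∃ p : Polynomial 𝕜, NormedSpace.exp A =
      1 + Polynomial.aeval A (Polynomial.X + Polynomial.X ^ 2 * p) := by
  obtain ⟨n, hn⟩ := hA
  refine ⟨∑ i ∈ Finset.range n, Polynomial.C (((i + 2).factorial : 𝕜)⁻¹) * Polynomial.X ^ i, ?_⟩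
  rw [NormedSpace.exp_eq_tsum 𝕜]
  beta_reduce
  rw [tsum_eq_sum (s := Finset.range (n + 2)) fun k hk => by
    rw [pow_eq_zero_of_le (by simpa using (by simpa using hk : n + 2 ≤ k).trans' (by omega)) hn,
      smul_zero], Finset.sum_range_succ', Finset.sum_range_succ']
  simp only [map_add, map_mul, map_sum, Polynomial.aeval_X, Polynomial.aeval_C, map_pow,
    Finset.mul_sum]
  rw [add_comm, add_comm (∑ _ ∈ _, _)]
  simp only [Nat.factorial, pow_zero, pow_one, zero_add, Nat.cast_one, inv_one, one_smul, mul_one]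
  congr 2
  refine Finset.sum_congr rfl fun i _ => ?_
  rw [show i + 1 + 1 = 2 + i by ring, pow_add, ← Algebra.smul_def, mul_smul_comm]

/-- A nilpotent matrix is a polynomial in its exponential, so both have the same centralizer. -/
theorem commute_exp_iff_of_isNilpotent {A Q : Matrix ι ι 𝕜} (hA : IsNilpotent A) :
    Commute Q (NormedSpace.exp A) ↔ Commute Q A := by
  constructor
  · intro h
    obtain ⟨p, hp⟩ := exp_eq_aeval_of_isNilpotent hA
    rw [hp] at h
    refine commute_of_commute_aeval hA p ?_
    have := h.sub_right (Commute.one_right Q)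
    rwa [add_sub_cancel_left] at this
  · intro h
    obtain ⟨p, hp⟩ := exp_eq_aeval_of_isNilpotent hA
    rw [hp, Polynomial.aeval_eq_sum_range]
    exact (Commute.one_right Q).add_right
      (Commute.sum_right _ _ _ fun i _ => (h.pow_right i).smul_right _)

theorem stab_smul_exp (G : Subgroup (GeneralLinearGroup ι 𝕜)) {A : Matrix ι ι 𝕜}
    (hA : IsNilpotent A) {ε : 𝕜} (hε : ε ≠ 0) :
    stab G (ε • NormedSpace.exp A) = stab G A := by
  ext Q
  rw [mem_stab_iff, mem_stab_iff, ← commute_exp_iff_of_isNilpotent hA]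
  refine and_congr_right fun _ => ⟨fun h => ?_, fun h => h.smul_right ε⟩
  have := h.smul_right ε⁻¹
  rwa [smul_smul, inv_mul_cancel₀ hε, one_smul] at this

/-- The exponential of a matrix that is skew-adjoint with respect to the form is an isometry. -/
theorem exp_preserves {H M : Matrix ι ι 𝕜} (hH : IsUnit H.det) (h : Mᵀ * H = -(H * M)) :
    (NormedSpace.exp M)ᵀ * H * NormedSpace.exp M = H := by
  have h1 : Mᵀ = H * (-M) * H⁻¹ := by
    rw [Matrix.mul_neg, ← h, Matrix.mul_assoc, Matrix.mul_nonsing_inv _ hH, Matrix.mul_one]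
  rw [← Matrix.exp_transpose, h1, Matrix.exp_conj _ _ ((Matrix.isUnit_iff_isUnit_det _).2 hH),
    Matrix.mul_assoc _ H⁻¹, Matrix.nonsing_inv_mul _ hH, Matrix.mul_one, Matrix.mul_assoc,
    ← Matrix.exp_add_of_commute _ _ (Commute.neg_left (Commute.refl M)), neg_add_cancel,
    NormedSpace.exp_zero, Matrix.mul_one]

theorem exists_exp_mem_formGroup {H M : Matrix ι ι 𝕜} (hH : IsUnit H.det)
    (h : Mᵀ * H = -(H * M)) {ε : 𝕜} (hε : ε = 1 ∨ ε = -1) :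
    ∃ g ∈ formGroup H, (g : Matrix ι ι 𝕜) = ε • NormedSpace.exp M := by
  have hε2 : ε * ε = 1 := by rcases hε with rfl | rfl <;> simp
  have hu : IsUnit (ε • NormedSpace.exp M) := by
    refine IsUnit.of_mul_eq_one (ε • NormedSpace.exp (-M)) ?_
    rw [Matrix.smul_mul, Matrix.mul_smul, smul_smul, hε2, one_smul,
      ← Matrix.exp_add_of_commute _ _ (Commute.neg_right (Commute.refl M)), add_neg_cancel,
      NormedSpace.exp_zero]
  obtain ⟨g, hg⟩ := hu
  refine ⟨g, ?_, hg⟩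
  rw [mem_formGroup_iff, hg, Matrix.transpose_smul, Matrix.smul_mul, Matrix.smul_mul,
    Matrix.mul_smul, smul_smul, hε2, one_smul, exp_preserves hH h]

end Exponential

/-! ### The Lie algebra and the dimension -/

section LieAlgebra

variable {ι 𝕜 : Type*} [Fintype ι] [DecidableEq ι]

/-- The matrices that commute with `A` and are skew-adjoint with respect to the form `H`. -/
def lieStab [Field 𝕜] (H A : Matrix ι ι 𝕜) : Submodule 𝕜 (Matrix ι ι 𝕜) where
  carrier := {M | Mᵀ * H = -(H * M) ∧ Commute M A}
  zero_mem' := by simp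
  add_mem' := by
    rintro M M' ⟨h1, h2⟩ ⟨h1', h2'⟩
    refine ⟨?_, h2.add_left h2'⟩
    rw [Matrix.transpose_add, Matrix.add_mul, Matrix.mul_add, h1, h1', neg_add]
  smul_mem' := by
    rintro a M ⟨h1, h2⟩
    refine ⟨?_, h2.smul_left a⟩
    rw [Matrix.transpose_smul, Matrix.smul_mul, Matrix.mul_smul, h1, smul_neg]

theorem mem_lieStab [Field 𝕜] {H A M : Matrix ι ι 𝕜} :
    M ∈ lieStab H A ↔ Mᵀ * H = -(H * M) ∧ Commute M A := Iff.rfl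

variable [RCLike 𝕜]

theorem hasDerivAt_exp_smul (M : Matrix ι ι 𝕜) :
    open scoped Matrix.Norms.Operator in
    HasDerivAt (fun t : ℝ => NormedSpace.exp (t • M)) M 0 := by
  open scoped Matrix.Norms.Operator in
  have h := hasDerivAt_exp_smul_const (𝕂 := ℝ) M 0
  have h1 : NormedSpace.exp ((0 : ℝ) • M) * M = M := by
    rw [zero_smul, NormedSpace.exp_zero, Matrix.one_mul]
  exact h.congr_deriv h1

/-- The Lie algebra of the isotropy group. In one direction the equations that define the group
are differentiated along `exp (t M)` at `t = 0`. -/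
theorem mem_lieStab_iff_exp {H A M : Matrix ι ι 𝕜} (hH : IsUnit H.det) :
    M ∈ lieStab H A ↔ ∀ t : ℝ, ∃ g ∈ stab (formGroup H) A,
      (g : Matrix ι ι 𝕜) = NormedSpace.exp ((t : 𝕜) • M) := by
  constructor
  · rintro h t
    obtain ⟨h1, h2⟩ := (lieStab H A).smul_mem (t : 𝕜) h
    obtain ⟨g, hg⟩ := Matrix.isUnit_exp ((t : 𝕜) • M)
    refine ⟨g, mem_stab_iff.2 ⟨?_, ?_⟩, hg⟩
    · rw [mem_formGroup_iff, hg]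
      exact exp_preserves hH h1
    · rw [hg]
      open scoped Matrix.Norms.Operator in exact h2.exp_left
  · intro h
    open scoped Matrix.Norms.Operator in
    have hE : ∀ t : ℝ, (NormedSpace.exp (t • M))ᵀ * H * NormedSpace.exp (t • M) = H ∧
        Commute (NormedSpace.exp (t • M)) A := by
      intro t
      obtain ⟨g, hg, hg'⟩ := h t
      rw [RCLike.real_smul_eq_coe_smul (K := 𝕜), ← hg']
      exact mem_stab_iff.1 hg
    have hd := hasDerivAt_exp_smul M
    have hd' := hasDerivAt_exp_smul Mᵀ
    refine ⟨?_, ?_⟩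
    · have h1 := (hd'.mul_const H).mul hd
      have h2 : (fun t : ℝ => NormedSpace.exp (t • Mᵀ) * H * NormedSpace.exp (t • M)) =
          fun _ => H := by
        funext t
        rw [← Matrix.transpose_smul, Matrix.exp_transpose]
        exact (hE t).1
      have h3 := h1.unique ((hasDerivAt_const (0 : ℝ) H).congr_of_eventuallyEq
        (Filter.Eventually.of_forall fun t => congrFun h2 t))
      simp only [zero_smul, NormedSpace.exp_zero, Matrix.mul_one, Matrix.one_mul] at h3
      exact eq_neg_of_add_eq_zero_left h3
    · have h1 := hd.mul_const A
      have h2 := hd.const_mul A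
      exact h1.unique (h2.congr_of_eventuallyEq
        (Filter.Eventually.of_forall fun t => (hE t).2.eq))

/-- The isotropy group is given by polynomial equations. -/
theorem isClosed_stab (H A : Matrix ι ι 𝕜) :
    IsClosed (stab (formGroup H) A : Set (GeneralLinearGroup ι 𝕜)) := by
  have h : (stab (formGroup H) A : Set (GeneralLinearGroup ι 𝕜)) =
      {Q : GeneralLinearGroup ι 𝕜 | (Q : Matrix ι ι 𝕜)ᵀ * H * (Q : Matrix ι ι 𝕜) = H} ∩
        {Q : GeneralLinearGroup ι 𝕜 | (Q : Matrix ι ι 𝕜) * A = A * (Q : Matrix ι ι 𝕜)} := by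
    ext Q
    exact mem_stab_iff
  have hc : Continuous fun Q : GeneralLinearGroup ι 𝕜 => (Q : Matrix ι ι 𝕜) :=
    Units.continuous_val
  rw [h]
  exact (isClosed_eq ((hc.matrix_transpose.matrix_mul continuous_const).matrix_mul hc)
    continuous_const).inter (isClosed_eq (hc.matrix_mul continuous_const)
      (continuous_const.matrix_mul hc))

theorem hasDimension_stab {H : Matrix ι ι 𝕜} (A : Matrix ι ι 𝕜) (hH : IsUnit H.det) :
    HasDimension (stab (formGroup H) A) (Module.finrank 𝕜 (lieStab H A)) :=
  ⟨isClosed_stab H A, lieStab H A, fun _ => mem_lieStab_iff_exp hH, rfl⟩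

end LieAlgebra

section Symmetric

variable (𝕜 : Type*) [Field 𝕜] (n : ℕ)

/-- The matrices `S` with `Sᵀ = σ S`. -/
def signedSymm (σ : 𝕜) : Submodule 𝕜 (Matrix (Fin n) (Fin n) 𝕜) where
  carrier := {S | Sᵀ = σ • S}
  zero_mem' := by simp
  add_mem' := by
    intro S S' (h : Sᵀ = _) (h' : S'ᵀ = _)
    change (S + S')ᵀ = _
    rw [Matrix.transpose_add, h, h', smul_add]
  smul_mem' := by
    intro a S (h : Sᵀ = _)
    change (a • S)ᵀ = _
    rw [Matrix.transpose_smul, h, smul_comm]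

variable {𝕜 n} in
theorem mem_signedSymm {σ : 𝕜} {S : Matrix (Fin n) (Fin n) 𝕜} :
    S ∈ signedSymm 𝕜 n σ ↔ Sᵀ = σ • S := Iff.rfl

/-- Symmetric matrices are functions on unordered pairs. -/
def signedSymmEquiv : signedSymm 𝕜 n 1 ≃ₗ[𝕜] (Sym2 (Fin n) → 𝕜) where
  toFun S := Sym2.lift ⟨fun i j => S.1 i j, fun i j => by
    have h : S.1ᵀ = (1 : 𝕜) • S.1 := S.2
    rw [one_smul] at h
    exact congrFun (congrFun h j) i⟩
  map_add' S S' := by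
    funext z
    induction z with | h i j => rfl
  map_smul' a S := by
    funext z
    induction z with | h i j => rfl
  invFun f := ⟨Matrix.of fun i j => f s(i, j), by
    rw [mem_signedSymm, one_smul]
    ext i j
    exact congrArg f Sym2.eq_swap⟩
  left_inv S := rfl
  right_inv f := by
    funext z
    induction z with | h i j => rfl

theorem isCompl_signedSymm [CharZero 𝕜] : IsCompl (signedSymm 𝕜 n 1) (signedSymm 𝕜 n (-1)) := by
  constructor
  · rw [Submodule.disjoint_def]
    intro S h h'
    rw [mem_signedSymm] at h h'
    rw [h, one_smul, neg_one_smul] at h'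
    ext i j
    exact self_eq_neg.1 (congrFun (congrFun h' i) j)
  · rw [codisjoint_iff, Submodule.eq_top_iff']
    intro S
    refine Submodule.mem_sup.2 ⟨(1 / 2 : 𝕜) • (S + Sᵀ), ?_, (1 / 2 : 𝕜) • (S - Sᵀ), ?_, ?_⟩
    · rw [mem_signedSymm, Matrix.transpose_smul, Matrix.transpose_add, Matrix.transpose_transpose,
        one_smul, add_comm]
    · rw [mem_signedSymm, Matrix.transpose_smul, Matrix.transpose_sub, Matrix.transpose_transpose,
        neg_one_smul, ← smul_neg, neg_sub]
    · rw [← smul_add, add_add_sub_cancel, ← two_smul 𝕜 S, smul_smul]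
      norm_num

/-- The symmetric matrices have dimension `n (n + 1) / 2` and the skew-symmetric ones `n (n - 1) /
2`. -/
theorem two_mul_finrank_signedSymm [CharZero 𝕜] (k : ℕ) :
    (2 * Module.finrank 𝕜 (signedSymm 𝕜 n ((-1) ^ k)) : ℚ) = n ^ 2 + (-1) ^ k * n := by
  have h1 : (2 * Module.finrank 𝕜 (signedSymm 𝕜 n 1) : ℚ) = n ^ 2 + n := by
    rw [(signedSymmEquiv 𝕜 n).finrank_eq, Module.finrank_fintype_fun_eq_card, Sym2.card,
      Fintype.card_fin, Nat.cast_choose_two]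
    push_cast
    ring
  have h2 := Submodule.finrank_add_eq_of_isCompl (isCompl_signedSymm 𝕜 n)
  rw [Module.finrank_matrix, Module.finrank_self, Fintype.card_fin, mul_one] at h2
  have h3 := congrArg (Nat.cast : ℕ → ℚ) h2
  push_cast at h3
  rcases Nat.even_or_odd k with hk | hk
  · rw [hk.neg_one_pow, hk.neg_one_pow, h1]
    ring
  · rw [hk.neg_one_pow, hk.neg_one_pow]
    linarith

end Symmetric

section Dimension

variable {𝕜 : Type*} [Field 𝕜] {N : ℕ} {α μ : Fin N → ℕ}
variable {B : ∀ r : Fin N, Matrix (Fin (μ r)) (Fin (μ r)) 𝕜} {c : ℕ}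

/-- A Toeplitz block matrix lies in the Lie algebra if and only if its coefficients are skew-
adjoint. -/
theorem IsAdmissible.toeplitz_mem_lieStab_iff (h : IsAdmissible c α B) (A : Coeffs 𝕜 μ) :
    toeplitz α A ∈ lieStab (formT α B) (shiftT 𝕜 α μ) ↔
      ∀ r s j, j < min (α r) (α s) → adjC B α A r s j = -A r s j := by
  have hu := (Matrix.isUnit_iff_isUnit_det _).2 (isUnit_det_formT (α := α) B h.isUnit)
  rw [mem_lieStab, transpose_toeplitz_mul_formT B h.isUnit, ← Matrix.mul_neg,
    and_iff_left (toeplitz_commute_shiftT A), hu.mul_right_inj]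
  have hneg : -toeplitz α A = toeplitz α (fun r s j => -A r s j) := by
    refine ext_blk fun r i s i' => ?_
    have : blk (-toeplitz α A) r i s i' = -blk (toeplitz α A) r i s i' := rfl
    rw [this, blk_toeplitz, blk_toeplitz]
    split_ifs <;> simp
  rw [hneg]
  constructor
  · intro h1 r s j hj
    have h2 := congrArg (fun M => matCoeff M r s j) h1
    simpa only [matCoeff_toeplitz, hj, if_true] using h2
  · exact fun h1 => toeplitz_congr h1

theorem IsAdmissible.adjC_adjC (h : IsAdmissible c α B) (A : Coeffs 𝕜 μ) (r s : Fin N) (j : ℕ) :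
    adjC B α (adjC B α A) r s j = A r s j := by
  have h1 : ((B s)⁻¹)ᵀ * B s = (-1 : 𝕜) ^ (α s + c) • 1 := by
    have h2 := congrArg Matrix.transpose (h.transpose s)
    rw [Matrix.transpose_transpose, Matrix.transpose_smul] at h2
    refine (congrArg (((B s)⁻¹)ᵀ * ·) h2).trans ?_
    rw [Matrix.mul_smul, ← Matrix.transpose_mul, Matrix.mul_nonsing_inv _ (h.isUnit s),
      Matrix.transpose_one]
  have h3 : (B r)⁻¹ * (B r)ᵀ = (-1 : 𝕜) ^ (α r + c) • 1 := by
    rw [h.transpose r, Matrix.mul_smul, Matrix.nonsing_inv_mul _ (h.isUnit r)]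
  have h4 : (-1 : 𝕜) ^ (j + (α s - α r)) * (-1) ^ (j + (α r - α s)) *
      ((-1) ^ (α r + c) * (-1) ^ (α s + c)) = 1 := by
    rw [← pow_add, ← pow_add, ← pow_add, Even.neg_one_pow]
    rcases le_total (α r) (α s) with h5 | h5
    · exact ⟨j + α s + c, by omega⟩
    · exact ⟨j + α r + c, by omega⟩
  calc adjC B α (adjC B α A) r s j
      = ((-1 : 𝕜) ^ (j + (α s - α r)) * (-1) ^ (j + (α r - α s))) •
          (((B r)⁻¹ * (B r)ᵀ) * A r s j * (((B s)⁻¹)ᵀ * B s)) := by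
        simp only [adjC, Matrix.transpose_smul, Matrix.transpose_mul, Matrix.transpose_transpose,
          Matrix.mul_smul, Matrix.smul_mul, smul_smul, Matrix.mul_assoc]
    _ = A r s j := by
        rw [h1, h3, Matrix.smul_mul, Matrix.smul_mul, Matrix.mul_smul, smul_smul, smul_smul,
          Matrix.one_mul, Matrix.mul_one]
        rw [← _root_.mul_assoc] at h4
        rw [h4, one_smul]

/-- The skew-adjointness of a coefficient above the diagonal is that of its mirror image. -/
theorem IsAdmissible.adjC_eq_neg_symm (h : IsAdmissible c α B) {A : Coeffs 𝕜 μ} {r s : Fin N}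
    {j : ℕ} (hrs : adjC B α A r s j = -A r s j) : adjC B α A s r j = -A s r j := by
  rw [← h.adjC_adjC A s r j]
  simp only [adjC] at hrs ⊢
  rw [hrs]
  simp

theorem IsAdmissible.adjC_diag_eq_neg_iff (h : IsAdmissible c α B) {A : Coeffs 𝕜 μ} {r : Fin N}
    {j : ℕ} : adjC B α A r r j = -A r r j ↔
      B r * A r r j ∈ signedSymm 𝕜 (μ r) ((-1) ^ (α r + c + j + 1)) := by
  have hu := (Matrix.isUnit_iff_isUnit_det _).2 (h.isUnit r)
  have hne : (-1 : 𝕜) ^ (α r + c + j) ≠ 0 := pow_ne_zero _ (by simp)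
  have hsq : (-1 : 𝕜) ^ (α r + c + j) * (-1) ^ j = (-1) ^ (α r + c) := by
    rw [← pow_add, show α r + c + j + j = α r + c + 2 * j by ring, pow_add _ _ (2 * j), pow_mul]
    simp
  rw [mem_signedSymm, Matrix.transpose_mul, h.transpose r, ← hu.mul_right_inj,
    ← (smul_right_injective _ hne).eq_iff]
  simp only [adjC, Nat.sub_self, add_zero, Matrix.mul_smul, Matrix.mul_neg, smul_smul, hsq,
    pow_succ _ (α r + c + j)]
  rw [← Matrix.mul_assoc, Matrix.mul_nonsing_inv_cancel_left _ _ (h.isUnit r)]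
  simp

variable (B) in
/-- The coordinates on the Lie algebra: the coefficients below the diagonal and the products
`B_r A_j^{rr}`. -/
def lieCoord (h : IsAdmissible c α B) : lieStab (formT α B) (shiftT 𝕜 α μ) →ₗ[𝕜]
    (∀ r : Fin N, ∀ s : {s : Fin N // s < r}, Fin (α r) → Matrix (Fin (μ r)) (Fin (μ s)) 𝕜) ×
      (∀ r : Fin N, ∀ j : Fin (α r), signedSymm 𝕜 (μ r) ((-1) ^ (α r + c + j + 1))) where
  toFun M := (fun r s j => matCoeff M.1 r s j, fun r j => ⟨B r * matCoeff M.1 r r j, by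
    have h1 := M.2
    rw [← toeplitz_matCoeff_of_commute (mem_lieStab.1 M.2).2, h.toeplitz_mem_lieStab_iff] at h1
    exact h.adjC_diag_eq_neg_iff.1 (h1 r r j (by simp))⟩)
  map_add' M M' := by
    simp only [Submodule.coe_add, matCoeff_add, Pi.add_apply, Matrix.mul_add]
    rfl
  map_smul' a M := by
    simp only [Submodule.coe_smul, matCoeff_smul, Pi.smul_apply, Matrix.mul_smul]
    rfl

/-- Skew-adjointness determines the coefficients above the diagonal by those below, and it
restricts a diagonal coefficient to a space of symmetric or skew-symmetric matrices. -/
theorem lieCoord_bijective (h : IsAdmissible c α B) : Function.Bijective (lieCoord B h) := by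
  constructor
  · rw [← LinearMap.ker_eq_bot, LinearMap.ker_eq_bot']
    rintro ⟨M, hM⟩ h0
    have hT := toeplitz_matCoeff_of_commute (mem_lieStab.1 hM).2
    have hsk := hM
    rw [← hT, h.toeplitz_mem_lieStab_iff] at hsk
    have hlow : ∀ r s j, s < r → matCoeff M r s j = 0 := by
      intro r s j hrs
      by_cases hj : j < α r
      · exact congrFun (congrFun (congrFun (congrArg Prod.fst h0) r) ⟨s, hrs⟩) ⟨j, hj⟩
      · exact matCoeff_of_le M ((min_le_left _ _).trans (not_lt.1 hj))
    have hall : ∀ r s j, j < min (α r) (α s) → matCoeff M r s j = 0 := by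
      intro r s j hj
      rcases lt_trichotomy r s with hrs | rfl | hrs
      · have := hsk r s j hj
        rw [adjC, hlow s r j hrs] at this
        simpa [eq_comm] using this
      · have h1 : B r * matCoeff M r r j = 0 := congrArg Subtype.val
          (congrFun (congrFun (congrArg Prod.snd h0) r) ⟨j, hj.trans_le (min_le_left _ _)⟩)
        rw [← Matrix.nonsing_inv_mul_cancel_left _ (matCoeff M r r j) (h.isUnit r), h1,
          Matrix.mul_zero]
      · exact hlow r s j hrs
    refine Subtype.ext ?_
    change M = 0
    rw [← hT, toeplitz_congr (A' := fun _ _ _ => 0) hall]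
    ext
    simp [toeplitz]
  · rintro ⟨L, S⟩
    let A₀ : Coeffs 𝕜 μ := fun r s j =>
      if hsr : s < r then if hj : j < α r then L r ⟨s, hsr⟩ ⟨j, hj⟩ else 0 else 0
    let A : Coeffs 𝕜 μ := fun r s j =>
      if s < r then A₀ r s j
      else if hrs : r = s then
        hrs ▸ if hj : j < α r then (B r)⁻¹ * (S r ⟨j, hj⟩ : Matrix (Fin (μ r)) (Fin (μ r)) 𝕜) else 0
      else -adjC B α A₀ r s j
    have hlow : ∀ r s j, s < r → A r s j = A₀ r s j := fun r s j hrs => if_pos hrs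
    have hdiag : ∀ r j (hj : j < α r), B r * A r r j = S r ⟨j, hj⟩ := by
      intro r j hj
      simp only [A, lt_irrefl, if_false, dif_pos, hj]
      exact Matrix.mul_nonsing_inv_cancel_left _ _ (h.isUnit r)
    have hup : ∀ r s j, r < s → A r s j = -adjC B α A r s j := by
      intro r s j hrs
      simp only [adjC, hlow s r j hrs]
      simp only [A, if_neg hrs.not_gt, dif_neg hrs.ne, adjC]
    have hmem : toeplitz α A ∈ lieStab (formT α B) (shiftT 𝕜 α μ) := by
      rw [h.toeplitz_mem_lieStab_iff]
      intro r s j hj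
      rcases lt_trichotomy r s with hrs | rfl | hrs
      · rw [hup r s j hrs, neg_neg]
      · rw [h.adjC_diag_eq_neg_iff, hdiag r j (by simpa using hj)]
        exact (S r _).2
      · exact h.adjC_eq_neg_symm (by rw [hup s r j hrs, neg_neg])
    refine ⟨⟨_, hmem⟩, Prod.ext ?_ ?_⟩
    · funext r s j
      change matCoeff (toeplitz α A) r s j = L r s j
      have := h.anti s.2
      rw [matCoeff_toeplitz, if_pos (by have := j.2; omega), hlow r s j s.2]
      simp only [A₀, dif_pos s.2, dif_pos j.2]
    · funext r j
      refine Subtype.ext ?_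
      change B r * matCoeff (toeplitz α A) r r j = S r j
      rw [matCoeff_toeplitz, if_pos (by simp), hdiag]

theorem IsAdmissible.finrank_lieStab [CharZero 𝕜] (h : IsAdmissible c α B) :
    (Module.finrank 𝕜 (lieStab (formT α B) (shiftT 𝕜 α μ)) : ℚ) =
      ∑ r, ((1 / 2 : ℚ) * α r * (μ r : ℚ) ^ 2 +
          ∑ s ∈ Finset.univ.filter (fun s => s < r), (α r : ℚ) * μ r * μ s) +
        (-1) ^ c * ∑ r ∈ Finset.univ.filter (fun r => Odd (α r)), (1 / 2 : ℚ) * μ r := by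
  rw [(LinearEquiv.ofBijective _ (lieCoord_bijective h)).finrank_eq, Module.finrank_prod,
    Module.finrank_pi_fintype, Module.finrank_pi_fintype]
  simp only [Module.finrank_pi_fintype]
  have h1 : ∀ r : Fin N, (∑ s : {s : Fin N // s < r}, ∑ _ : Fin (α r),
      Module.finrank 𝕜 (Matrix (Fin (μ r)) (Fin (μ s)) 𝕜) : ℚ) =
        ∑ s ∈ Finset.univ.filter (fun s => s < r), (α r : ℚ) * μ r * μ s := by
    intro r
    rw [← Finset.sum_subtype_eq_sum_filter]
    simp [Module.finrank_matrix, mul_assoc]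
  -- The signs of the diagonal coefficients cancel in pairs, so only the blocks of odd size
  -- contribute to the linear term of the dimension.
  have hsign : ∀ a : ℕ, (∑ j : Fin a, (-1 : ℚ) ^ (a + c + j + 1)) =
      if Odd a then (-1) ^ c else 0 := by
    intro a
    have h3 : ∀ j : ℕ, (-1 : ℚ) ^ (a + c + j + 1) = (-1) ^ (a + c + 1) * (-1) ^ j := fun j => by
      rw [← pow_add]
      congr 1
      ring
    rw [Fin.sum_univ_eq_sum_range (fun j => (-1 : ℚ) ^ (a + c + j + 1))]
    simp only [h3]
    rw [← Finset.mul_sum, neg_one_geom_sum]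
    rcases Nat.even_or_odd a with ha | ha
    · rw [if_pos ha, if_neg (Nat.not_odd_iff_even.2 ha), mul_zero]
    · rw [if_neg (Nat.not_even_iff_odd.2 ha), if_pos ha, add_right_comm, pow_add,
        ha.add_one.neg_one_pow, one_mul, mul_one]
  have h2 : ∀ r : Fin N, (∑ j : Fin (α r),
      Module.finrank 𝕜 (signedSymm 𝕜 (μ r) ((-1) ^ (α r + c + j + 1))) : ℚ) =
        (1 / 2 : ℚ) * α r * (μ r : ℚ) ^ 2 +
          if Odd (α r) then (-1) ^ c * ((1 / 2 : ℚ) * μ r) else 0 := by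
    intro r
    have h3 : (∑ j : Fin (α r),
      (2 * Module.finrank 𝕜 (signedSymm 𝕜 (μ r) ((-1) ^ (α r + c + j + 1))) : ℚ)) =
        α r * (μ r : ℚ) ^ 2 + (if Odd (α r) then (-1) ^ c else 0) * μ r := by
      simp only [two_mul_finrank_signedSymm, Finset.sum_add_distrib, ← Finset.sum_mul, hsign]
      simp
    rw [← Finset.mul_sum] at h3
    split_ifs at h3 ⊢ <;> linarith
  push_cast
  simp only [h1, h2, Finset.sum_add_distrib, ← Finset.sum_filter, ← Finset.mul_sum]
  ring

end Dimension

/-! ### Definite forms -/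

section Definite

variable {N : ℕ} {c : ℕ} {α m : Fin N → ℕ}

theorem matH_eq_one (𝕜 : Type*) [Field 𝕜] (hα : ∀ r, α r = 1) : matH 𝕜 1 α m = 1 := by
  have key : ∀ a, a = 1 → blockH 𝕜 1 a = 1 := by
    rintro a rfl
    ext ⟨b, i⟩ ⟨b', i'⟩
    have hb : b = b' := Fin.ext (by
      have h1 := b.2.trans_eq (mult_of_even (by decide : Even (1 + 1)))
      have h2 := b'.2.trans_eq (mult_of_even (by decide : Even (1 + 1)))
      omega)
    subst hb
    have hi : i = i' := Subsingleton.elim i i'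
    subst hi
    simp [blockH, gammaMat]
  rw [matH, ← Matrix.blockDiagonal'_one]
  congr 1
  funext r
  rw [key _ (hα r)]
  exact Matrix.blockDiagonal_one

theorem eq_one_of_strictAnti (hN : 0 < N) (hα : StrictAnti α) (h : ∀ r, α r = 1) : N = 1 := by
  by_contra hN'
  have h1 : α ⟨1, by omega⟩ < α ⟨0, hN⟩ := hα (by simp [Fin.lt_def])
  rw [h, h] at h1
  exact lt_irrefl _ h1

theorem matA_eq_zero_iff (𝕜 : Type*) [Field 𝕜] (hN : 0 < N) (hα : StrictAnti α)
    (hα₀ : ∀ r, 0 < α r) (hm : ∀ r, 0 < m r) :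
    matA 𝕜 c α m = 0 ↔ N = 1 ∧ ∀ r, α r = 1 := by
  constructor
  · intro h
    have h1 : ∀ r, α r = 1 := by
      intro r
      by_contra hr
      have h2 := hα₀ r
      have hmult : 0 < mult c (α r) := by
        rw [mult]
        split_ifs <;> omega
      have := congrFun (congrFun h ⟨r, (⟨0, hmult⟩, ⟨0, h2⟩), ⟨0, hm r⟩⟩)
        ⟨r, (⟨0, hmult⟩, ⟨1, by omega⟩), ⟨0, hm r⟩⟩
      simp [matA, blockA, jordanZero, Matrix.blockDiagonal_apply] at this
    exact ⟨eq_one_of_strictAnti hN hα h1, h1⟩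
  · rintro ⟨-, h⟩
    ext ⟨r, x, j⟩ ⟨s, y, j'⟩
    have hJ : ∀ (a : ℕ), a = 1 → jordanZero 𝕜 a = 0 := by
      rintro a rfl
      ext i i'
      simp [jordanZero]
    by_cases hrs : r = s
    · subst hrs
      simp [matA, Matrix.blockDiagonal_apply, blockA, hJ _ (h r)]
    · rw [matA, Matrix.blockDiagonal'_apply_ne _ _ _ hrs]
      rfl

/-- A form that is congruent to `± I` is anisotropic. -/
theorem apply_self_ne_zero_of_congruent {ι : Type*} [Fintype ι] [DecidableEq ι]
    {H : Matrix ι ι ℝ} {P : GeneralLinearGroup ι ℝ}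
    (h : P.valᵀ * H * P.val = 1 ∨ P.valᵀ * H * P.val = -1) (e : ι) : H e e ≠ 0 := by
  intro h0
  obtain ⟨σ, hσ, h⟩ : ∃ σ : ℝ, σ ≠ 0 ∧ P.valᵀ * H * P.val = σ • 1 := by
    rcases h with h | h
    · exact ⟨1, one_ne_zero, by rw [h, one_smul]⟩
    · exact ⟨-1, by simp, by rw [h, neg_one_smul]⟩
  have hP : P.val * P⁻¹.val = 1 := P.mul_inv
  have hH : H = σ • ((P⁻¹.val)ᵀ * P⁻¹.val) := by
    calc H = (P.val * P⁻¹.val)ᵀ * H * (P.val * P⁻¹.val) := by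
          rw [hP, Matrix.transpose_one, Matrix.one_mul, Matrix.mul_one]
      _ = (P⁻¹.val)ᵀ * (P.valᵀ * H * P.val) * P⁻¹.val := by
          simp only [Matrix.transpose_mul, Matrix.mul_assoc]
      _ = _ := by rw [h, Matrix.mul_smul, Matrix.smul_mul, Matrix.mul_one]
  rw [hH, Matrix.smul_apply, Matrix.mul_apply, smul_eq_mul, mul_eq_zero, or_iff_right hσ] at h0
  simp only [Matrix.transpose_apply] at h0
  rw [Finset.sum_eq_zero_iff_of_nonneg fun _ _ => mul_self_nonneg _] at h0
  have h1 := congrFun (congrFun hP e) e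
  rw [Matrix.mul_apply, Matrix.one_apply_eq, Finset.sum_eq_zero] at h1
  · exact zero_ne_one h1
  · intro k hk
    rw [mul_self_eq_zero.1 (h0 k hk), mul_zero]

/-- If `c = 2`, the form is alternating, and if some `α_r ≥ 2`, the first vector of a Jordan chain
is isotropic; in both cases the form is not definite. -/
theorem exists_congruent_one_iff (hN : 0 < N) (hα : StrictAnti α) (hα₀ : ∀ r, 0 < α r)
    (hm : ∀ r, 0 < m r) (hc : c = 1 ∨ c = 2) :
    (∃ P : GeneralLinearGroup (NIdx c α m) ℝ,
        P.valᵀ * matH ℝ c α m * P.val = 1 ∨ P.valᵀ * matH ℝ c α m * P.val = -1) ↔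
      c = 1 ∧ N = 1 ∧ ∀ r, α r = 1 := by
  have hmult : ∀ r, 0 < mult c (α r) := by
    intro r
    rw [mult]
    split_ifs <;> omega
  constructor
  · rintro ⟨P, hP⟩
    have hne := apply_self_ne_zero_of_congruent hP
    have hc1 : c = 1 := by
      refine hc.resolve_right ?_
      rintro rfl
      let e : NIdx 2 α m := ⟨⟨0, hN⟩, (⟨0, hmult _⟩, ⟨0, hα₀ _⟩), ⟨0, hm _⟩⟩
      have h1 := congrFun (congrFun (matH_transpose (𝕜 := ℝ) (c := 2) hα hα₀ hm) e) e
      refine hne e (self_eq_neg.1 (h1.trans ?_))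
      simp [pow_succ]
    have h1 : ∀ r, α r = 1 := by
      intro r
      by_contra hr
      have h2 := hα₀ r
      refine hne ⟨r, (⟨0, hmult r⟩, ⟨0, h2⟩), ⟨0, hm r⟩⟩ ?_
      have h3 : ¬ 1 = α r := fun h => hr h.symm
      simp [matH, Matrix.blockDiagonal_apply, blockH, gammaMat, h3]
    exact ⟨hc1, eq_one_of_strictAnti hN hα h1, h1⟩
  · rintro ⟨rfl, -, h⟩
    refine ⟨1, Or.inl ?_⟩
    rw [matH_eq_one ℝ h]
    simp

theorem stab_smul_one {ι 𝕜 : Type*} [Fintype ι] [DecidableEq ι] [Field 𝕜]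
    (G : Subgroup (GeneralLinearGroup ι 𝕜)) (δ : 𝕜) : stab G (δ • 1) = G := by
  ext Q
  rw [mem_stab_iff]
  exact and_iff_left ((Commute.one_right _).smul_right δ)

theorem stab_zero {ι 𝕜 : Type*} [Fintype ι] [DecidableEq ι] [Field 𝕜]
    (G : Subgroup (GeneralLinearGroup ι 𝕜)) : stab G 0 = G := by
  simpa using stab_smul_one G 0

end Definite

end BlockToeplitz

theorem mainTheorem1 {𝕜 : Type*} [RCLike 𝕜] {N : ℕ} (hN : 0 < N) (α m : Fin N → ℕ)
    (hα : StrictAnti α) (hα₀ : ∀ r, 0 < α r) (hm : ∀ r, 0 < m r)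
    (c : ℕ) (hc : c = 1 ∨ c = 2) (ε : 𝕜) (hε : ε = 1 ∨ ε = -1) :
    let 𝒜 := BlockToeplitz.matA 𝕜 c α m
    let H := BlockToeplitz.matH 𝕜 c α m
    let G := BlockToeplitz.formGroup H
    let R := ε • NormedSpace.exp 𝒜
    let C := BlockToeplitz.stab G R
    let μ := BlockToeplitz.mu c α m
    let B := BlockToeplitz.matB 𝕜 c α m
    let Ψ := BlockToeplitz.conjPsi 𝕜 c α m
    let 𝕆 := BlockToeplitz.groupO 𝕜 c α m
    let 𝕌 := BlockToeplitz.groupU 𝕜 c α m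
    let 𝕏 := BlockToeplitz.groupX 𝕜 c α m
    -- the data are as they should be: `G` is an orthogonal (symplectic) group, `𝒜` is
    -- `H`-skew-symmetric (`H`-Hamiltonian), and `R` lies in `G`
    (IsUnit H.det ∧ Hᵀ = (-1 : 𝕜) ^ (c + 1) • H ∧ 𝒜ᵀ * H = -(H * 𝒜) ∧ ∃ g ∈ G, ↑g = R) ∧
    -- the isotropy group and the centralizer coincide
    BlockToeplitz.stab G 𝒜 = C ∧
    -- the semidirect product decomposition
    (∃ L Ru : Subgroup (GeneralLinearGroup (BlockToeplitz.NIdx c α m) 𝕜),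
      BlockToeplitz.IsSemidirect C L Ru ∧ BlockToeplitz.IsReductive L ∧
      BlockToeplitz.IsUnipotentRadical C Ru ∧
      L.map Ψ.toMonoidHom = 𝕆 ∧ Ru.map Ψ.toMonoidHom = 𝕌) ∧
    -- the conjugate of the centralizer
    C.map Ψ.toMonoidHom = 𝕏 ∧
    (𝕏 : Set (GeneralLinearGroup (BlockToeplitz.TIdx α μ) 𝕜)) ⊆
      BlockToeplitz.toeplitzSet 𝕜 α μ ∧
    BlockToeplitz.IsSemidirect 𝕏 𝕆 𝕌 ∧
    -- the matrices generating `𝕌` exist for every choice of the parameters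
    (∀ Z, BlockToeplitz.HasSign c α Z → ∃ X ∈ 𝕌, BlockToeplitz.IsDiagGen B Z X) ∧
    (∀ p t k F, p < t → k < α t → ∃ X ∈ 𝕌, BlockToeplitz.IsOffDiagGen B p t k F X) ∧
    -- conditions (I), (II), (III)
    BlockToeplitz.SatisfiesConditions c B
      (𝕏 : Set (GeneralLinearGroup (BlockToeplitz.TIdx α μ) 𝕜)) ∧
    -- the algorithm: every coefficient is given by a formula in the coefficients that precede it,
    -- and the outputs of the algorithm are exactly the elements of `𝕏`
    (∀ (A A' : BlockToeplitz.Coeffs 𝕜 μ) (r s : Fin N) (j : ℕ), r ≤ s →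
      (∀ r' s' j', BlockToeplitz.Precedes r' s' j' r s j → A r' s' j' = A' r' s' j') →
      BlockToeplitz.remainder α B A r s j = BlockToeplitz.remainder α B A' r s j) ∧
    (∀ X : GeneralLinearGroup (BlockToeplitz.TIdx α μ) 𝕜, X ∈ 𝕏 ↔
      X ∈ BlockToeplitz.toeplitzSet 𝕜 α μ ∧
      (∀ r, (BlockToeplitz.coeff X r r 0)ᵀ * B r * BlockToeplitz.coeff X r r 0 = B r) ∧
      ∃ Z, BlockToeplitz.HasSign c α Z ∧
        BlockToeplitz.IsComputed α B Z (BlockToeplitz.coeff X)) ∧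
    -- the dimension
    (∃ d : ℕ, BlockToeplitz.HasDimension 𝕏 d ∧
      (d : ℚ) = ∑ r, ((1 / 2 : ℚ) * α r * (μ r : ℚ) ^ 2 +
          ∑ s ∈ Finset.univ.filter (fun s => s < r), (α r : ℚ) * μ r * μ s) +
        (-1) ^ c * ∑ r ∈ Finset.univ.filter (fun r => Odd (α r)), (1 / 2 : ℚ) * μ r) ∧
    -- the real case: when `H` is congruent to `± I`
    ((∃ P : GeneralLinearGroup (BlockToeplitz.NIdx c α m) ℝ,
        P.valᵀ * BlockToeplitz.matH ℝ c α m * P.val = 1 ∨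
        P.valᵀ * BlockToeplitz.matH ℝ c α m * P.val = -1) ↔
      c = 1 ∧ N = 1 ∧ ∀ r, α r = 1) ∧
    (BlockToeplitz.matA ℝ c α m = 0 ↔ N = 1 ∧ ∀ r, α r = 1) ∧
    (c = 1 → N = 1 → (∀ r, α r = 1) →
      BlockToeplitz.formGroup (BlockToeplitz.matH ℝ c α m) = BlockToeplitz.formGroup 1 ∧
      BlockToeplitz.matA ℝ c α m = 0 ∧
      ∀ δ : ℝ, δ = 1 ∨ δ = -1 →
        δ • NormedSpace.exp (BlockToeplitz.matA ℝ c α m) = δ • 1 ∧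
        BlockToeplitz.stab (BlockToeplitz.formGroup (BlockToeplitz.matH ℝ c α m)) (δ • 1) =
          BlockToeplitz.formGroup 1 ∧
        BlockToeplitz.stab (BlockToeplitz.formGroup (BlockToeplitz.matH ℝ c α m)) 0 =
          BlockToeplitz.formGroup 1) := by
  intro 𝒜 H G R C μ B Ψ 𝕆 𝕌 𝕏
  have hadm : BlockToeplitz.IsAdmissible c α B := BlockToeplitz.isAdmissible_matB 𝕜 c hα hα₀ hm
  have hred := BlockToeplitz.hasNoNormalUnipotent_matB (𝕜 := 𝕜) c hα hα₀ hm
  have hO : 𝕆 = BlockToeplitz.genO α B := BlockToeplitz.groupO_eq_genO 𝕜 c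
  have hU : 𝕌 = BlockToeplitz.genU α B c := rfl
  have hX : 𝕏 = BlockToeplitz.isoT α B := by
    rw [← hadm.sup_eq_isoT, ← hO, ← hU]
    rfl
  have hε0 : ε ≠ 0 := by
    rcases hε with rfl | rfl
    · exact one_ne_zero
    · exact neg_ne_zero.2 one_ne_zero
  have hstab : BlockToeplitz.stab G 𝒜 = C :=
    (BlockToeplitz.stab_smul_exp G BlockToeplitz.isNilpotent_matA hε0).symm
  have hC : C = 𝕏.comap Ψ.toMonoidHom := by
    rw [← hstab, hX]
    exact BlockToeplitz.stab_matA_eq_comap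
  have hmap : ∀ K : Subgroup (GeneralLinearGroup (BlockToeplitz.TIdx α μ) 𝕜),
      (K.comap Ψ.toMonoidHom).map Ψ.toMonoidHom = K := fun K =>
    Subgroup.map_comap_eq_self_of_surjective Ψ.surjective K
  have hsemi : BlockToeplitz.IsSemidirect 𝕏 𝕆 𝕌 := by
    rw [hX, hO, hU]
    exact hadm.isSemidirect
  have hskew := BlockToeplitz.matA_transpose_mul_matH (𝕜 := 𝕜) (c := c) (α := α) (m := m)
  have hdet := BlockToeplitz.isUnit_det_matH (𝕜 := 𝕜) (c := c) hα hα₀ hm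
  -- The reductive factor and the unipotent radical are the preimages of `𝕆` and `𝕌` under
  -- conjugation by `Ψ`.
  refine ⟨⟨hdet, BlockToeplitz.matH_transpose hα hα₀ hm, hskew,
      BlockToeplitz.exists_exp_mem_formGroup hdet hskew hε⟩, hstab,
    ⟨𝕆.comap Ψ.toMonoidHom, 𝕌.comap Ψ.toMonoidHom, ?_, ?_, ?_, hmap 𝕆, hmap 𝕌⟩, ?_, ?_, hsemi,
    fun Z hZ => ?_, fun p t k F hpt hk => ?_, ?_, BlockToeplitz.remainder_congr B hα, fun X => ?_,
    ⟨_, ?_, hadm.finrank_lieStab⟩, BlockToeplitz.exists_congruent_one_iff hN hα hα₀ hm hc,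
    BlockToeplitz.matA_eq_zero_iff ℝ hN hα hα₀ hm, ?_⟩
  · rw [hC]
    exact hsemi.comap Ψ
  · have h := BlockToeplitz.IsUnipotentRadical.comap Ψ
      BlockToeplitz.isNilpotent_sub_one_conjPsi_iff (hadm.isReductive hred)
    rw [← hO] at h
    have hbot : (⊥ : Subgroup (GeneralLinearGroup (BlockToeplitz.TIdx α μ) 𝕜)).comap
        Ψ.toMonoidHom = ⊥ := (MonoidHom.ker_eq_bot_iff _).2 Ψ.injective
    rw [hbot] at h
    exact h
  · rw [hC, hX, hU]
    exact (hadm.isUnipotentRadical hred).comap Ψ BlockToeplitz.isNilpotent_sub_one_conjPsi_iff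
  · rw [hC, hmap]
  · rw [hX]
    exact hadm.isoT_subset
  · obtain ⟨X, hX'⟩ := hadm.exists_isDiagGen hZ
    exact ⟨X, Subgroup.subset_closure (Or.inl ⟨Z, hZ, hX'⟩), hX'⟩
  · obtain ⟨X, -, hX'⟩ := hadm.exists_isOffDiagGen hpt hk F
    exact ⟨X, Subgroup.subset_closure (Or.inr ⟨p, t, k, F, hpt, hk, hX'⟩), hX'⟩
  · rw [hX]
    exact hadm.satisfiesConditions
  · rw [hX]
    exact hadm.mem_isoT_iff
  · rw [hX]
    exact BlockToeplitz.hasDimension_stab _ (BlockToeplitz.isUnit_det_formT B hadm.isUnit)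
  · rintro rfl hN1 h1
    have hA := (BlockToeplitz.matA_eq_zero_iff (c := 1) ℝ hN hα hα₀ hm).2 ⟨hN1, h1⟩
    have hH := BlockToeplitz.matH_eq_one (m := m) ℝ h1
    refine ⟨by rw [hH], hA, fun δ _ => ⟨by rw [hA, NormedSpace.exp_zero], ?_, ?_⟩⟩
    · rw [hH, BlockToeplitz.stab_smul_one]
    · rw [hH, BlockToeplitz.stab_zero]
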